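/- Let $0<q<1$, $\lambda=q-q^{-1}$, $[u]=(q^u-q^{-u})/\lambda$. **Algebras.** $A=A(SU_q(2))$ is the complex $*$-algebra generated by $a,c$ with $ac=qca$, $ac^*=qc^*a$, $cc^*=c^*c$, $a^*a+c^*c=1=aa^*+q^2cc^*$. $U=U_q(su(2))$ is generated by $K^{\pm1},E,F$ with $KE=qEK$, $KF=q^{-1}FK$, $EF-FE=\lambda^{-1}(K^2-K^{-2})$; $K$ is group-like and $\Delta E=E\otimes K+K^{-1}\otimes E$, $\Delta F=F\otimes K+K^{-1}\otimes F$. $\triangleright,\triangleleft$ are the left and right actions of $U$ on $A$ given by the standard dual pairing. They make $A$ a module algebra and satisfy $K\triangleright a=q^{-1/2}a$, $K\triangleright c=q^{-1/2}c$, $K\triangleright a^*=q^{1/2}a^*$, $K\triangleright c^*=q^{1/2}c^*$; $E\triangleright a=-qc^*$, $E\triangleright c=a^*$, $E\triangleright a^*=E\triangleright c^*=0$; $F\triangleright a^*=c$, $F\triangleright c^*=-q^{-1}a$, $F\triangleright a=F\triangleright c=0$; $a\triangleleft K=q^{-1/2}a$, $c\triangleleft K=q^{1/2}c$, $a^*\triangleleft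 K=q^{1/2}a^*$, $c^*\triangleleft K=q^{-1/2}c^*$; $c\triangleleft E=a$, $a^*\triangleleft E=-qc^*$, $a\triangleleft E=c^*\triangleleft E=0$. **Calculus.** Put $$L_-=q^{1/2}FK^{-1},\quad L_+=q^{-1/2}EK^{-1},\quad L_z=\lambda^{-1}(K^{-2}-1),\quad L_0=\lambda^{-2}\big(q(K^2-1)+q^{-1}(K^{-2}-1)\big)+FE .$$ These span the quantum tangent space of Woronowicz's four dimensional bicovariant calculus $4D_+$: $\Omega^1$ is the free left $A$-module on left invariant forms $\omega_-,\omega_+,\omega_0,\omega_z$ with $dx=\sum_a(L_a\triangleright x)\,\omega_a$ and $\omega_a x=\sum_b(f_{ab}\triangleright x)\,\omega_b$, where $\Delta L_a=1\otimes L_a+\sum_bL_b\otimes f_{ba}$; $\omega_\mp^*=-\omega_\pm$, $\omega_0^*=-\omega_0$, $\omega_z^*=-\omega_z$. The right $U(1)$-coaction gives $\omega_\pm$ the charges $\pm2$ and $\omega_0,\omega_z$ the charge $0$. Let $\sigma^{+}=\sigma$ be the canonical braiding of $\Omega^1\otimes_A\Omega^1$ and $\sigma^-=\sigma^{-1}$.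 Let $A^{(k)}_\pm=\sum_{p\in S_k}\mathrm{sgn}(p)\,\mathfrak P_\pm(p)$ be the antisymmetriser built from $\sigma^\pm$ through reduced words, $\Omega^k_\pm=\mathrm{Range}\,A^{(k)}_\pm$, with $\eta_1\wedge\dots\wedge\eta_k=A^{(k)}_\pm(\eta_1\otimes\dots\otimes\eta_k)$ and $d$ the exterior derivative, and let $B_{1,k-1}=1-\sigma^\pm_1+\sigma^\pm_1\sigma^\pm_2-\cdots$, so that $A^{(k)}_\pm=(1\otimes A^{(k-1)}_\pm)B_{1,k-1}$. **Metrics.** $\mathfrak G_\sigma$ is the set of non degenerate $A$-bimodule maps $g:\Omega^1\otimes_A\Omega^1\to A$ with $g(\omega_a,\omega_b)\in\mathbb C$ (left invariance), $g(\omega_a,\omega_b)=0$ unless the charges of $\omega_a,\omega_b$ add up to $0$ (right $U(1)$-coinvariance), $g(\omega_a,\omega_b)^*=g(\omega_b^*,\omega_a^*)$ (reality), and $g\circ\sigma^\pm=g$, $(g\otimes1)\circ\sigma^\pm_2=(1\otimes g)\circ\sigma^\mp_1$. The sesquilinear contraction $\Gamma$ of $g$ on left invariant one-forms is given by $g(\omega_a,\omega_b)=\Gamma(\omega_a^*,\omega_b)$;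 it extends factorwise to tensors of left invariant forms. Put $\alpha=\Gamma(\omega_-,\omega_-)=-g(\omega_+,\omega_-)$. **Hodge operators and Laplacians.** For $m\in\mathbb R$ let $\vartheta=i\,m\,\omega_-\otimes\omega_+\otimes\omega_0\otimes\omega_z$. On left invariant forms of degree $0,1,4$ put $\mathfrak T^\pm(1)=\mu=A^{(4)}_\pm\vartheta$, $\mathfrak T^\pm(\omega_a)=\big(A^{(3)}_\pm\,\Gamma(\omega_a,B_{1,3}\vartheta)\big)^*$, where $\omega_a$ is contracted with the first tensor factor, and $\mathfrak T^\pm(\xi)=\Gamma(\xi,\vartheta)^*$ for $\xi$ of degree 4. Put $\det_q\Gamma=\Gamma(\vartheta,A^{(4)}_\pm\vartheta)$ at $m=1$ and $\mathrm{sgn}\,\Gamma=\det_q\Gamma/|\det_q\Gamma|$. Let $\det_q\Gamma\ne0$ and let $m$ be chosen so that $(\mathfrak T^\pm)^2(1)=\mathrm{sgn}\,\Gamma$. Set $\star^L(x\xi)=x\,\mathfrak T^\pm(\xi)$ and $\star^R(\xi x)=\mathfrak T^\pm(\xi)\,x$ for $x\in A$ and $\xi$ left invariant, and on $A$ $$\Box^L=-\star^Ld\star^Ld,\qquad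 \Box^R=-\star^Rd\star^Rd .$$ **Theorem.** 1. $L_0$ is central in $U$, and the quantum Casimir $C_q=\lambda^{-2}(qK^2-2+q^{-1}K^{-2})+FE-\tfrac14$ equals $L_0+[\tfrac12]^2-\tfrac14$. 2. The elements $\phi_{n,J,l}=\big(c^{J-n/2}(a^*)^{J+n/2}\big)\triangleleft E^l$, with $n\in\mathbb Z$, $J\in\tfrac{|n|}2+\mathbb N$ and $l=0,\dots,2J$ (here $0\in\mathbb N$), form a basis of $A$, and $L_0\triangleright\phi_{n,J,l}=[J][J+1]\,\phi_{n,J,l}$. 3. For every $g\in\mathfrak G_\sigma$, either choice of the sign $\pm$, every $m$ normalised as above and all $x\in A$, $$\Box^Lx=-\alpha\,\{L_+L_-+q^2L_-L_++(1+q^2)L_zL_z-2(q^2-1)L_0L_z\}\triangleright x=-2q\alpha\,L_0\triangleright x,$$ that is $\Box^L=2q\,\mathsf a\,L_0$ with $\mathsf a=-\alpha=g(\omega_+,\omega_-)$. Hence $\Box^L\phi_{n,J,l}=-2q\alpha\,[J][J+1]\,\phi_{n,J,l}$. Moreover $\Box^R=\Box^L$. -/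

import Mathlib

open scoped Matrix

namespace QSU2

/-! ## Scalars -/

/-- The deformation parameter, a real number with `0 < q < 1`. -/
abbrev Param : Type := Set.Ioo (0 : ℝ) 1

/-- `q` as a complex number. -/
noncomputable def qc (q : Param) : ℂ := ((q : ℝ) : ℂ)

/-- `q^{1/2}` as a complex number. -/
noncomputable def qh (q : Param) : ℂ := ((Real.sqrt (q : ℝ) : ℝ) : ℂ)

/-- `q - q⁻¹`. -/
noncomputable def lam (q : Param) : ℂ := qc q - (qc q)⁻¹

/-- The `q`-number `[u] = (q^u - q^{-u}) / (q - q⁻¹)`, `u` real. -/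
noncomputable def qnum (q : Param) (u : ℝ) : ℝ :=
  ((q : ℝ) ^ u - (q : ℝ) ^ (-u)) / ((q : ℝ) - (q : ℝ)⁻¹)

theorem qh_mul_qh (q : Param) : qh q * qh q = qc q := by
  rw [qh, qc, ← Complex.ofReal_mul, Real.mul_self_sqrt q.2.1.le]

theorem qc_ne_zero (q : Param) : qc q ≠ 0 := by
  rw [qc]; exact_mod_cast q.2.1.ne'

theorem qh_ne_zero (q : Param) : qh q ≠ 0 := by
  intro h
  apply qc_ne_zero q
  rw [← qh_mul_qh, h, zero_mul]

theorem qc_inv (q : Param) : (qc q)⁻¹ = (qh q)⁻¹ * (qh q)⁻¹ := by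
  rw [← qh_mul_qh, mul_inv]

/-! ## The coordinate algebra `A(SU_q(2))` -/

/-- Generators `a, a*, c, c*`. -/
inductive AGen
  | a | as | c | cs

/-- The defining relations of `A(SU_q(2))` as a `*`-algebra, together with their conjugates. -/
inductive ARel (q : Param) : FreeAlgebra ℂ AGen → FreeAlgebra ℂ AGen → Prop
  | ac : ARel q (FreeAlgebra.ι ℂ .a * FreeAlgebra.ι ℂ .c)
      (qc q • (FreeAlgebra.ι ℂ .c * FreeAlgebra.ι ℂ .a))
  | acs : ARel q (FreeAlgebra.ι ℂ .a * FreeAlgebra.ι ℂ .cs)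
      (qc q • (FreeAlgebra.ι ℂ .cs * FreeAlgebra.ι ℂ .a))
  | csas : ARel q (FreeAlgebra.ι ℂ .cs * FreeAlgebra.ι ℂ .as)
      (qc q • (FreeAlgebra.ι ℂ .as * FreeAlgebra.ι ℂ .cs))
  | cas : ARel q (FreeAlgebra.ι ℂ .c * FreeAlgebra.ι ℂ .as)
      (qc q • (FreeAlgebra.ι ℂ .as * FreeAlgebra.ι ℂ .c))
  | ccs : ARel q (FreeAlgebra.ι ℂ .c * FreeAlgebra.ι ℂ .cs)
      (FreeAlgebra.ι ℂ .cs * FreeAlgebra.ι ℂ .c)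
  | asa : ARel q (FreeAlgebra.ι ℂ .as * FreeAlgebra.ι ℂ .a
      + FreeAlgebra.ι ℂ .cs * FreeAlgebra.ι ℂ .c) 1
  | aas : ARel q (FreeAlgebra.ι ℂ .a * FreeAlgebra.ι ℂ .as
      + (qc q * qc q) • (FreeAlgebra.ι ℂ .c * FreeAlgebra.ι ℂ .cs)) 1

/-- The polynomial algebra `A(SU_q(2))`. -/
def A (q : Param) : Type := RingQuot (ARel q)

noncomputable instance (q : Param) : Ring (A q) := inferInstanceAs (Ring (RingQuot (ARel q)))

noncomputable instance (q : Param) : Algebra ℂ (A q) :=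
  inferInstanceAs (Algebra ℂ (RingQuot (ARel q)))

/-- The projection from the free algebra. -/
noncomputable def mkA (q : Param) : FreeAlgebra ℂ AGen →ₐ[ℂ] A q := RingQuot.mkAlgHom ℂ (ARel q)

theorem mkA_rel (q : Param) {x y : FreeAlgebra ℂ AGen} (h : ARel q x y) : mkA q x = mkA q y :=
  RingQuot.mkAlgHom_rel ℂ h

/-- The generators in `A(SU_q(2))`. -/
noncomputable def gen (q : Param) (x : AGen) : A q := mkA q (FreeAlgebra.ι ℂ x)

theorem gen_ac (q : Param) : gen q .a * gen q .c = qc q • (gen q .c * gen q .a) := by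
  simpa only [gen, map_mul, map_smul, map_add, map_one] using mkA_rel q ARel.ac

theorem gen_acs (q : Param) : gen q .a * gen q .cs = qc q • (gen q .cs * gen q .a) := by
  simpa only [gen, map_mul, map_smul, map_add, map_one] using mkA_rel q ARel.acs

theorem gen_csas (q : Param) : gen q .cs * gen q .as = qc q • (gen q .as * gen q .cs) := by
  simpa only [gen, map_mul, map_smul, map_add, map_one] using mkA_rel q ARel.csas

theorem gen_cas (q : Param) : gen q .c * gen q .as = qc q • (gen q .as * gen q .c) := by
  simpa only [gen, map_mul, map_smul, map_add, map_one] using mkA_rel q ARel.cas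

theorem gen_ccs (q : Param) : gen q .c * gen q .cs = gen q .cs * gen q .c := by
  simpa only [gen, map_mul, map_smul, map_add, map_one] using mkA_rel q ARel.ccs

theorem gen_asa (q : Param) : gen q .as * gen q .a + gen q .cs * gen q .c = 1 := by
  simpa only [gen, map_mul, map_smul, map_add, map_one] using mkA_rel q ARel.asa

theorem gen_aas (q : Param) :
    gen q .a * gen q .as + (qc q * qc q) • (gen q .cs * gen q .c) = 1 := by
  rw [← gen_ccs]
  simpa only [gen, map_mul, map_smul, map_add, map_one] using mkA_rel q ARel.aas

/-- `a a*` in normal form. -/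
theorem gen_aas' (q : Param) :
    gen q .a * gen q .as = 1 - (qc q * qc q) • (gen q .cs * gen q .c) :=
  eq_sub_of_add_eq (gen_aas q)

/-- `a* a` in normal form. -/
theorem gen_asa' (q : Param) : gen q .as * gen q .a = 1 - gen q .cs * gen q .c :=
  eq_sub_of_add_eq (gen_asa q)

theorem A_induction (q : Param) {P : A q → Prop} (hs : ∀ r : ℂ, P (algebraMap ℂ (A q) r))
    (hg : ∀ x, P (gen q x)) (hm : ∀ x y, P x → P y → P (x * y))
    (ha : ∀ x y, P x → P y → P (x + y)) (x : A q) : P x := by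
  obtain ⟨y, rfl⟩ : ∃ y, mkA q y = x := RingQuot.mkAlgHom_surjective ℂ (ARel q) x
  induction y using FreeAlgebra.induction with
  | grade0 r => simpa only [AlgHom.commutes] using hs r
  | grade1 x => exact hg x
  | mul x y hx hy => simpa only [map_mul] using hm _ _ hx hy
  | add x y hx hy => simpa only [map_add] using ha _ _ hx hy

/-- Algebra maps out of `A(SU_q(2))`. -/
noncomputable def liftA (q : Param) {B : Type*} [Ring B] [Algebra ℂ B] (v : AGen → B)
    (h1 : v .a * v .c = qc q • (v .c * v .a)) (h2 : v .a * v .cs = qc q • (v .cs * v .a))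
    (h3 : v .cs * v .as = qc q • (v .as * v .cs)) (h4 : v .c * v .as = qc q • (v .as * v .c))
    (h5 : v .c * v .cs = v .cs * v .c) (h6 : v .as * v .a + v .cs * v .c = 1)
    (h7 : v .a * v .as + (qc q * qc q) • (v .c * v .cs) = 1) : A q →ₐ[ℂ] B :=
  RingQuot.liftAlgHom ℂ ⟨FreeAlgebra.lift ℂ v, by
    intro x y h
    induction h <;> simp only [map_mul, map_smul, map_add, map_one, FreeAlgebra.lift_ι_apply] <;>
      assumption⟩

theorem liftA_gen (q : Param) {B : Type*} [Ring B] [Algebra ℂ B] (v : AGen → B)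
    (h1 h2 h3 h4 h5 h6 h7) (x : AGen) :
    liftA q v h1 h2 h3 h4 h5 h6 h7 (gen q x) = v x := by
  rw [liftA, gen, mkA]
  exact (RingQuot.liftAlgHom_mkAlgHom_apply ℂ _ _ _).trans (FreeAlgebra.lift_ι_apply _ _)

theorem A_algHom_ext (q : Param) {B : Type*} [Ring B] [Algebra ℂ B] {φ ψ : A q →ₐ[ℂ] B}
    (h : ∀ x, φ (gen q x) = ψ (gen q x)) : φ = ψ := by
  ext x
  induction x using A_induction with
  | hs r => simp only [AlgHom.commutes]
  | hg x => exact h x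
  | hm x y hx hy => simp only [map_mul, hx, hy]
  | ha x y hx hy => simp only [map_add, hx, hy]

/-! ## The actions of the generators of `U_q(su(2))` on `A(SU_q(2))` -/

/-- Generator-wise rescaling `a, c ↦ t·a, t·c` and `a*, c* ↦ t⁻¹·a*, t⁻¹·c*`. -/
noncomputable def kScale (q : Param) (t : ℂ) (ht : t ≠ 0) : A q →ₐ[ℂ] A q :=
  liftA q (fun
      | .a => t • gen q .a
      | .c => t • gen q .c
      | .as => t⁻¹ • gen q .as
      | .cs => t⁻¹ • gen q .cs)
    (by simp only [smul_mul_smul_comm, gen_ac]; module)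
    (by simp only [smul_mul_smul_comm, gen_acs]; module)
    (by simp only [smul_mul_smul_comm, gen_csas]; module)
    (by simp only [smul_mul_smul_comm, gen_cas]; module)
    (by simp only [smul_mul_smul_comm, gen_ccs]; module)
    (by simp only [smul_mul_smul_comm, inv_mul_cancel₀ ht, one_smul, gen_asa])
    (by simp only [smul_mul_smul_comm, mul_inv_cancel₀ ht, one_smul, gen_ccs, gen_aas])

/-- `x ↦ K ▷ x`. -/
noncomputable def kL (q : Param) : A q →ₐ[ℂ] A q :=
  kScale q (qh q)⁻¹ (inv_ne_zero (qh_ne_zero q))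

/-- `x ↦ K⁻¹ ▷ x`. -/
noncomputable def kiL (q : Param) : A q →ₐ[ℂ] A q := kScale q (qh q) (qh_ne_zero q)

/-- Upper triangular `2 × 2` matrices. -/
def upper {R : Type*} [Zero R] (x y z : R) : Matrix (Fin 2) (Fin 2) R := !![x, y; 0, z]

theorem upper_mul {R : Type*} [Ring R] (x y z x' y' z' : R) :
    upper x y z * upper x' y' z' = upper (x * x') (x * y' + y * z') (z * z') := by
  simp [upper]

theorem upper_add {R : Type*} [Ring R] (x y z x' y' z' : R) :
    upper x y z + upper x' y' z' = upper (x + x') (y + y') (z + z') := by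
  ext i j; fin_cases i <;> fin_cases j <;> simp [upper]

theorem smul_upper {R : Type*} [Ring R] [Algebra ℂ R] (r : ℂ) (x y z : R) :
    r • upper x y z = upper (r • x) (r • y) (r • z) := by
  ext i j; fin_cases i <;> fin_cases j <;> simp [upper]

theorem upper_one {R : Type*} [Ring R] : (upper 1 0 1 : Matrix (Fin 2) (Fin 2) R) = 1 := by
  ext i j; fin_cases i <;> fin_cases j <;> simp [upper]

/-- `x ↦ [[K⁻¹ ▷ x, E ▷ x], [0, K ▷ x]]`; multiplicativity of this map is the rule
`E ▷ (x y) = (E ▷ x) (K ▷ y) + (K⁻¹ ▷ x) (E ▷ y)`. -/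
noncomputable def eLMat (q : Param) : A q →ₐ[ℂ] Matrix (Fin 2) (Fin 2) (A q) := by
  refine liftA q (fun
      | .a => upper (qh q • gen q .a) (-(qc q • gen q .cs)) ((qh q)⁻¹ • gen q .a)
      | .c => upper (qh q • gen q .c) (gen q .as) ((qh q)⁻¹ • gen q .c)
      | .as => upper ((qh q)⁻¹ • gen q .as) 0 (qh q • gen q .as)
      | .cs => upper ((qh q)⁻¹ • gen q .cs) 0 (qh q • gen q .cs))
    ?_ ?_ ?_ ?_ ?_ ?_ ?_ <;>
  have h0 := qh_ne_zero q <;>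
  simp only [upper_mul, upper_add, smul_upper, ← upper_one, gen_ac, gen_acs, gen_csas, gen_cas,
    gen_ccs, gen_aas', gen_asa', ← qh_mul_qh, neg_mul, mul_neg, smul_mul_assoc, mul_smul_comm,
    mul_zero, zero_mul, add_zero, zero_add, smul_zero] <;>
  congr 1 <;> match_scalars <;> field_simp <;> ring

/-- `x ↦ [[K⁻¹ ▷ x, F ▷ x], [0, K ▷ x]]`; multiplicativity of this map is the rule
`F ▷ (x y) = (F ▷ x) (K ▷ y) + (K⁻¹ ▷ x) (F ▷ y)`. -/
noncomputable def fLMat (q : Param) : A q →ₐ[ℂ] Matrix (Fin 2) (Fin 2) (A q) := by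
  refine liftA q (fun
      | .a => upper (qh q • gen q .a) 0 ((qh q)⁻¹ • gen q .a)
      | .c => upper (qh q • gen q .c) 0 ((qh q)⁻¹ • gen q .c)
      | .as => upper ((qh q)⁻¹ • gen q .as) (gen q .c) (qh q • gen q .as)
      | .cs => upper ((qh q)⁻¹ • gen q .cs) (-((qc q)⁻¹ • gen q .a)) (qh q • gen q .cs))
    ?_ ?_ ?_ ?_ ?_ ?_ ?_ <;>
  have h0 := qh_ne_zero q <;>
  simp only [upper_mul, upper_add, smul_upper, ← upper_one, gen_ac, gen_acs, gen_csas, gen_cas,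
    gen_ccs, gen_aas', gen_asa', ← qh_mul_qh, neg_mul, mul_neg, smul_mul_assoc, mul_smul_comm,
    mul_zero, zero_mul, add_zero, zero_add, smul_zero] <;>
  congr 1 <;> match_scalars <;> field_simp <;> ring

/-- `x ↦ [[x ◁ K⁻¹, x ◁ E], [0, x ◁ K]]`; multiplicativity of this map is the rule
`(x y) ◁ E = (x ◁ E) (y ◁ K) + (x ◁ K⁻¹) (y ◁ E)`. -/
noncomputable def eRMat (q : Param) : A q →ₐ[ℂ] Matrix (Fin 2) (Fin 2) (A q) := by
  refine liftA q (fun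
      | .a => upper (qh q • gen q .a) 0 ((qh q)⁻¹ • gen q .a)
      | .c => upper ((qh q)⁻¹ • gen q .c) (gen q .a) (qh q • gen q .c)
      | .as => upper ((qh q)⁻¹ • gen q .as) (-(qc q • gen q .cs)) (qh q • gen q .as)
      | .cs => upper (qh q • gen q .cs) 0 ((qh q)⁻¹ • gen q .cs))
    ?_ ?_ ?_ ?_ ?_ ?_ ?_ <;>
  have h0 := qh_ne_zero q <;>
  simp only [upper_mul, upper_add, smul_upper, ← upper_one, gen_ac, gen_acs, gen_csas, gen_cas,
    gen_ccs, gen_aas', gen_asa', ← qh_mul_qh, neg_mul, mul_neg, smul_mul_assoc, mul_smul_comm,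
    mul_zero, zero_mul, add_zero, zero_add, smul_zero] <;>
  congr 1 <;> match_scalars <;> field_simp <;> ring

/-- `x ↦ E ▷ x`. -/
noncomputable def eL (q : Param) : Module.End ℂ (A q) :=
  (Matrix.entryLinearMap ℂ (A q) 0 1).comp (eLMat q).toLinearMap

/-- `x ↦ F ▷ x`. -/
noncomputable def fL (q : Param) : Module.End ℂ (A q) :=
  (Matrix.entryLinearMap ℂ (A q) 0 1).comp (fLMat q).toLinearMap

/-- `x ↦ x ◁ E`. -/
noncomputable def eR (q : Param) : Module.End ℂ (A q) :=
  (Matrix.entryLinearMap ℂ (A q) 0 1).comp (eRMat q).toLinearMap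

theorem kL_gen (q : Param) :
    kL q (gen q .a) = (qh q)⁻¹ • gen q .a ∧ kL q (gen q .c) = (qh q)⁻¹ • gen q .c ∧
    kL q (gen q .as) = qh q • gen q .as ∧ kL q (gen q .cs) = qh q • gen q .cs := by
  refine ⟨?_, ?_, ?_, ?_⟩ <;> rw [kL, kScale, liftA_gen] <;> simp only [inv_inv]

theorem kiL_gen (q : Param) :
    kiL q (gen q .a) = qh q • gen q .a ∧ kiL q (gen q .c) = qh q • gen q .c ∧
    kiL q (gen q .as) = (qh q)⁻¹ • gen q .as ∧ kiL q (gen q .cs) = (qh q)⁻¹ • gen q .cs := by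
  refine ⟨?_, ?_, ?_, ?_⟩ <;> rw [kiL, kScale, liftA_gen]

theorem eL_gen (q : Param) :
    eL q (gen q .a) = -(qc q • gen q .cs) ∧ eL q (gen q .c) = gen q .as ∧
    eL q (gen q .as) = 0 ∧ eL q (gen q .cs) = 0 := by
  refine ⟨?_, ?_, ?_, ?_⟩ <;>
  · change (eLMat q _) 0 1 = _
    rw [eLMat, liftA_gen]
    simp [upper]

theorem fL_gen (q : Param) :
    fL q (gen q .a) = 0 ∧ fL q (gen q .c) = 0 ∧
    fL q (gen q .as) = gen q .c ∧ fL q (gen q .cs) = -((qc q)⁻¹ • gen q .a) := by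
  refine ⟨?_, ?_, ?_, ?_⟩ <;>
  · change (fLMat q _) 0 1 = _
    rw [fLMat, liftA_gen]
    simp [upper]

theorem eLMat_eq (q : Param) (x : A q) : eLMat q x = upper (kiL q x) (eL q x) (kL q x) := by
  have h : ∀ x, eLMat q x 0 0 = kiL q x ∧ eLMat q x 1 0 = 0 ∧ eLMat q x 1 1 = kL q x := by
    intro x
    induction x using A_induction with
    | hs r =>
      simp only [AlgHom.commutes]
      simp [Matrix.algebraMap_matrix_apply]
    | hg x =>
      have hk := kL_gen q
      have hi := kiL_gen q
      rw [eLMat, liftA_gen]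
      cases x <;> simp [upper, hk, hi]
    | hm x y hx hy =>
      simp [Matrix.mul_apply, Fin.sum_univ_two, hx, hy]
    | ha x y hx hy => simp [hx, hy]
  ext i j
  fin_cases i <;> fin_cases j <;> simp [upper, h] <;> rfl

theorem fLMat_eq (q : Param) (x : A q) : fLMat q x = upper (kiL q x) (fL q x) (kL q x) := by
  have h : ∀ x, fLMat q x 0 0 = kiL q x ∧ fLMat q x 1 0 = 0 ∧ fLMat q x 1 1 = kL q x := by
    intro x
    induction x using A_induction with
    | hs r =>
      simp only [AlgHom.commutes]
      simp [Matrix.algebraMap_matrix_apply]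
    | hg x =>
      have hk := kL_gen q
      have hi := kiL_gen q
      rw [fLMat, liftA_gen]
      cases x <;> simp [upper, hk, hi]
    | hm x y hx hy =>
      simp [Matrix.mul_apply, Fin.sum_univ_two, hx, hy]
    | ha x y hx hy => simp [hx, hy]
  ext i j
  fin_cases i <;> fin_cases j <;> simp [upper, h] <;> rfl

/-- `Δ(E) = E ⊗ K + K⁻¹ ⊗ E`. -/
theorem eL_mul (q : Param) (x y : A q) :
    eL q (x * y) = eL q x * kL q y + kiL q x * eL q y := by
  have h : eLMat q (x * y) 0 1 = (eLMat q x * eLMat q y) 0 1 := by rw [map_mul]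
  rw [eLMat_eq, eLMat_eq, eLMat_eq, upper_mul] at h
  simpa [upper, add_comm] using h

/-- `Δ(F) = F ⊗ K + K⁻¹ ⊗ F`. -/
theorem fL_mul (q : Param) (x y : A q) :
    fL q (x * y) = fL q x * kL q y + kiL q x * fL q y := by
  have h : fLMat q (x * y) 0 1 = (fLMat q x * fLMat q y) 0 1 := by rw [map_mul]
  rw [fLMat_eq, fLMat_eq, fLMat_eq, upper_mul] at h
  simpa [upper, add_comm] using h

theorem eL_algebraMap (q : Param) (r : ℂ) : eL q (algebraMap ℂ (A q) r) = 0 := by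
  change eLMat q _ 0 1 = 0
  rw [AlgHom.commutes]
  simp [Matrix.algebraMap_matrix_apply]

theorem fL_algebraMap (q : Param) (r : ℂ) : fL q (algebraMap ℂ (A q) r) = 0 := by
  change fLMat q _ 0 1 = 0
  rw [AlgHom.commutes]
  simp [Matrix.algebraMap_matrix_apply]

theorem kL_kiL (q : Param) (x : A q) : kL q (kiL q x) = x := by
  have h : (kL q).comp (kiL q) = AlgHom.id ℂ (A q) := by
    apply A_algHom_ext
    have hk := kL_gen q
    have hi := kiL_gen q
    intro x
    cases x <;> simp [hk, hi, smul_smul, qh_ne_zero q]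
  exact congrArg (fun φ : A q →ₐ[ℂ] A q => φ x) h

theorem kiL_kL (q : Param) (x : A q) : kiL q (kL q x) = x := by
  have h : (kiL q).comp (kL q) = AlgHom.id ℂ (A q) := by
    apply A_algHom_ext
    have hk := kL_gen q
    have hi := kiL_gen q
    intro x
    cases x <;> simp [hk, hi, smul_smul, qh_ne_zero q]
  exact congrArg (fun φ : A q →ₐ[ℂ] A q => φ x) h

theorem kL_eL (q : Param) (x : A q) : kL q (eL q x) = qc q • eL q (kL q x) := by
  induction x using A_induction with
  | hs r => simp only [AlgHom.commutes, eL_algebraMap, map_zero, smul_zero]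
  | hg x =>
    have h0 := qh_ne_zero q
    cases x <;> simp only [kL_gen, eL_gen, map_smul, map_neg, map_zero, smul_zero,
      ← qh_mul_qh] <;> match_scalars <;> field_simp
  | hm x y hx hy =>
    simp only [eL_mul, map_mul, map_add, hx, hy, kL_kiL, kiL_kL, smul_add, smul_mul_assoc,
      mul_smul_comm]
  | ha x y hx hy => simp only [map_add, hx, hy, smul_add]

theorem kL_fL (q : Param) (x : A q) : kL q (fL q x) = (qc q)⁻¹ • fL q (kL q x) := by
  induction x using A_induction with
  | hs r => simp only [AlgHom.commutes, fL_algebraMap, map_zero, smul_zero]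
  | hg x =>
    have h0 := qh_ne_zero q
    cases x <;> simp only [kL_gen, fL_gen, map_smul, map_neg, map_zero, smul_zero,
      ← qh_mul_qh] <;> match_scalars <;> field_simp
  | hm x y hx hy =>
    simp only [fL_mul, map_mul, map_add, hx, hy, kL_kiL, kiL_kL, smul_add, smul_mul_assoc,
      mul_smul_comm]
  | ha x y hx hy => simp only [map_add, hx, hy, smul_add]

theorem kiL_eL (q : Param) (x : A q) : kiL q (eL q x) = (qc q)⁻¹ • eL q (kiL q x) := by
  have h := kL_eL q (kiL q x)
  rw [kL_kiL] at h
  have h2 := congrArg (kiL q) h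
  rw [kiL_kL, map_smul] at h2
  rw [h2, smul_smul, inv_mul_cancel₀ (qc_ne_zero q), one_smul]

theorem kiL_fL (q : Param) (x : A q) : kiL q (fL q x) = qc q • fL q (kiL q x) := by
  have h := kL_fL q (kiL q x)
  rw [kL_kiL] at h
  have h2 := congrArg (kiL q) h
  rw [kiL_kL, map_smul] at h2
  rw [h2, smul_smul, mul_inv_cancel₀ (qc_ne_zero q), one_smul]

theorem lam_ne_zero (q : Param) : lam q ≠ 0 := by
  have h0 : (q : ℝ) ≠ 0 := q.2.1.ne'
  have h : ((q : ℝ) - (q : ℝ)⁻¹) ≠ 0 := by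
    have h1 : 1 < (q : ℝ)⁻¹ := (one_lt_inv₀ q.2.1).2 q.2.2
    have h2 : (q : ℝ) < 1 := q.2.2
    linarith
  rw [lam, qc]
  exact_mod_cast h

theorem eL_fL_comm (q : Param) (x : A q) :
    eL q (fL q x) - fL q (eL q x) = (lam q)⁻¹ • (kL q (kL q x) - kiL q (kiL q x)) := by
  induction x using A_induction with
  | hs r => simp only [AlgHom.commutes, fL_algebraMap, eL_algebraMap, map_zero, sub_self, smul_zero]
  | hg x =>
    have h0 := qh_ne_zero q
    have h1 := lam_ne_zero q
    rw [← smul_right_injective (A q) h1 |>.eq_iff]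
    simp only [smul_inv_smul₀ h1]
    simp only [lam, ← qh_mul_qh]
    cases x <;> simp only [kL_gen, kiL_gen, fL_gen, eL_gen, map_smul, map_neg, map_zero,
      ← qh_mul_qh] <;> match_scalars <;> field_simp <;> ring
  | hm x y hx hy =>
    have hx' := sub_eq_iff_eq_add.1 hx
    have hy' := sub_eq_iff_eq_add.1 hy
    have h0 := qc_ne_zero q
    simp only [eL_mul, fL_mul, map_mul, map_add, hx', hy', kL_eL, kL_fL, kiL_fL, kiL_eL, smul_mul_assoc, mul_smul_comm, add_mul, mul_add, sub_mul, mul_sub, smul_sub]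
    match_scalars <;> field_simp <;> ring
  | ha x y hx hy =>
    have hx' := sub_eq_iff_eq_add.1 hx
    have hy' := sub_eq_iff_eq_add.1 hy
    simp only [map_add, hx', hy']
    module

/-! ## The quantum universal enveloping algebra `U_q(su(2))` -/

/-- Generators `K, K⁻¹, E, F`. -/
inductive UGen
  | K | Ki | E | F

/-- The defining relations of `U_q(su(2))`. -/
inductive URel (q : Param) : FreeAlgebra ℂ UGen → FreeAlgebra ℂ UGen → Prop
  | KKi : URel q (FreeAlgebra.ι ℂ .K * FreeAlgebra.ι ℂ .Ki) 1
  | KiK : URel q (FreeAlgebra.ι ℂ .Ki * FreeAlgebra.ι ℂ .K) 1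
  | KE : URel q (FreeAlgebra.ι ℂ .K * FreeAlgebra.ι ℂ .E)
      (qc q • (FreeAlgebra.ι ℂ .E * FreeAlgebra.ι ℂ .K))
  | KiE : URel q (FreeAlgebra.ι ℂ .Ki * FreeAlgebra.ι ℂ .E)
      ((qc q)⁻¹ • (FreeAlgebra.ι ℂ .E * FreeAlgebra.ι ℂ .Ki))
  | KF : URel q (FreeAlgebra.ι ℂ .K * FreeAlgebra.ι ℂ .F)
      ((qc q)⁻¹ • (FreeAlgebra.ι ℂ .F * FreeAlgebra.ι ℂ .K))
  | KiF : URel q (FreeAlgebra.ι ℂ .Ki * FreeAlgebra.ι ℂ .F)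
      (qc q • (FreeAlgebra.ι ℂ .F * FreeAlgebra.ι ℂ .Ki))
  | EF : URel q (FreeAlgebra.ι ℂ .E * FreeAlgebra.ι ℂ .F
        - FreeAlgebra.ι ℂ .F * FreeAlgebra.ι ℂ .E)
      ((lam q)⁻¹ • (FreeAlgebra.ι ℂ .K * FreeAlgebra.ι ℂ .K
        - FreeAlgebra.ι ℂ .Ki * FreeAlgebra.ι ℂ .Ki))

/-- The algebra `U_q(su(2))`. -/
def U (q : Param) : Type := RingQuot (URel q)

noncomputable instance (q : Param) : Ring (U q) := inferInstanceAs (Ring (RingQuot (URel q)))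

noncomputable instance (q : Param) : Algebra ℂ (U q) :=
  inferInstanceAs (Algebra ℂ (RingQuot (URel q)))

/-- The projection from the free algebra. -/
noncomputable def mkU (q : Param) : FreeAlgebra ℂ UGen →ₐ[ℂ] U q := RingQuot.mkAlgHom ℂ (URel q)

theorem mkU_rel (q : Param) {x y : FreeAlgebra ℂ UGen} (h : URel q x y) : mkU q x = mkU q y :=
  RingQuot.mkAlgHom_rel ℂ h

/-- The generators in `U_q(su(2))`. -/
noncomputable def ugen (q : Param) (x : UGen) : U q := mkU q (FreeAlgebra.ι ℂ x)

theorem u_KKi (q : Param) : ugen q .K * ugen q .Ki = 1 := by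
  simpa only [ugen, map_mul, map_smul, map_one] using mkU_rel q URel.KKi

theorem u_KiK (q : Param) : ugen q .Ki * ugen q .K = 1 := by
  simpa only [ugen, map_mul, map_smul, map_one] using mkU_rel q URel.KiK

theorem u_KE (q : Param) : ugen q .K * ugen q .E = qc q • (ugen q .E * ugen q .K) := by
  simpa only [ugen, map_mul, map_smul, map_one] using mkU_rel q URel.KE

theorem u_KiE (q : Param) : ugen q .Ki * ugen q .E = (qc q)⁻¹ • (ugen q .E * ugen q .Ki) := by
  simpa only [ugen, map_mul, map_smul, map_one] using mkU_rel q URel.KiE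

theorem u_KF (q : Param) : ugen q .K * ugen q .F = (qc q)⁻¹ • (ugen q .F * ugen q .K) := by
  simpa only [ugen, map_mul, map_smul, map_one] using mkU_rel q URel.KF

theorem u_KiF (q : Param) : ugen q .Ki * ugen q .F = qc q • (ugen q .F * ugen q .Ki) := by
  simpa only [ugen, map_mul, map_smul, map_one] using mkU_rel q URel.KiF

theorem u_EF (q : Param) : ugen q .E * ugen q .F - ugen q .F * ugen q .E
    = (lam q)⁻¹ • (ugen q .K * ugen q .K - ugen q .Ki * ugen q .Ki) := by
  simpa only [ugen, map_mul, map_smul, map_sub] using mkU_rel q URel.EF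

/-- Algebra maps out of `U_q(su(2))`. -/
noncomputable def liftU (q : Param) {B : Type*} [Ring B] [Algebra ℂ B] (v : UGen → B)
    (h1 : v .K * v .Ki = 1) (h2 : v .Ki * v .K = 1)
    (h3 : v .K * v .E = qc q • (v .E * v .K)) (h4 : v .Ki * v .E = (qc q)⁻¹ • (v .E * v .Ki))
    (h5 : v .K * v .F = (qc q)⁻¹ • (v .F * v .K)) (h6 : v .Ki * v .F = qc q • (v .F * v .Ki))
    (h7 : v .E * v .F - v .F * v .E = (lam q)⁻¹ • (v .K * v .K - v .Ki * v .Ki)) :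
    U q →ₐ[ℂ] B :=
  RingQuot.liftAlgHom ℂ ⟨FreeAlgebra.lift ℂ v, by
    intro x y h
    induction h <;> simp only [map_mul, map_smul, map_sub, map_one, FreeAlgebra.lift_ι_apply] <;>
      assumption⟩

theorem liftU_ugen (q : Param) {B : Type*} [Ring B] [Algebra ℂ B] (v : UGen → B)
    (h1 h2 h3 h4 h5 h6 h7) (x : UGen) :
    liftU q v h1 h2 h3 h4 h5 h6 h7 (ugen q x) = v x := by
  rw [liftU, ugen, mkU]
  exact (RingQuot.liftAlgHom_mkAlgHom_apply ℂ _ _ _).trans (FreeAlgebra.lift_ι_apply _ _)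

/-- The canonical left action `h ▷ x = x₍₁₎ ⟨h, x₍₂₎⟩` of `U_q(su(2))` on `A(SU_q(2))`.
It is the action for which `A(SU_q(2))` is a left module algebra and `h ▷ U = U ρ(h)` on the
matrix `U = [[a, -q c*], [c, a*]]`, with `ρ(h) = ⟨h, U⟩` given by `ρ(K) = diag(q^{-1/2}, q^{1/2})`,
`ρ(E) = [[0, 0], [1, 0]]` and `ρ(F) = [[0, 1], [0, 0]]`; see `kL_gen`, `eL_gen`, `fL_gen`,
`eL_mul`, `fL_mul`. -/
noncomputable def act (q : Param) : U q →ₐ[ℂ] Module.End ℂ (A q) :=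
  liftU q (fun
      | .K => (kL q).toLinearMap
      | .Ki => (kiL q).toLinearMap
      | .E => eL q
      | .F => fL q)
    (LinearMap.ext (kL_kiL q)) (LinearMap.ext (kiL_kL q)) (LinearMap.ext (kL_eL q))
    (LinearMap.ext (kiL_eL q)) (LinearMap.ext (kL_fL q)) (LinearMap.ext (kiL_fL q))
    (LinearMap.ext (eL_fL_comm q))

/-- The inverse `S⁻¹` of the antipode, an algebra map to the opposite algebra:
`S⁻¹(K) = K⁻¹`, `S⁻¹(E) = -q⁻¹ E`, `S⁻¹(F) = -q F`. -/
noncomputable def sInvOp (q : Param) : U q →ₐ[ℂ] (U q)ᵐᵒᵖ :=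
  liftU q (fun
      | .K => MulOpposite.op (ugen q .Ki)
      | .Ki => MulOpposite.op (ugen q .K)
      | .E => MulOpposite.op (-((qc q)⁻¹ • ugen q .E))
      | .F => MulOpposite.op (-(qc q • ugen q .F)))
    (MulOpposite.unop_injective (u_KKi q)) (MulOpposite.unop_injective (u_KiK q))
    (MulOpposite.unop_injective (by
      have h0 := qc_ne_zero q
      simp only [MulOpposite.unop_mul, MulOpposite.unop_smul, MulOpposite.unop_op, neg_mul,
        mul_neg, smul_mul_assoc, mul_smul_comm, u_KiE]
      match_scalars <;> field_simp))
    (MulOpposite.unop_injective (by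
      have h0 := qc_ne_zero q
      simp only [MulOpposite.unop_mul, MulOpposite.unop_smul, MulOpposite.unop_op, neg_mul,
        mul_neg, smul_mul_assoc, mul_smul_comm, u_KE]
      match_scalars <;> field_simp))
    (MulOpposite.unop_injective (by
      have h0 := qc_ne_zero q
      simp only [MulOpposite.unop_mul, MulOpposite.unop_smul, MulOpposite.unop_op, neg_mul,
        mul_neg, smul_mul_assoc, mul_smul_comm, u_KiF]
      match_scalars <;> field_simp))
    (MulOpposite.unop_injective (by
      have h0 := qc_ne_zero q
      simp only [MulOpposite.unop_mul, MulOpposite.unop_smul, MulOpposite.unop_op, neg_mul,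
        mul_neg, smul_mul_assoc, mul_smul_comm, u_KF]
      match_scalars <;> field_simp))
    (MulOpposite.unop_injective (by
      have h0 := qc_ne_zero q
      have h := u_EF q
      have h' : ugen q .E * ugen q .F = ugen q .F * ugen q .E
          + (lam q)⁻¹ • (ugen q .K * ugen q .K - ugen q .Ki * ugen q .Ki) := by
        rw [← h]; abel
      simp only [MulOpposite.unop_mul, MulOpposite.unop_smul, MulOpposite.unop_op,
        MulOpposite.unop_sub, neg_mul, mul_neg, smul_mul_assoc, mul_smul_comm, h']
      match_scalars <;> field_simp <;> ring))

/-- `S⁻¹` as a map `U_q(su(2)) → U_q(su(2))`. -/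
noncomputable def sInv (q : Param) (h : U q) : U q := (sInvOp q h).unop

/-! ## The tangent space of the four dimensional calculus and its first order calculus

The left invariant one-forms `ω₋, ω₊, ω₀, ω_z` are indexed by `0, 1, 2, 3 : Fin 4`. -/

/-- The basis `L₋, L₊, L₀, L_z` of the quantum tangent space. -/
noncomputable def L (q : Param) : Fin 4 → U q :=
  ![qh q • (ugen q .F * ugen q .Ki),
    (qh q)⁻¹ • (ugen q .E * ugen q .Ki),
    (lam q ^ 2)⁻¹ • (qc q • (ugen q .K * ugen q .K - 1)
      + (qc q)⁻¹ • (ugen q .Ki * ugen q .Ki - 1)) + ugen q .F * ugen q .E,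
    (lam q)⁻¹ • (ugen q .Ki * ugen q .Ki - 1)]

/-- The quantum Casimir element `C_q`. -/
noncomputable def casimir (q : Param) : U q :=
  (lam q ^ 2)⁻¹ • (qc q • (ugen q .K * ugen q .K) - (2 : ℂ) • 1
      + (qc q)⁻¹ • (ugen q .Ki * ugen q .Ki)) + ugen q .F * ugen q .E - (1 / 4 : ℂ) • 1

/-- The elements `f_{ab}` with `Δ(L_a) = 1 ⊗ L_a + ∑_b L_b ⊗ f_{ba}`. -/
noncomputable def f (q : Param) : Fin 4 → Fin 4 → U q :=
  ![![1, 0, (qh q)⁻¹ • (ugen q .K * ugen q .E), 0],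
    ![0, 1, (qh q)⁻¹ • (ugen q .F * ugen q .K), 0],
    ![0, 0, ugen q .K * ugen q .K, 0],
    ![lam q • L q 0, lam q • L q 1,
      lam q • (ugen q .F * ugen q .E)
        + (qc q * lam q)⁻¹ • (ugen q .Ki * ugen q .Ki - ugen q .K * ugen q .K),
      ugen q .Ki * ugen q .Ki]]

/-- The twisted Leibniz rule of the `L_a`, which fixes the `f_{ab}`. -/
theorem L_mul (q : Param) (a : Fin 4) (x y : A q) :
    act q (L q a) (x * y) = x * act q (L q a) y
      + ∑ b, act q (L q b) x * act q (f q b a) y := by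
  have hK : act q (ugen q .K) = (kL q).toLinearMap := by rw [act, liftU_ugen]
  have hKi : act q (ugen q .Ki) = (kiL q).toLinearMap := by rw [act, liftU_ugen]
  have hE : act q (ugen q .E) = eL q := by rw [act, liftU_ugen]
  have hF : act q (ugen q .F) = fL q := by rw [act, liftU_ugen]
  have h0 := qc_ne_zero q
  have h1 := qh_ne_zero q
  have h2 := lam_ne_zero q
  fin_cases a <;>
  simp only [L, f, Fin.sum_univ_four, Fin.isValue, Fin.zero_eta, Fin.mk_one, Fin.reduceFinMk,
    Matrix.cons_val_zero, Matrix.cons_val_one, Matrix.cons_val, map_smul, map_mul, map_add,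
    map_sub, map_one, map_zero, hK, hKi, hE, hF, Module.End.mul_apply, LinearMap.smul_apply,
    LinearMap.add_apply, LinearMap.sub_apply, LinearMap.zero_apply, Module.End.one_apply,
    AlgHom.toLinearMap_apply, eL_mul, fL_mul, kL_kiL, kL_eL, kiL_eL,
    mul_zero, add_zero, zero_add, smul_add, smul_sub, mul_add, mul_sub, add_mul, sub_mul,
    smul_mul_assoc, mul_smul_comm]
  all_goals
    have h3 := qh_mul_qh q
    match_scalars <;> field_simp <;> first | ring1 | linear_combination h3

/-! ## Tensor powers of the bimodule of one-forms, the braiding and the exterior algebra -/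

/-- Multi-indices. -/
abbrev W (k : ℕ) : Type := Fin k → Fin 4

/-- The tensor power `Ω^{⊗k}` over `A(SU_q(2))`. It is a free left module on the
`ω_I = ω_{I 0} ⊗ ⋯ ⊗ ω_{I (k-1)}`; the function `t` stands for `∑_I t I · ω_I`. -/
abbrev T (q : Param) (k : ℕ) : Type := W k → A q

/-- The product `f_{I 0, J 0} ⋯ f_{I (k-1), J (k-1)}`, so that
`ω_I · y = ∑_J (fT I J ▷ y) · ω_J` and `y · ω_I = ∑_J ω_J · (S⁻¹(fT I J) ▷ y)`. -/
noncomputable def fT (q : Param) {k : ℕ} (I J : W k) : U q :=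
  (List.ofFn fun i => f q (I i) (J i)).prod

/-- The right multiplication `t · y` on `Ω^{⊗k}`. -/
noncomputable def rmul (q : Param) {k : ℕ} (t : T q k) (y : A q) : T q k :=
  fun J => ∑ I, t I * act q (fT q I J) y

/-- The coordinates of a tensor in the right basis: `t = ∑_J ω_J · (rightCoord t J)`. -/
noncomputable def rightCoord (q : Param) {k : ℕ} (t : T q k) : T q k :=
  fun J => ∑ I, act q (sInv q (fT q I J)) (t I)

/-- The tensor `ω_c ⊗ ω_d`. -/
def e (c d : Fin 4) : Fin 4 → Fin 4 → ℂ := fun x y => if x = c ∧ y = d then 1 else 0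

/-- The canonical braiding of the calculus (`true`) and its inverse (`false`) on left invariant
two-tensors: `braid q s a b` is the tensor `σ^{±1}(ω_a ⊗ ω_b)`. -/
noncomputable def braid (q : Param) : Bool → Fin 4 → Fin 4 → (Fin 4 → Fin 4 → ℂ)
  | true, 0, 0 => e 0 0
  | true, 1, 1 => e 1 1
  | true, 2, 2 => e 2 2
  | true, 0, 2 => (1 - qc q ^ 2) • e 0 2 + e 2 0
  | true, 2, 0 => (qc q ^ 2) • e 0 2
  | true, 0, 3 => (1 + qc q ^ 2) • e 0 2 + e 3 0
  | true, 3, 0 => (-1 - (qc q ^ 2)⁻¹) • e 0 2 + ((qc q ^ 2)⁻¹) • e 0 3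
      + (1 - (qc q ^ 2)⁻¹) • e 3 0
  | true, 3, 2 => (-(lam q ^ 2)) • e 3 2 + e 2 3 - (lam q ^ 2) • e 0 1 + (lam q ^ 2) • e 1 0
  | true, 2, 3 => e 3 2
  | true, 3, 3 => (qc q ^ 2 - (qc q ^ 2)⁻¹) • e 3 2 + e 3 3
      + (qc q ^ 2 - (qc q ^ 2)⁻¹) • e 0 1 - (qc q ^ 2 - (qc q ^ 2)⁻¹) • e 1 0
  | true, 0, 1 => -e 3 2 + e 1 0
  | true, 1, 0 => e 3 2 + e 0 1
  | true, 1, 2 => (1 - (qc q ^ 2)⁻¹) • e 1 2 + e 2 1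
  | true, 2, 1 => ((qc q ^ 2)⁻¹) • e 1 2
  | true, 1, 3 => (-1 - (qc q ^ 2)⁻¹) • e 1 2 + e 3 1
  | true, 3, 1 => (1 + qc q ^ 2) • e 1 2 + (qc q ^ 2) • e 1 3 + (1 - qc q ^ 2) • e 3 1
  | false, 0, 0 => e 0 0
  | false, 1, 1 => e 1 1
  | false, 2, 2 => e 2 2
  | false, 0, 2 => ((qc q ^ 2)⁻¹) • e 2 0
  | false, 2, 0 => e 0 2 + (1 - (qc q ^ 2)⁻¹) • e 2 0
  | false, 0, 3 => (1 + qc q ^ 2) • e 2 0 + (1 - qc q ^ 2) • e 0 3 + (qc q ^ 2) • e 3 0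
  | false, 3, 0 => (-1 - (qc q ^ 2)⁻¹) • e 2 0 + e 0 3
  | false, 3, 2 => e 2 3
  | false, 2, 3 => e 3 2 - (lam q ^ 2) • e 2 3 - (lam q ^ 2) • e 0 1 + (lam q ^ 2) • e 1 0
  | false, 3, 3 => (qc q ^ 2 - (qc q ^ 2)⁻¹) • e 2 3 + e 3 3
      + (qc q ^ 2 - (qc q ^ 2)⁻¹) • e 0 1 - (qc q ^ 2 - (qc q ^ 2)⁻¹) • e 1 0
  | false, 0, 1 => -e 2 3 + e 1 0
  | false, 1, 0 => e 2 3 + e 0 1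
  | false, 1, 2 => (qc q ^ 2) • e 2 1
  | false, 2, 1 => e 1 2 + (1 - qc q ^ 2) • e 2 1
  | false, 1, 3 => (-1 - (qc q ^ 2)⁻¹) • e 2 1 + (1 - (qc q ^ 2)⁻¹) • e 1 3
      + ((qc q ^ 2)⁻¹) • e 3 1
  | false, 3, 1 => (1 + qc q ^ 2) • e 2 1 + e 1 3

/-- The operator `σ_{j+1} = 1 ⊗ ⋯ ⊗ σ^{±1} ⊗ ⋯ ⊗ 1` acting on the neighbouring tensor factors
with (zero based) positions `j` and `j + 1`. The coefficients lie in a complex vector space `M`,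
which is `A(SU_q(2))` for general tensors and `ℂ` for left invariant ones. -/
noncomputable def braidAt (q : Param) (s : Bool) (k j : ℕ) (M : Type*) [AddCommGroup M]
    [Module ℂ M] : Module.End ℂ (W k → M) :=
  if h : j + 1 < k then
    { toFun := fun t J => ∑ a, ∑ b, braid q s a b (J ⟨j, Nat.lt_of_succ_lt h⟩) (J ⟨j + 1, h⟩) •
        t (Function.update (Function.update J ⟨j, Nat.lt_of_succ_lt h⟩ a) ⟨j + 1, h⟩ b)
      map_add' := by
        intro t u
        funext J
        simp only [Pi.add_apply, smul_add, Finset.sum_add_distrib]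
      map_smul' := by
        intro r t
        funext J
        simp only [Pi.smul_apply, RingHom.id_apply, Finset.smul_sum, smul_comm r] }
  else 1

/-- The composition of `l` braidings with decreasing positions `j, j - 1, …, j - l + 1`. -/
noncomputable def braidDown (q : Param) (s : Bool) (k j : ℕ) (M : Type*) [AddCommGroup M]
    [Module ℂ M] : ℕ → Module.End ℂ (W k → M)
  | 0 => 1
  | l + 1 => braidDown q s k j M l * braidAt q s k (j - l) M

/-- The composition `σ₁ σ₂ ⋯ σ_l`. -/
noncomputable def braidUp (q : Param) (s : Bool) (k : ℕ) (M : Type*) [AddCommGroup M]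
    [Module ℂ M] : ℕ → Module.End ℂ (W k → M)
  | 0 => 1
  | l + 1 => braidUp q s k M l * braidAt q s k l M

/-- The antisymmetriser `A^{(k)}_± = ∑_p sign(p) 𝔓(p)`, the sum over the permutations `p` of
`k` elements, `𝔓(p)` being the product of braidings along a reduced word of `p`.
Every permutation has exactly one reduced word of the form `w₀ w₁ ⋯ w_{k-2}`, where `w_j` is one
of the `j + 2` words `1, σ_{j+1}, σ_{j+1} σ_j, …, σ_{j+1} σ_j ⋯ σ_1`, and the sum over these words
factorises. -/
noncomputable def antisym (q : Param) (s : Bool) (k : ℕ) (M : Type*) [AddCommGroup M]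
    [Module ℂ M] : Module.End ℂ (W k → M) :=
  ((List.range (k - 1)).map fun j =>
    ∑ l ∈ Finset.range (j + 2), ((-1 : ℂ) ^ l) • braidDown q s k j M l).prod

/-- The shuffle operator `B_{1,k-1} = 1 - σ₁ + σ₁σ₂ - ⋯`, for which
`A^{(k)} = (1 ⊗ A^{(k-1)}) B_{1,k-1}`. -/
noncomputable def shuffleOne (q : Param) (s : Bool) (k : ℕ) (M : Type*) [AddCommGroup M]
    [Module ℂ M] : Module.End ℂ (W k → M) :=
  ∑ l ∈ Finset.range k, ((-1 : ℂ) ^ l) • braidUp q s k M l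

/-- The space `Ω^k_±(SU_q(2))` of exterior `k`-forms, the range of the antisymmetriser. -/
noncomputable abbrev Forms (q : Param) (s : Bool) (k : ℕ) : Submodule ℂ (T q k) :=
  LinearMap.range (antisym q s k (A q))

/-- The wedge product of the factors of a tensor: the form
`∑_I t I · ω_{I 0} ∧ ⋯ ∧ ω_{I (k-1)} = A^{(k)}(∑_I t I · ω_I)`. -/
noncomputable def wedge (q : Param) (s : Bool) (k : ℕ) : T q k →ₗ[ℂ] Forms q s k :=
  (antisym q s k (A q)).rangeRestrict

/-! ## The exterior derivative -/

/-- The differential `d x = ∑_a (L_a ▷ x) ω_a`, as the family of its left coefficients. -/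
noncomputable def diff (q : Param) (x : A q) : Fin 4 → A q := fun a => act q (L q a) x

/-- The tensor `d x₀ ⊗ ⋯ ⊗ d x_{k-1}` over `A(SU_q(2))`, computed with the bimodule rule
`ω_a y = ∑_b (f_{ab} ▷ y) ω_b`. -/
noncomputable def diffTensor (q : Param) : (k : ℕ) → (Fin k → A q) → T q k
  | 0, _ => fun _ => 1
  | k + 1, x => fun J =>
      ∑ a, diff q (x 0) a * act q (f q a (J 0)) (diffTensor q k (Fin.tail x) (Fin.tail J))

/-- The exterior derivative in degree `k` is the linear map with
`d (x₀ dx₁ ∧ ⋯ ∧ dx_k) = dx₀ ∧ dx₁ ∧ ⋯ ∧ dx_k`. Such forms span `Ω^k`, so this is the restriction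
to degree `k` of the only extension of `d` to a graded derivation with `d² = 0`. -/
def IsExteriorDerivative (q : Param) (s : Bool) (k : ℕ)
    (D : Forms q s k →ₗ[ℂ] Forms q s (k + 1)) : Prop :=
  ∀ x : Fin (k + 1) → A q,
    D (wedge q s k fun J => x 0 * diffTensor q k (Fin.tail x) J)
      = wedge q s (k + 1) (diffTensor q (k + 1) x)

open Classical in
/-- The exterior derivative `d : Ω^k_± → Ω^{k+1}_±`. -/
noncomputable def extD (q : Param) (s : Bool) (k : ℕ) : Forms q s k →ₗ[ℂ] Forms q s (k + 1) :=
  if h : ∃ D, IsExteriorDerivative q s k D then h.choose else 0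

/-! ## Metrics -/

/-- The involution of the index set with `ω_a^* = -ω_{bar a}`. -/
def bar : Fin 4 → Fin 4 := ![1, 0, 2, 3]

/-- The `U(1)`-charges of the left invariant forms: `ω_a ↦ ω_a ⊗ z^{charge a}`. -/
def charge : Fin 4 → ℤ := ![-2, 2, 0, 0]

/-- The left `A(SU_q(2))`-linear map `Ω^{⊗2} → A(SU_q(2))` with `ω_a ⊗ ω_b ↦ g a b`. -/
noncomputable def evalMetric (q : Param) (g : Matrix (Fin 4) (Fin 4) ℂ) (t : T q 2) : A q :=
  ∑ a, ∑ b, g a b • t ![a, b]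

/-- `g ⊗ 1 : Ω^{⊗3} → Ω¹`. -/
noncomputable def evalMetricLeft (q : Param) (g : Matrix (Fin 4) (Fin 4) ℂ) (t : T q 3) :
    Fin 4 → A q :=
  fun c => ∑ a, ∑ b, g a b • t ![a, b, c]

/-- `1 ⊗ g : Ω^{⊗3} → Ω¹`. -/
noncomputable def evalMetricRight (q : Param) (g : Matrix (Fin 4) (Fin 4) ℂ) (t : T q 3) :
    Fin 4 → A q :=
  fun a => ∑ b, ∑ c, g b c • t ![a, b, c]

/-- The set `𝔊_σ` of real, left invariant, right `U(1)`-coinvariant `σ`-metrics, given by their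
complex values `g a b` on `ω_a ⊗ ω_b`. -/
structure IsSigmaMetric (q : Param) (g : Matrix (Fin 4) (Fin 4) ℂ) : Prop where
  /-- `g` is a homomorphism of bimodules (left linearity holds by construction). -/
  bimodule : ∀ (t : T q 2) (y : A q), evalMetric q g (rmul q t y) = evalMetric q g t * y
  nondegenerate : g.det ≠ 0
  /-- `g ∘ σ^± = g`. -/
  symmetric : ∀ (s : Bool) (t : T q 2), evalMetric q g (braidAt q s 2 0 (A q) t) = evalMetric q g t
  /-- `(g ⊗ 1) ∘ σ₂^± = (1 ⊗ g) ∘ σ₁^∓`. -/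
  braided : ∀ (s : Bool) (t : T q 3),
    evalMetricLeft q g (braidAt q s 3 1 (A q) t) = evalMetricRight q g (braidAt q (!s) 3 0 (A q) t)
  /-- `g(ω_a, ω_b)^* = g(ω_b^*, ω_a^*)`. -/
  real : ∀ a b, star (g a b) = g (bar b) (bar a)
  coinvariant : ∀ a b, charge a + charge b ≠ 0 → g a b = 0

/-- The sesquilinear contraction `Γ` on left invariant one-forms corresponding to `g`, with
coefficients `Γ(ω_a, ω_b)`. It is fixed by `g(ω_a, ω_b) = Γ(ω_a^*, ω_b)`. -/
def contraction (g : Matrix (Fin 4) (Fin 4) ℂ) : Matrix (Fin 4) (Fin 4) ℂ :=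
  fun a b => -g (bar a) b

/-! ## Hodge operators -/

/-- The contraction `Γ(ω_a, t)` of a left invariant one-form with a left invariant tensor. -/
noncomputable def contractOne (Γ : Matrix (Fin 4) (Fin 4) ℂ) {k : ℕ} (a : Fin 4)
    (t : W (k + 1) → ℂ) : W k → ℂ :=
  fun J => ∑ b, Γ a b * t (Fin.cons b J : W (k + 1))

/-- The contraction `Γ(t, u)` of left invariant tensors of equal degree, antilinear in `t`. -/
noncomputable def contractFull (Γ : Matrix (Fin 4) (Fin 4) ℂ) {k : ℕ} (t u : W k → ℂ) : ℂ :=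
  ∑ I, ∑ J, star (t I) * (∏ i, Γ (I i) (J i)) * u J

/-- The tensor `ω_I`. -/
noncomputable def basisTensor {k : ℕ} (I : W k) : W k → ℂ := fun J => if J = I then 1 else 0

/-- `ϑ = i m ω₋ ⊗ ω₊ ⊗ ω₀ ⊗ ω_z`. -/
noncomputable def vartheta (m : ℝ) : W 4 → ℂ :=
  (Complex.I * (m : ℂ)) • basisTensor ![0, 1, 2, 3]

/-- The `*`-structure on left invariant tensors which represents
`(ω_{a₁} ∧ ⋯ ∧ ω_{a_k})^* = (-1)^{k(k-1)/2} ω_{a_k}^* ∧ ⋯ ∧ ω_{a₁}^*`. -/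
noncomputable def starTensor {k : ℕ} (t : W k → ℂ) : W k → ℂ :=
  fun J => (-1) ^ (k * (k - 1) / 2) * ((-1) ^ k * star (t fun i => bar (J (Fin.rev i))))

/-- A left invariant tensor representing the Hodge dual of `ω_a`, that is
`𝔗^±(ω_a) = (A^{(3)}_±(Γ(ω_a, B_{1,3} ϑ)))^* = A^{(3)}_±(hodgeOne a)`.
The ratio of antisymmetriser eigenvalues in the definition of `𝔗^±` is `1` in degree one. -/
noncomputable def hodgeOne (q : Param) (s : Bool) (Γ : Matrix (Fin 4) (Fin 4) ℂ) (m : ℝ)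
    (a : Fin 4) : W 3 → ℂ :=
  starTensor (contractOne Γ a (shuffleOne q s 4 ℂ (vartheta m)))

/-- The volume form `μ = 𝔗^±(1) = A^{(4)}_±(ϑ)`. -/
noncomputable def vol (q : Param) (s : Bool) (m : ℝ) : W 4 → ℂ := antisym q s 4 ℂ (vartheta m)

/-- The Hodge operator `𝔗^±(ξ) = Γ(ξ, ϑ)^*` on left invariant four-forms. The ratio of
antisymmetriser eigenvalues in the definition of `𝔗^±` is `1`, since these forms are multiples of
`μ = μ^*`. -/
noncomputable def hodgeTop (Γ : Matrix (Fin 4) (Fin 4) ℂ) (m : ℝ) (ξ : W 4 → ℂ) : ℂ :=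
  star (contractFull Γ ξ (vartheta m))

/-- The quantum determinant
`det_q Γ = Γ(i ω₋ ⊗ ω₊ ⊗ ω₀ ⊗ ω_z, i ω₋ ∧ ω₊ ∧ ω₀ ∧ ω_z)`. -/
noncomputable def detq (q : Param) (s : Bool) (Γ : Matrix (Fin 4) (Fin 4) ℂ) : ℂ :=
  contractFull Γ (vartheta 1) (vol q s 1)

/-- The normalisation `(𝔗^±)²(1) = sgn Γ`, with `sgn Γ = det_q Γ / |det_q Γ|`, of the real scale
parameter `m`. -/
def IsNormalised (q : Param) (s : Bool) (Γ : Matrix (Fin 4) (Fin 4) ℂ) (m : ℝ) : Prop :=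
  detq q s Γ ≠ 0 ∧ hodgeTop Γ m (vol q s m) = detq q s Γ / ((‖detq q s Γ‖ : ℝ) : ℂ)

/-- `⋆^L_±` on one-forms, `⋆^L(x ω_a) = x 𝔗^±(ω_a)`. -/
noncomputable def starL₁ (q : Param) (s : Bool) (Γ : Matrix (Fin 4) (Fin 4) ℂ) (m : ℝ)
    (η : Fin 4 → A q) : Forms q s 3 :=
  wedge q s 3 fun J => ∑ a, hodgeOne q s Γ m a J • η a

/-- `⋆^L_±` on four-forms, `⋆^L(x ξ) = x 𝔗^±(ξ)`. -/
noncomputable def starL₄ (q : Param) (s : Bool) (Γ : Matrix (Fin 4) (Fin 4) ℂ) (m : ℝ)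
    (θ : Forms q s 4) : A q :=
  ∑ J, hodgeTop Γ m (basisTensor J) • (θ : T q 4) J

/-- `⋆^R_±` on one-forms, `⋆^R(ω_b y) = 𝔗^±(ω_b) y`. -/
noncomputable def starR₁ (q : Param) (s : Bool) (Γ : Matrix (Fin 4) (Fin 4) ℂ) (m : ℝ)
    (η : Fin 4 → A q) : Forms q s 3 :=
  wedge q s 3 (∑ b, rmul q (fun I => algebraMap ℂ (A q) (hodgeOne q s Γ m b I))
    (∑ a, act q (sInv q (f q a b)) (η a)))

/-- `⋆^R_±` on four-forms, `⋆^R(ξ y) = 𝔗^±(ξ) y`. -/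
noncomputable def starR₄ (q : Param) (s : Bool) (Γ : Matrix (Fin 4) (Fin 4) ℂ) (m : ℝ)
    (θ : Forms q s 4) : A q :=
  ∑ J, hodgeTop Γ m (basisTensor J) • rightCoord q (θ : T q 4) J

/-- The Laplacian `□^L = -⋆^L d ⋆^L d` on `A(SU_q(2))`. -/
noncomputable def lapL (q : Param) (s : Bool) (Γ : Matrix (Fin 4) (Fin 4) ℂ) (m : ℝ)
    (x : A q) : A q :=
  -starL₄ q s Γ m (extD q s 3 (starL₁ q s Γ m (diff q x)))

/-- The Laplacian `□^R = -⋆^R d ⋆^R d` on `A(SU_q(2))`. -/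
noncomputable def lapR (q : Param) (s : Bool) (Γ : Matrix (Fin 4) (Fin 4) ℂ) (m : ℝ)
    (x : A q) : A q :=
  -starR₄ q s Γ m (extD q s 3 (starR₁ q s Γ m (diff q x)))

/-! ## The eigenbasis -/

/-- The element `φ_{n,J,l} = (c^{J - n/2} (a^*)^{J + n/2}) ◁ E^l` with `J = |n|/2 + j`. -/
noncomputable def phi (q : Param) (n : ℤ) (j l : ℕ) : A q :=
  (eR q ^ l) (gen q .c ^ (j + (-n).toNat) * gen q .as ^ (j + n.toNat))

end QSU2

/-!
The proof is a reduction to finite computations in `U_q(su(2))` and with the matrix of the braiding.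

*The exterior derivative.* The calculus is inner: with `θ = λ⁻¹ ω_z + (q + q⁻¹) λ⁻² ω_0` one has
`d x = θ x - x θ`, which on the level of `U_q(su(2))` reads `∑_c θ_c f_{cb} = L_b + θ_b`
(`sum_theta_smul_f`). The commutation relations of the `L_a` say that the tensors
`θ ⊗ d x + d x ⊗ θ` are fixed by the braiding (`braidAt_anticommutator`). By the braid relations
the antisymmetriser of four strands has `1 - σ_j` as a right factor for every `j`, so it kills what
is fixed by `σ_j` (`antisym_four_eq_zero`), and it has the antisymmetrisers of the first and the
last three strands as right factors. Hence `ξ ↦ θ ∧ ξ + ξ ∧ θ` is well defined on three-forms and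
is an exterior derivative. It is the only one because the tensors `x₀ d x₁ ⊗ ⋯ ⊗ d x_k` span
(`span_diffTensor`), and so `d` on three-forms is known explicitly (`extD_wedge`).

*Metrics and Hodge duals.* Coinvariance, symmetry and the bimodule property leave a one parameter
family of metrics (`IsSigmaMetric.values`). The antisymmetriser of degree four has rank one, with
the same functional `ε` for both braidings (`volCoeff`), so that the quantum determinant is a
negative number and the normalisation becomes `m² |det_q Γ| = 1` (`IsNormalised.sq_mul_detAbs`).
The Hodge duals of the `ω_a` depend on the sign of the braiding (`hodgeShape`), but the products
`ω_b ∧ ⋆ω_a = -⋆ω_b ∧ ω_a` do not: their coefficients `κ_{ba}` (`hodgePair`) are the same for both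
signs (`volCoeff_consTensor`, `volCoeff_snocTensor`).

*The Laplacians.* For the left operator this gives `□^L = -α ∑ κ_{ba} L_b L_a` (`lapL_eq`), and the
sum is `2 q L_0` in `U_q(su(2))` (`laplacian_eq_L_two`). For the right operator the braiding
commutes with right multiplication (`braidAt_rightAct`), and in the right basis the differential
is `d x = -∑_b ω_b · (S⁻¹(L_b) ▷ x)`. So `□^R` is `S⁻¹` applied to the same quadratic expression,
and `S⁻¹(L_0) = L_0` (`lapR_eq`).

*The basis.* The elements `c^s (a^*)^t` are eigenvectors of `L_0`, which commutes with the right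
action of `E`. The `φ_{n,J,l}` are joint eigenvectors of `K ▷`, `L_0 ▷` and `◁ K` with distinct
eigenvalues. They do not vanish, because iterating `◁ E` leads from `c^s (a^*)^t` to a non zero
multiple of `a^s (c^*)^t` (`IsString`), which acts by a non zero operator in a representation on
sequences. So they are linearly independent. In each degree of a word filtration they are as many
as the normally ordered monomials, which span (`genSpan_pow_le`), so they span (`span_phi`).
-/

namespace QSU2

/-! ### Calculations in `U_q(su(2))` -/

theorem qh_pow_four_sub_one_ne_zero (q : Param) : qh q ^ 4 - 1 ≠ 0 := by
  intro h
  apply lam_ne_zero q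
  have h0 := qh_ne_zero q
  rw [lam, ← qh_mul_qh]
  field_simp
  linear_combination h

theorem lam_eq_qh (q : Param) : lam q = (qh q ^ 4 - 1) / qh q ^ 2 := by
  have h0 := qh_ne_zero q
  rw [lam, ← qh_mul_qh]
  field_simp

theorem qc_eq_qh (q : Param) : qc q = qh q ^ 2 := by rw [← qh_mul_qh, sq]

theorem u_EF' (q : Param) : ugen q .E * ugen q .F = ugen q .F * ugen q .E
    + (lam q)⁻¹ • (ugen q .K * ugen q .K - ugen q .Ki * ugen q .Ki) := by
  rw [← u_EF]; abel

theorem u_KKi_assoc (q : Param) (x : U q) : ugen q .K * (ugen q .Ki * x) = x := by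
  rw [← mul_assoc, u_KKi, one_mul]

theorem u_KiK_assoc (q : Param) (x : U q) : ugen q .Ki * (ugen q .K * x) = x := by
  rw [← mul_assoc, u_KiK, one_mul]

theorem u_KE_assoc (q : Param) (x : U q) :
    ugen q .K * (ugen q .E * x) = qc q • (ugen q .E * (ugen q .K * x)) := by
  rw [← mul_assoc, u_KE, smul_mul_assoc, mul_assoc]

theorem u_KiE_assoc (q : Param) (x : U q) :
    ugen q .Ki * (ugen q .E * x) = (qc q)⁻¹ • (ugen q .E * (ugen q .Ki * x)) := by
  rw [← mul_assoc, u_KiE, smul_mul_assoc, mul_assoc]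

theorem u_KF_assoc (q : Param) (x : U q) :
    ugen q .K * (ugen q .F * x) = (qc q)⁻¹ • (ugen q .F * (ugen q .K * x)) := by
  rw [← mul_assoc, u_KF, smul_mul_assoc, mul_assoc]

theorem u_KiF_assoc (q : Param) (x : U q) :
    ugen q .Ki * (ugen q .F * x) = qc q • (ugen q .F * (ugen q .Ki * x)) := by
  rw [← mul_assoc, u_KiF, smul_mul_assoc, mul_assoc]

theorem u_EF_assoc (q : Param) (x : U q) :
    ugen q .E * (ugen q .F * x) = ugen q .F * (ugen q .E * x)
      + (lam q)⁻¹ • (ugen q .K * (ugen q .K * x) - ugen q .Ki * (ugen q .Ki * x)) := by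
  rw [← mul_assoc, u_EF']
  simp only [add_mul, smul_mul_assoc, sub_mul, mul_assoc]

theorem L_0 (q : Param) : L q 0 = qh q • (ugen q .F * ugen q .Ki) := rfl
theorem L_1 (q : Param) : L q 1 = (qh q)⁻¹ • (ugen q .E * ugen q .Ki) := rfl
theorem L_2 (q : Param) : L q 2 = (lam q ^ 2)⁻¹ • (qc q • (ugen q .K * ugen q .K - 1)
      + (qc q)⁻¹ • (ugen q .Ki * ugen q .Ki - 1)) + ugen q .F * ugen q .E := rfl
theorem L_3 (q : Param) : L q 3 = (lam q)⁻¹ • (ugen q .Ki * ugen q .Ki - 1) := rfl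

theorem f_00 (q : Param) : f q 0 0 = 1 := rfl
theorem f_01 (q : Param) : f q 0 1 = 0 := rfl
theorem f_02 (q : Param) : f q 0 2 = (qh q)⁻¹ • (ugen q .K * ugen q .E) := rfl
theorem f_03 (q : Param) : f q 0 3 = 0 := rfl
theorem f_10 (q : Param) : f q 1 0 = 0 := rfl
theorem f_11 (q : Param) : f q 1 1 = 1 := rfl
theorem f_12 (q : Param) : f q 1 2 = (qh q)⁻¹ • (ugen q .F * ugen q .K) := rfl
theorem f_13 (q : Param) : f q 1 3 = 0 := rfl
theorem f_20 (q : Param) : f q 2 0 = 0 := rfl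
theorem f_21 (q : Param) : f q 2 1 = 0 := rfl
theorem f_22 (q : Param) : f q 2 2 = ugen q .K * ugen q .K := rfl
theorem f_23 (q : Param) : f q 2 3 = 0 := rfl
theorem f_30 (q : Param) : f q 3 0 = lam q • L q 0 := rfl
theorem f_31 (q : Param) : f q 3 1 = lam q • L q 1 := rfl
theorem f_32 (q : Param) : f q 3 2 = lam q • (ugen q .F * ugen q .E)
        + (qc q * lam q)⁻¹ • (ugen q .Ki * ugen q .Ki - ugen q .K * ugen q .K) := rfl
theorem f_33 (q : Param) : f q 3 3 = ugen q .Ki * ugen q .Ki := rfl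

/-! ### The braiding -/

/-- The braiding `σ^{±1}` on the coefficients of a two-tensor `∑ F a b · ω_a ⊗ ω_b`. -/
noncomputable def braidMix (q : Param) (s : Bool) {M : Type*} [AddCommGroup M] [Module ℂ M]
    (F : Fin 4 → Fin 4 → M) (x y : Fin 4) : M :=
  ∑ a, ∑ b, braid q s a b x y • F a b

/-- The coefficients of `σ(∑ F a b · ω_a ⊗ ω_b)`. The rows of the braiding are needed here, while
`sum_braid_true_smul` lists its columns. -/
theorem braidMix_true (q : Param) {M : Type*} [AddCommGroup M] [Module ℂ M]
    (F : Fin 4 → Fin 4 → M) :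
    braidMix q true F 0 0 = F 0 0 ∧
    braidMix q true F 0 1 = -((lam q ^ 2) • F 3 2) + (qc q ^ 2 - (qc q ^ 2)⁻¹) • F 3 3 + F 1 0 ∧
    braidMix q true F 0 2 = (1 - qc q ^ 2) • F 0 2 + (qc q ^ 2) • F 2 0 + (1 + qc q ^ 2) • F 0 3
      + (-1 - (qc q ^ 2)⁻¹) • F 3 0 ∧
    braidMix q true F 0 3 = ((qc q ^ 2)⁻¹) • F 3 0 ∧
    braidMix q true F 1 0 = (lam q ^ 2) • F 3 2 - (qc q ^ 2 - (qc q ^ 2)⁻¹) • F 3 3 + F 0 1 ∧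
    braidMix q true F 1 1 = F 1 1 ∧
    braidMix q true F 1 2 = (1 - (qc q ^ 2)⁻¹) • F 1 2 + ((qc q ^ 2)⁻¹) • F 2 1
      + (-1 - (qc q ^ 2)⁻¹) • F 1 3 + (1 + qc q ^ 2) • F 3 1 ∧
    braidMix q true F 1 3 = (qc q ^ 2) • F 3 1 ∧
    braidMix q true F 2 0 = F 0 2 ∧
    braidMix q true F 2 1 = F 1 2 ∧
    braidMix q true F 2 2 = F 2 2 ∧
    braidMix q true F 2 3 = F 3 2 ∧
    braidMix q true F 3 0 = F 0 3 + (1 - (qc q ^ 2)⁻¹) • F 3 0 ∧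
    braidMix q true F 3 1 = F 1 3 + (1 - qc q ^ 2) • F 3 1 ∧
    braidMix q true F 3 2 = (-(lam q ^ 2)) • F 3 2 + F 2 3 + (qc q ^ 2 - (qc q ^ 2)⁻¹) • F 3 3
      - F 0 1 + F 1 0 ∧
    braidMix q true F 3 3 = F 3 3 := by
  refine ⟨?_, ?_, ?_, ?_, ?_, ?_, ?_, ?_, ?_, ?_, ?_, ?_, ?_, ?_, ?_, ?_⟩
  all_goals
    simp [braidMix, Fin.sum_univ_four, braid, e]
    try module

theorem braidMix_false (q : Param) {M : Type*} [AddCommGroup M] [Module ℂ M]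
    (F : Fin 4 → Fin 4 → M) :
    braidMix q false F 0 0 = F 0 0 ∧
    braidMix q false F 0 1 = -((lam q ^ 2) • F 2 3) + (qc q ^ 2 - (qc q ^ 2)⁻¹) • F 3 3 + F 1 0 ∧
    braidMix q false F 0 2 = F 2 0 ∧
    braidMix q false F 0 3 = (1 - qc q ^ 2) • F 0 3 + F 3 0 ∧
    braidMix q false F 1 0 = (lam q ^ 2) • F 2 3 - (qc q ^ 2 - (qc q ^ 2)⁻¹) • F 3 3 + F 0 1 ∧
    braidMix q false F 1 1 = F 1 1 ∧
    braidMix q false F 1 2 = F 2 1 ∧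
    braidMix q false F 1 3 = (1 - (qc q ^ 2)⁻¹) • F 1 3 + F 3 1 ∧
    braidMix q false F 2 0 = ((qc q ^ 2)⁻¹) • F 0 2 + (1 - (qc q ^ 2)⁻¹) • F 2 0
      + (1 + qc q ^ 2) • F 0 3 + (-1 - (qc q ^ 2)⁻¹) • F 3 0 ∧
    braidMix q false F 2 1 = (qc q ^ 2) • F 1 2 + (1 - qc q ^ 2) • F 2 1
      + (-1 - (qc q ^ 2)⁻¹) • F 1 3 + (1 + qc q ^ 2) • F 3 1 ∧
    braidMix q false F 2 2 = F 2 2 ∧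
    braidMix q false F 2 3 = F 3 2 - (lam q ^ 2) • F 2 3 + (qc q ^ 2 - (qc q ^ 2)⁻¹) • F 3 3
      - F 0 1 + F 1 0 ∧
    braidMix q false F 3 0 = (qc q ^ 2) • F 0 3 ∧
    braidMix q false F 3 1 = ((qc q ^ 2)⁻¹) • F 1 3 ∧
    braidMix q false F 3 2 = F 2 3 ∧
    braidMix q false F 3 3 = F 3 3 := by
  refine ⟨?_, ?_, ?_, ?_, ?_, ?_, ?_, ?_, ?_, ?_, ?_, ?_, ?_, ?_, ?_, ?_⟩
  all_goals
    simp [braidMix, Fin.sum_univ_four, braid, e]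
    try module

theorem sum_braid_true_smul (q : Param) {M : Type*} [AddCommGroup M] [Module ℂ M]
    (F : Fin 4 → Fin 4 → M) :
    ∑ c, ∑ d, braid q true 0 0 c d • F c d = F 0 0 ∧
    ∑ c, ∑ d, braid q true 0 1 c d • F c d = -F 3 2 + F 1 0 ∧
    ∑ c, ∑ d, braid q true 0 2 c d • F c d = (1 - qc q ^ 2) • F 0 2 + F 2 0 ∧
    ∑ c, ∑ d, braid q true 0 3 c d • F c d = (1 + qc q ^ 2) • F 0 2 + F 3 0 ∧
    ∑ c, ∑ d, braid q true 1 0 c d • F c d = F 3 2 + F 0 1 ∧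
    ∑ c, ∑ d, braid q true 1 1 c d • F c d = F 1 1 ∧
    ∑ c, ∑ d, braid q true 1 2 c d • F c d = (1 - (qc q ^ 2)⁻¹) • F 1 2 + F 2 1 ∧
    ∑ c, ∑ d, braid q true 1 3 c d • F c d = (-1 - (qc q ^ 2)⁻¹) • F 1 2 + F 3 1 ∧
    ∑ c, ∑ d, braid q true 2 0 c d • F c d = (qc q ^ 2) • F 0 2 ∧
    ∑ c, ∑ d, braid q true 2 1 c d • F c d = ((qc q ^ 2)⁻¹) • F 1 2 ∧
    ∑ c, ∑ d, braid q true 2 2 c d • F c d = F 2 2 ∧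
    ∑ c, ∑ d, braid q true 2 3 c d • F c d = F 3 2 ∧
    ∑ c, ∑ d, braid q true 3 0 c d • F c d = (-1 - (qc q ^ 2)⁻¹) • F 0 2 + ((qc q ^ 2)⁻¹) • F 0 3
      + (1 - (qc q ^ 2)⁻¹) • F 3 0 ∧
    ∑ c, ∑ d, braid q true 3 1 c d • F c d = (1 + qc q ^ 2) • F 1 2 + (qc q ^ 2) • F 1 3
      + (1 - qc q ^ 2) • F 3 1 ∧
    ∑ c, ∑ d, braid q true 3 2 c d • F c d = (-(lam q ^ 2)) • F 3 2 + F 2 3 - (lam q ^ 2) • F 0 1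
      + (lam q ^ 2) • F 1 0 ∧
    ∑ c, ∑ d, braid q true 3 3 c d • F c d = (qc q ^ 2 - (qc q ^ 2)⁻¹) • F 3 2 + F 3 3
      + (qc q ^ 2 - (qc q ^ 2)⁻¹) • F 0 1 - (qc q ^ 2 - (qc q ^ 2)⁻¹) • F 1 0 := by
  refine ⟨?_, ?_, ?_, ?_, ?_, ?_, ?_, ?_, ?_, ?_, ?_, ?_, ?_, ?_, ?_, ?_⟩
  all_goals
    simp [Fin.sum_univ_four, braid, e]
    try module

/-! ### The Casimir element -/

theorem L_two_central (q : Param) (h : U q) : L q 2 * h = h * L q 2 := by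
  obtain ⟨y, rfl⟩ : ∃ y, mkU q y = h := RingQuot.mkAlgHom_surjective ℂ (URel q) h
  have h0 := qh_ne_zero q
  have h1 := qh_pow_four_sub_one_ne_zero q
  induction y using FreeAlgebra.induction with
  | grade0 r =>
    rw [AlgHom.commutes]
    exact (Algebra.commutes r _).symm
  | grade1 x =>
    change L q 2 * ugen q x = ugen q x * L q 2
    cases x <;>
    simp only [L_2, mul_add, add_mul, mul_sub, sub_mul, smul_mul_assoc, mul_smul_comm, mul_assoc,
      mul_one, one_mul, u_KKi, u_KiK, u_KE, u_KiE, u_KF, u_KiF, u_EF', u_KKi_assoc, u_KiK_assoc,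
      u_KE_assoc, u_KiE_assoc, u_KF_assoc, u_KiF_assoc, u_EF_assoc, lam_eq_qh, qc_eq_qh] <;>
    match_scalars <;> field_simp <;> ring
  | mul x y hx hy => rw [map_mul, ← mul_assoc, hx, mul_assoc, hy, mul_assoc]
  | add x y hx hy => rw [map_add, mul_add, add_mul, hx, hy]

theorem qnum_half (q : Param) : ((qnum q (1 / 2) : ℝ) : ℂ) = (qh q - (qh q)⁻¹) / lam q := by
  have h : (q : ℝ) ^ (-(1 / 2) : ℝ) = (Real.sqrt (q : ℝ))⁻¹ := by
    rw [Real.rpow_neg q.2.1.le, Real.sqrt_eq_rpow]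
  rw [qnum, h, ← Real.sqrt_eq_rpow, lam, qh, qc]
  push_cast
  rfl

theorem casimir_eq (q : Param) : casimir q
      = L q 2 + algebraMap ℂ (U q) (((qnum q (1 / 2) ^ 2 - 1 / 4 : ℝ) : ℂ)) := by
  have h0 := qh_ne_zero q
  have h1 := qh_pow_four_sub_one_ne_zero q
  rw [Algebra.algebraMap_eq_smul_one]
  push_cast
  rw [qnum_half, casimir, L_2, lam_eq_qh, qc_eq_qh]
  match_scalars <;> field_simp <;> ring

/-! ### The structure of the four dimensional calculus -/

/-- The coefficients of the left invariant one-form `θ = λ⁻¹ ω_z + (q + q⁻¹) λ⁻² ω_0`, for which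
`d x = θ x - x θ`. -/
noncomputable def theta (q : Param) : Fin 4 → ℂ :=
  ![0, 0, (qc q + (qc q)⁻¹) * (lam q ^ 2)⁻¹, (lam q)⁻¹]

theorem theta_0 (q : Param) : theta q 0 = 0 := rfl
theorem theta_1 (q : Param) : theta q 1 = 0 := rfl
theorem theta_2 (q : Param) : theta q 2 = (qc q + (qc q)⁻¹) * (lam q ^ 2)⁻¹ := rfl
theorem theta_3 (q : Param) : theta q 3 = (lam q)⁻¹ := rfl

/-- The calculus is inner: `θ x - x θ` has the coefficients `∑_c θ_c f_{cb} ▷ x - θ_b x`. -/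
theorem sum_theta_smul_f (q : Param) (b : Fin 4) :
    ∑ c, theta q c • f q c b = L q b + algebraMap ℂ (U q) (theta q b) := by
  have h0 := qh_ne_zero q
  have h1 := qh_pow_four_sub_one_ne_zero q
  rw [Algebra.algebraMap_eq_smul_one]
  fin_cases b <;>
  simp only [Fin.zero_eta, Fin.mk_one, Fin.reduceFinMk, Fin.sum_univ_four, theta_0, theta_1,
    theta_2, theta_3, f_00, f_01, f_02, f_03, f_10, f_11, f_12, f_13, f_20, f_21, f_22, f_23,
    f_30, f_31, f_32, f_33, L_0, L_1, L_2, L_3, lam_eq_qh, qc_eq_qh] <;>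
  match_scalars <;> field_simp <;> ring

/-- The braiding is a map of right modules: it intertwines `∑_{c,d} f_{ac} f_{bd} ω_c ⊗ ω_d`. -/
theorem braidMix_f_mul_f (q : Param) (a b x y : Fin 4) :
    braidMix q true (fun c d => f q a c * f q b d) x y
      = ∑ c, ∑ d, braid q true a b c d • (f q c x * f q d y) := by
  have h0 := qh_ne_zero q
  have h1 := qh_pow_four_sub_one_ne_zero q
  fin_cases a <;> fin_cases b <;>
  simp only [Fin.zero_eta, Fin.mk_one, Fin.reduceFinMk,
    sum_braid_true_smul q (fun c d => f q c x * f q d y)] <;>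
  fin_cases x <;> fin_cases y <;>
  simp only [Fin.zero_eta, Fin.mk_one, Fin.reduceFinMk, braidMix_true, f_00, f_01, f_02, f_03,
    f_10, f_11, f_12, f_13, f_20, f_21, f_22, f_23, f_30, f_31, f_32, f_33, mul_zero, zero_mul,
    smul_zero, add_zero, zero_add, neg_zero, sub_zero, zero_sub, one_mul, mul_one] <;>
  simp only [L_0, L_1, mul_one, mul_add, add_mul, mul_sub, sub_mul, smul_mul_assoc,
    mul_smul_comm, mul_assoc, u_KKi, u_KiK, u_KE, u_KiE, u_KF, u_KiF, u_EF', u_KKi_assoc,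
    u_KiK_assoc, u_KE_assoc, u_KiE_assoc, u_KF_assoc, u_KiF_assoc, u_EF_assoc, lam_eq_qh,
    qc_eq_qh] <;>
  match_scalars <;> field_simp <;> ring

/-- The commutation relations of the quantum tangent space, in the form that the two-form
coefficients of `θ ∧ d x + d x ∧ θ` are fixed by the braiding. -/
theorem braidMix_L_mul_L (q : Param) (x y : Fin 4) :
    braidMix q true (fun b c => L q b * L q c + theta q b • L q c + theta q c • L q b) x y
      = L q x * L q y + theta q x • L q y + theta q y • L q x := by
  have h0 := qh_ne_zero q
  have h1 := qh_pow_four_sub_one_ne_zero q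
  fin_cases x <;> fin_cases y <;>
  simp only [Fin.zero_eta, Fin.mk_one, Fin.reduceFinMk, braidMix_true, theta_0, theta_1, theta_2,
    theta_3, zero_smul, add_zero, ← L_two_central] <;>
  simp only [L_0, L_1, L_2, L_3, mul_add, add_mul, mul_sub, sub_mul, smul_mul_assoc, mul_one,
    one_mul, mul_smul_comm, mul_assoc, u_KKi, u_KE, u_KF, u_KKi_assoc,
    u_KE_assoc, u_KiE_assoc, u_KF_assoc, u_KiF_assoc, u_EF_assoc, lam_eq_qh,
    qc_eq_qh] <;>
  match_scalars <;> field_simp <;> ring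

/-! ### The antipode and right derivations -/

theorem sInv_mul (q : Param) (x y : U q) : sInv q (x * y) = sInv q y * sInv q x := by
  simp [sInv]

theorem sInv_one (q : Param) : sInv q 1 = 1 := by simp [sInv]

theorem sInv_zero (q : Param) : sInv q 0 = 0 := by simp [sInv]

theorem sInv_add (q : Param) (x y : U q) : sInv q (x + y) = sInv q x + sInv q y := by simp [sInv]

theorem sInv_sub (q : Param) (x y : U q) : sInv q (x - y) = sInv q x - sInv q y := by simp [sInv]

theorem sInv_smul (q : Param) (r : ℂ) (x : U q) : sInv q (r • x) = r • sInv q x := by simp [sInv]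

theorem sInv_K (q : Param) : sInv q (ugen q .K) = ugen q .Ki := by
  rw [sInv, sInvOp, liftU_ugen, MulOpposite.unop_op]

theorem sInv_Ki (q : Param) : sInv q (ugen q .Ki) = ugen q .K := by
  rw [sInv, sInvOp, liftU_ugen, MulOpposite.unop_op]

theorem sInv_E (q : Param) : sInv q (ugen q .E) = -((qc q)⁻¹ • ugen q .E) := by
  rw [sInv, sInvOp, liftU_ugen, MulOpposite.unop_op]

theorem sInv_F (q : Param) : sInv q (ugen q .F) = -(qc q • ugen q .F) := by
  rw [sInv, sInvOp, liftU_ugen, MulOpposite.unop_op]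

/-- As `Δ f_{kj} = ∑_i f_{ki} ⊗ f_{ij}`, this is the property `∑ S⁻¹(x₂) x₁ = ε(x)` of the inverse
antipode. The property `∑ x₂ S⁻¹(x₁) = ε(x)` is `sum_f_mul_sInv_f`. -/
theorem sum_sInv_f_mul_f (q : Param) (j k : Fin 4) :
    ∑ i, sInv q (f q i j) * f q k i = if k = j then 1 else 0 := by
  have h0 := qh_ne_zero q
  have h1 := qh_pow_four_sub_one_ne_zero q
  fin_cases j <;> fin_cases k <;>
  simp only [Fin.zero_eta, Fin.mk_one, Fin.reduceFinMk, Fin.sum_univ_four, f_00, f_01, f_02, f_03,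
    f_10, f_11, f_12, f_13, f_20, f_21, f_22, f_23, f_30, f_31, f_32, f_33, L_0, L_1,
    Fin.reduceEq, if_true, if_false, mul_zero, zero_mul, add_zero, zero_add,
    sInv_mul, sInv_one, sInv_zero, sInv_add, sInv_sub, sInv_smul, sInv_K, sInv_Ki, sInv_E,
    sInv_F, neg_mul, mul_neg, mul_one, one_mul, mul_add, add_mul, mul_sub, sub_mul, smul_mul_assoc,
    mul_smul_comm, mul_assoc, u_KKi, u_KiK, u_KE, u_KiE, u_KF, u_KiF, u_EF', u_KKi_assoc,
    u_KiK_assoc, u_KiE_assoc, u_KiF_assoc, u_EF_assoc, lam_eq_qh,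
    qc_eq_qh] <;>
  match_scalars <;> field_simp <;> ring

theorem sum_f_mul_sInv_f (q : Param) (a b : Fin 4) :
    ∑ c, f q c b * sInv q (f q a c) = if a = b then 1 else 0 := by
  have h0 := qh_ne_zero q
  have h1 := qh_pow_four_sub_one_ne_zero q
  fin_cases a <;> fin_cases b <;>
  simp only [Fin.zero_eta, Fin.mk_one, Fin.reduceFinMk, Fin.sum_univ_four, f_00, f_01, f_02, f_03,
    f_10, f_11, f_12, f_13, f_20, f_21, f_22, f_23, f_30, f_31, f_32, f_33, L_0, L_1,
    Fin.reduceEq, if_true, if_false, mul_zero, zero_mul, add_zero, zero_add,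
    sInv_mul, sInv_one, sInv_zero, sInv_add, sInv_sub, sInv_smul, sInv_K, sInv_Ki, sInv_E,
    sInv_F, neg_mul, mul_neg, mul_one, one_mul, mul_add, add_mul, mul_sub, sub_mul, smul_mul_assoc,
    mul_smul_comm, mul_assoc, u_KKi, u_KiK, u_KE, u_KiE, u_KF, u_KiF, u_EF', u_KKi_assoc,
    u_KiK_assoc, u_KE_assoc, u_KF_assoc, u_EF_assoc, lam_eq_qh,
    qc_eq_qh] <;>
  match_scalars <;> field_simp <;> ring

/-- The right derivations: `d x = ∑_b ω_b · (R_b ▷ x)` with `R_b = ∑_a S⁻¹(f_{ab}) L_a`. -/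
theorem sum_sInv_f_mul_L (q : Param) (b : Fin 4) :
    ∑ a, sInv q (f q a b) * L q a = -sInv q (L q b) := by
  have h0 := qh_ne_zero q
  have h1 := qh_pow_four_sub_one_ne_zero q
  fin_cases b <;>
  simp only [Fin.zero_eta, Fin.mk_one, Fin.reduceFinMk, Fin.sum_univ_four, f_00, f_01, f_02, f_03,
    f_10, f_11, f_12, f_13, f_20, f_21, f_22, f_23, f_30, f_31, f_32, f_33, L_0, L_1, L_2, L_3,
    zero_mul, add_zero,
    sInv_mul, sInv_one, sInv_zero, sInv_add, sInv_sub, sInv_smul, sInv_K, sInv_Ki, sInv_E,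
    sInv_F, neg_mul, mul_neg, mul_one, one_mul, mul_add, add_mul, mul_sub, sub_mul, smul_mul_assoc,
    mul_smul_comm, mul_assoc, u_KKi, u_KiK, u_KE, u_KiE, u_KF, u_KiF, u_EF', u_KKi_assoc,
    u_KiK_assoc, u_KiE_assoc, u_KiF_assoc, u_EF_assoc, lam_eq_qh,
    qc_eq_qh] <;>
  match_scalars <;> field_simp <;> ring

theorem sInv_L_two (q : Param) : sInv q (L q 2) = L q 2 := by
  have h0 := qh_ne_zero q
  have h1 := qh_pow_four_sub_one_ne_zero q
  simp only [L_2,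
    sInv_mul, sInv_one, sInv_add, sInv_sub, sInv_smul, sInv_K, sInv_Ki, sInv_E,
    sInv_F, neg_mul, mul_neg, smul_mul_assoc, mul_smul_comm, u_EF', lam_eq_qh, qc_eq_qh]
  match_scalars <;> field_simp <;> ring

/-- The Laplacian as an element of the enveloping algebra. -/
theorem laplacian_eq_L_two (q : Param) :
    L q 1 * L q 0 + (qc q ^ 2) • (L q 0 * L q 1) + (1 + qc q ^ 2) • (L q 3 * L q 3)
      - (2 * (qc q ^ 2 - 1)) • (L q 2 * L q 3) = (2 * qc q) • L q 2 := by
  have h0 := qh_ne_zero q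
  have h1 := qh_pow_four_sub_one_ne_zero q
  simp only [L_0, L_1, L_2, L_3, mul_one, one_mul, add_mul, mul_sub, sub_mul,
    smul_mul_assoc, mul_smul_comm, mul_assoc, u_KKi,
    u_KKi_assoc, u_KiE_assoc, u_KiF_assoc, u_EF_assoc,
    lam_eq_qh, qc_eq_qh]
  match_scalars <;> field_simp <;> ring

/-! ### Braidings on tensors -/

section Braid
variable {M N : Type*} [AddCommGroup M] [Module ℂ M] [AddCommGroup N] [Module ℂ N]

theorem braidAt_apply (q : Param) (s : Bool) {k j : ℕ} (h : j + 1 < k) (t : W k → M) (J : W k) :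
    braidAt q s k j M t J = braidMix q s (fun a b =>
      t (Function.update (Function.update J ⟨j, Nat.lt_of_succ_lt h⟩ a) ⟨j + 1, h⟩ b))
      (J ⟨j, Nat.lt_of_succ_lt h⟩) (J ⟨j + 1, h⟩) := by
  rw [braidAt, dif_pos h]
  rfl

theorem braidMix_map (q : Param) (s : Bool) (φ : M →ₗ[ℂ] N) (F : Fin 4 → Fin 4 → M)
    (x y : Fin 4) : braidMix q s (fun a b => φ (F a b)) x y = φ (braidMix q s F x y) := by
  simp only [braidMix, map_sum, map_smul]

/-- Braidings act on the indices only, so they commute with linear maps of the coefficients. -/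
theorem braidAt_map (q : Param) (s : Bool) {k : ℕ} (j : ℕ) (φ : M →ₗ[ℂ] N) (t : W k → M)
    (J : W k) : braidAt q s k j N (fun J => φ (t J)) J = φ (braidAt q s k j M t J) := by
  by_cases h : j + 1 < k
  · rw [braidAt_apply q s h, braidAt_apply q s h, braidMix_map]
  · rw [braidAt, braidAt, dif_neg h, dif_neg h, Module.End.one_apply, Module.End.one_apply]

theorem braidAt_succ (q : Param) (s : Bool) {k j : ℕ} (h : j + 1 < k) (t : W (k + 1) → M)
    (J : W (k + 1)) : braidAt q s (k + 1) (j + 1) M t J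
      = braidAt q s k j M (fun I => t (Fin.cons (J 0) I : W (k + 1))) (Fin.tail J) := by
  rw [braidAt_apply q s (Nat.succ_lt_succ h), braidAt_apply q s h]
  simp only [Fin.cons_update, Fin.cons_self_tail]
  rfl

theorem braidAt_castSucc (q : Param) (s : Bool) {k j : ℕ} (h : j + 1 < k) (t : W (k + 1) → M)
    (J : W (k + 1)) : braidAt q s (k + 1) j M t J
      = braidAt q s k j M (fun I => t (Fin.snoc I (J (Fin.last k)) : W (k + 1))) (Fin.init J) := by
  rw [braidAt_apply q s (Nat.lt_succ_of_lt h), braidAt_apply q s h]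
  simp only [Fin.snoc_update, Fin.snoc_init_self]
  rfl

theorem braidAt_zero (q : Param) (s : Bool) {k : ℕ} (t : W (k + 2) → M) (J : W (k + 2)) :
    braidAt q s (k + 2) 0 M t J = braidMix q s (fun a b =>
      t (Fin.cons a (Fin.cons b (Fin.tail (Fin.tail J)) : W (k + 1)))) (J 0) (J 1) := by
  rw [braidAt_apply q s (by omega)]
  have h : ∀ a b, Function.update (Function.update J ⟨0, by omega⟩ a) ⟨0 + 1, by omega⟩ b
      = (Fin.cons a (Fin.cons b (Fin.tail (Fin.tail J)) : W (k + 1)) : W (k + 2)) := by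
    intro a b
    funext i
    refine Fin.cases ?_ (fun i => Fin.cases ?_ (fun i => ?_) i) i
    · simp [Function.update]
    · simp [Function.update]
    · simp [Function.update, Fin.ext_iff, Fin.tail]
  simp only [h]
  rfl

theorem braidAt_three_zero (q : Param) (s : Bool) (t : W 3 → M) (x y z : Fin 4) :
    braidAt q s 3 0 M t ![x, y, z] = braidMix q s (fun a b => t ![a, b, z]) x y :=
  braidAt_zero q s t _

theorem braidAt_three_one (q : Param) (s : Bool) (t : W 3 → M) (x y z : Fin 4) :
    braidAt q s 3 1 M t ![x, y, z] = braidMix q s (fun a b => t ![x, a, b]) y z :=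
  (braidAt_succ q s (by omega) t _).trans (braidAt_zero q s (k := 0) _ _)

theorem braidAt_four_zero (q : Param) (s : Bool) (t : W 4 → M) (w x y z : Fin 4) :
    braidAt q s 4 0 M t ![w, x, y, z] = braidMix q s (fun a b => t ![a, b, y, z]) w x :=
  braidAt_zero q s t _

theorem braidAt_four_one (q : Param) (s : Bool) (t : W 4 → M) (w x y z : Fin 4) :
    braidAt q s 4 1 M t ![w, x, y, z] = braidMix q s (fun a b => t ![w, a, b, z]) x y :=
  (braidAt_succ q s (by omega) t _).trans (braidAt_zero q s (k := 1) _ _)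

theorem braidAt_four_two (q : Param) (s : Bool) (t : W 4 → M) (w x y z : Fin 4) :
    braidAt q s 4 2 M t ![w, x, y, z] = braidMix q s (fun a b => t ![w, x, a, b]) y z :=
  ((braidAt_succ q s (by omega) t _).trans (braidAt_succ q s (by omega) _ _)).trans
    (braidAt_zero q s (k := 0) _ _)

theorem vec_three_eta (J : W 3) : J = ![J 0, J 1, J 2] := by
  funext i; fin_cases i <;> rfl

theorem vec_four_eta (J : W 4) : J = ![J 0, J 1, J 2, J 3] := by
  funext i; fin_cases i <;> rfl

theorem braidMix_true_false (q : Param) (F : Fin 4 → Fin 4 → M) (x y : Fin 4) :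
    braidMix q true (braidMix q false F) x y = F x y := by
  have h0 := qc_ne_zero q
  fin_cases x <;> fin_cases y <;>
  simp only [Fin.zero_eta, Fin.mk_one, Fin.reduceFinMk, braidMix_true, braidMix_false, lam] <;>
  match_scalars <;> field_simp <;> ring

theorem braidMix_false_true (q : Param) (F : Fin 4 → Fin 4 → M) (x y : Fin 4) :
    braidMix q false (braidMix q true F) x y = F x y := by
  have h0 := qc_ne_zero q
  fin_cases x <;> fin_cases y <;>
  simp only [Fin.zero_eta, Fin.mk_one, Fin.reduceFinMk, braidMix_true, braidMix_false, lam] <;>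
  match_scalars <;> field_simp <;> ring

end Braid

/-! ### Braid relations and antisymmetrisers -/

theorem sum_pair_comm {M ι κ : Type*} [AddCommMonoid M] [Fintype ι] [Fintype κ]
    (F : ι → ι → κ → κ → M) :
    ∑ a, ∑ b, ∑ c, ∑ d, F a b c d = ∑ c, ∑ d, ∑ a, ∑ b, F a b c d := by
  calc _ = ∑ a, ∑ c, ∑ b, ∑ d, F a b c d := Finset.sum_congr rfl fun _ _ => Finset.sum_comm
    _ = ∑ c, ∑ a, ∑ b, ∑ d, F a b c d := Finset.sum_comm
    _ = ∑ c, ∑ a, ∑ d, ∑ b, F a b c d := Finset.sum_congr rfl fun _ _ =>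
      Finset.sum_congr rfl fun _ _ => Finset.sum_comm
    _ = _ := Finset.sum_congr rfl fun _ _ => Finset.sum_comm

section Braid
variable {M N : Type*} [AddCommGroup M] [Module ℂ M] [AddCommGroup N] [Module ℂ N]

theorem braidAt_mul_not (q : Param) (s : Bool) {k j : ℕ} (h : j + 1 < k) :
    braidAt q s k j M * braidAt q (!s) k j M = 1 := by
  have key : ∀ (s : Bool) (F : Fin 4 → Fin 4 → M) (x y : Fin 4),
      braidMix q s (braidMix q (!s) F) x y = F x y := by
    intro s
    cases s
    · exact braidMix_false_true q
    · exact braidMix_true_false q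
  refine LinearMap.ext fun t => funext fun J => ?_
  rw [Module.End.mul_apply, braidAt_apply q s h, Module.End.one_apply]
  set i₀ : Fin k := ⟨j, Nat.lt_of_succ_lt h⟩
  set i₁ : Fin k := ⟨j + 1, h⟩
  have hne : i₀ ≠ i₁ := by simp [i₀, i₁]
  have hin : ∀ a b, braidAt q (!s) k j M t (Function.update (Function.update J i₀ a) i₁ b)
      = braidMix q (!s) (fun c d => t (Function.update (Function.update J i₀ c) i₁ d)) a b := by
    intro a b
    rw [braidAt_apply q (!s) h]
    have hu : ∀ c d, Function.update (Function.update (Function.update (Function.update J i₀ a)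
        i₁ b) i₀ c) i₁ d = Function.update (Function.update J i₀ c) i₁ d := by
      intro c d
      rw [Function.update_comm hne.symm, Function.update_idem, Function.update_idem]
    simp only [i₀, i₁] at hu hne ⊢
    simp only [hu, Function.update_self, Function.update_of_ne hne]
  simp only [hin]
  rw [key s (fun c d => t (Function.update (Function.update J i₀ c) i₁ d))]
  simp [i₀, i₁]

/-- A tensor is fixed by a braiding if and only if it is fixed by its inverse. -/
theorem braidAt_fixed_of_true (q : Param) (s : Bool) {k j : ℕ} (h : j + 1 < k) {t : W k → M}
    (ht : braidAt q true k j M t = t) : braidAt q s k j M t = t := by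
  cases s
  · have := LinearMap.congr_fun (braidAt_mul_not (M := M) q false h) t
    rwa [Module.End.mul_apply, Bool.not_false, ht] at this
  · exact ht

theorem braid_relation_three_true (q : Param) :
    braidAt q true 3 0 M * braidAt q true 3 1 M * braidAt q true 3 0 M
      = braidAt q true 3 1 M * braidAt q true 3 0 M * braidAt q true 3 1 M := by
  have h0 := qc_ne_zero q
  refine LinearMap.ext fun t => funext fun J => ?_
  rw [vec_three_eta J]
  simp only [Module.End.mul_apply, braidAt_three_zero, braidAt_three_one]
  generalize J 0 = x
  generalize J 1 = y
  generalize J 2 = z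
  fin_cases x <;> fin_cases y <;> fin_cases z <;>
  simp only [Fin.zero_eta, Fin.mk_one, Fin.reduceFinMk, braidMix_true, lam] <;>
  match_scalars <;> field_simp <;> ring

/-- The Yang–Baxter equation, for `σ` and `σ⁻¹`. -/
theorem braid_relation_three (q : Param) (s : Bool) :
    braidAt q s 3 0 M * braidAt q s 3 1 M * braidAt q s 3 0 M
      = braidAt q s 3 1 M * braidAt q s 3 0 M * braidAt q s 3 1 M := by
  cases s
  · -- the relation for the inverse braiding is the inverse of the relation
    let u : ∀ j, j + 1 < 3 → (Module.End ℂ (W 3 → M))ˣ := fun j h =>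
      ⟨braidAt q true 3 j M, braidAt q false 3 j M, braidAt_mul_not q true h,
        braidAt_mul_not q false h⟩
    have h : u 0 (by omega) * u 1 (by omega) * u 0 (by omega)
        = u 1 (by omega) * u 0 (by omega) * u 1 (by omega) :=
      Units.ext (braid_relation_three_true q)
    have h' := congrArg (fun v => ((v⁻¹ : (Module.End ℂ (W 3 → M))ˣ) : Module.End ℂ (W 3 → M))) h
    simp only [mul_inv_rev, Units.val_mul] at h'
    simp only [mul_assoc] at h' ⊢
    exact h'
  · exact braid_relation_three_true q

theorem braid_relation_four_left (q : Param) (s : Bool) :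
    braidAt q s 4 0 M * braidAt q s 4 1 M * braidAt q s 4 0 M
      = braidAt q s 4 1 M * braidAt q s 4 0 M * braidAt q s 4 1 M := by
  refine LinearMap.ext fun t => funext fun J => ?_
  have h := congrFun (LinearMap.congr_fun (braid_relation_three (M := M) q s)
    (fun I => t (Fin.snoc I (J (Fin.last 3)) : W 4))) (Fin.init J)
  have e : ∀ j, j + 1 < 3 → ∀ u : W 4 → M, braidAt q s 3 j M
      (fun I => u (Fin.snoc I (J (Fin.last 3)) : W 4))
        = fun I => braidAt q s 4 j M u (Fin.snoc I (J (Fin.last 3)) : W 4) := by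
    intro j hj u
    funext I
    rw [braidAt_castSucc q s hj]
    simp only [Fin.snoc_last, Fin.init_snoc]
  simpa only [Module.End.mul_apply, e 0 (by omega), e 1 (by omega), Fin.snoc_init_self] using h

theorem braid_relation_four_right (q : Param) (s : Bool) :
    braidAt q s 4 1 M * braidAt q s 4 2 M * braidAt q s 4 1 M
      = braidAt q s 4 2 M * braidAt q s 4 1 M * braidAt q s 4 2 M := by
  refine LinearMap.ext fun t => funext fun J => ?_
  have h := congrFun (LinearMap.congr_fun (braid_relation_three (M := M) q s)
    (fun I => t (Fin.cons (J 0) I : W 4))) (Fin.tail J)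
  have e : ∀ j, j + 1 < 3 → ∀ u : W 4 → M, braidAt q s 3 j M
      (fun I => u (Fin.cons (J 0) I : W 4))
        = fun I => braidAt q s 4 (j + 1) M u (Fin.cons (J 0) I : W 4) := by
    intro j hj u
    funext I
    rw [braidAt_succ q s hj]
    simp
  have e0 := e 0 (by omega)
  have e1 := e 1 (by omega)
  simp only [zero_add, one_add_one_eq_two] at e0 e1
  simpa only [Module.End.mul_apply, e0, e1, Fin.cons_self_tail] using h

theorem braid_comm_four (q : Param) (s : Bool) :
    braidAt q s 4 2 M * braidAt q s 4 0 M = braidAt q s 4 0 M * braidAt q s 4 2 M := by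
  refine LinearMap.ext fun t => funext fun J => ?_
  rw [vec_four_eta J]
  simp only [Module.End.mul_apply, braidAt_four_zero, braidAt_four_two]
  simp only [braidMix, Finset.smul_sum]
  calc _ = ∑ a, ∑ b, ∑ c, ∑ d, braid q s a b (J 2) (J 3) • braid q s c d (J 0) (J 1) •
        t ![c, d, a, b] := rfl
    _ = ∑ c, ∑ d, ∑ a, ∑ b, braid q s a b (J 2) (J 3) • braid q s c d (J 0) (J 1) •
        t ![c, d, a, b] :=
      sum_pair_comm _
    _ = _ := by simp only [smul_comm (braid q s _ _ (J 2) (J 3))]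

theorem antisym_three (q : Param) (s : Bool) : antisym q s 3 M
    = (1 - braidAt q s 3 0 M)
      * (1 - braidAt q s 3 1 M + braidAt q s 3 1 M * braidAt q s 3 0 M) := by
  have h (x : Module.End ℂ (W 3 → M)) : (-1 : ℂ) • x = -x := neg_one_smul ℂ x
  simp [antisym, List.range_succ, Finset.sum_range_succ, braidDown, sub_eq_add_neg, -neg_smul, h]

theorem antisym_four (q : Param) (s : Bool) : antisym q s 4 M
    = (1 - braidAt q s 4 0 M)
      * ((1 - braidAt q s 4 1 M + braidAt q s 4 1 M * braidAt q s 4 0 M)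
        * (1 - braidAt q s 4 2 M + braidAt q s 4 2 M * braidAt q s 4 1 M
          - braidAt q s 4 2 M * braidAt q s 4 1 M * braidAt q s 4 0 M)) := by
  have h (x : Module.End ℂ (W 4 → M)) : (-1 : ℂ) • x = -x := neg_one_smul ℂ x
  have h3 : (-1 : ℂ) ^ 3 = -1 := by norm_num
  simp [antisym, List.range_succ, Finset.sum_range_succ, braidDown, sub_eq_add_neg, -neg_smul, h,
    h3]

end Braid

section Words
variable {R : Type*} [Ring R] {a b c : R}

/-- The antisymmetriser of four strands contains that of the first three strands as right factor. -/
theorem antisym_word_left (hac : c * a = a * c) :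
    (1 - a) * ((1 - b + b * a) * (1 - c + c * b - c * b * a))
      = (1 - c + b * c - a * b * c) * ((1 - a) * (1 - b + b * a)) := by
  have e : ∀ x, c * (a * x) = a * (c * x) := fun x => by
    simpa only [mul_assoc] using congrArg (· * x) hac
  simp only [mul_add, add_mul, mul_one, one_mul, mul_assoc, hac, e, sub_eq_add_neg, neg_add,
    neg_neg, neg_mul, mul_neg, add_assoc]
  abel

/-- The antisymmetriser of four strands contains that of the last three strands as right factor. -/
theorem antisym_word_right (hab : a * b * a = b * a * b) (hbc : b * c * b = c * b * c)
    (hac : c * a = a * c) :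
    (1 - a) * ((1 - b + b * a) * (1 - c + c * b - c * b * a))
      = (1 - a + b * a - c * b * a) * ((1 - b) * (1 - c + c * b)) := by
  have e1 : b * (a * b) = a * (b * a) := by simpa only [mul_assoc] using hab.symm
  have e1' : ∀ x, b * (a * (b * x)) = a * (b * (a * x)) := fun x => by
    simpa only [mul_assoc] using congrArg (· * x) hab.symm
  have e2 : ∀ x, c * (b * (c * x)) = b * (c * (b * x)) := fun x => by
    simpa only [mul_assoc] using congrArg (· * x) hbc.symm
  have e3 : ∀ x, a * (c * x) = c * (a * x) := fun x => by
    simpa only [mul_assoc] using congrArg (· * x) hac.symm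
  have e4 : ∀ x, c * (a * (b * (c * x))) = a * (b * (c * (b * x))) := fun x => by
    rw [← e3, e2]
  simp only [mul_add, add_mul, mul_one, one_mul, mul_assoc, e1, hac.symm, e1', e2, e3, e4,
    sub_eq_add_neg, neg_add, neg_neg, neg_mul, mul_neg, add_assoc]
  abel

theorem antisym_word_three_first :
    (1 - a) * (1 - b + b * a) = (1 - b + a * b) * (1 - a) := by
  simp only [mul_add, add_mul, mul_sub, sub_mul, mul_one, one_mul, ← mul_assoc]
  abel

theorem antisym_word_three_second (hab : a * b * a = b * a * b) :
    (1 - a) * (1 - b + b * a) = (1 - a + b * a) * (1 - b) := by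
  simp only [mul_add, add_mul, mul_sub, sub_mul, mul_one, one_mul, ← mul_assoc, hab]
  abel

end Words

section Antisym
variable {M : Type*} [AddCommGroup M] [Module ℂ M]

theorem antisym_four_left (q : Param) (s : Bool) : antisym q s 4 M
    = (1 - braidAt q s 4 2 M + braidAt q s 4 1 M * braidAt q s 4 2 M
        - braidAt q s 4 0 M * braidAt q s 4 1 M * braidAt q s 4 2 M)
      * ((1 - braidAt q s 4 0 M)
        * (1 - braidAt q s 4 1 M + braidAt q s 4 1 M * braidAt q s 4 0 M)) := by
  rw [antisym_four]
  exact antisym_word_left (braid_comm_four q s)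

theorem antisym_four_right (q : Param) (s : Bool) : antisym q s 4 M
    = (1 - braidAt q s 4 0 M + braidAt q s 4 1 M * braidAt q s 4 0 M
        - braidAt q s 4 2 M * braidAt q s 4 1 M * braidAt q s 4 0 M)
      * ((1 - braidAt q s 4 1 M)
        * (1 - braidAt q s 4 2 M + braidAt q s 4 2 M * braidAt q s 4 1 M)) := by
  rw [antisym_four]
  exact antisym_word_right (braid_relation_four_left q s) (braid_relation_four_right q s)
    (braid_comm_four q s)

/-- The antisymmetriser kills the tensors which are fixed by one of the braidings. -/
theorem antisym_four_eq_zero (q : Param) (s : Bool) {j : ℕ} (hj : j < 3) {t : W 4 → M}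
    (ht : braidAt q true 4 j M t = t) : antisym q s 4 M t = 0 := by
  have ht' := braidAt_fixed_of_true q s (by omega) ht
  have h0 : (1 - braidAt q s 4 j M) t = 0 := by
    rw [LinearMap.sub_apply, Module.End.one_apply, ht', sub_self]
  interval_cases j
  · rw [antisym_four_left, antisym_word_three_first,
      Module.End.mul_apply, Module.End.mul_apply, h0, map_zero, map_zero]
  · rw [antisym_four_left, antisym_word_three_second (braid_relation_four_left q s),
      Module.End.mul_apply, Module.End.mul_apply, h0, map_zero, map_zero]
  · rw [antisym_four_right, antisym_word_three_second (braid_relation_four_right q s),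
      Module.End.mul_apply, Module.End.mul_apply, h0, map_zero, map_zero]

end Antisym

/-! ### Tensor products with one-forms -/

/-- The tensor `η ⊗ t` of a one-form `η = ∑ η_a ω_a` and a tensor `t`. -/
noncomputable def prepend (q : Param) {k : ℕ} (η : Fin 4 → A q) : T q k →ₗ[ℂ] T q (k + 1) where
  toFun t J := ∑ a, η a * act q (f q a (J 0)) (t (Fin.tail J))
  map_add' t u := by
    funext J
    simp only [Pi.add_apply, map_add, mul_add, Finset.sum_add_distrib]
  map_smul' r t := by
    funext J
    simp only [Pi.smul_apply, map_smul, mul_smul_comm, RingHom.id_apply, Finset.smul_sum]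

theorem prepend_apply (q : Param) {k : ℕ} (η : Fin 4 → A q) (t : T q k) (J : W (k + 1)) :
    prepend q η t J = ∑ a, η a * act q (f q a (J 0)) (t (Fin.tail J)) := rfl

/-- The tensor `θ ⊗ t`. By `sum_theta_smul_f` its coefficients are those given here. -/
noncomputable def thetaLeft (q : Param) {k : ℕ} : T q k →ₗ[ℂ] T q (k + 1) where
  toFun t J := act q (L q (J 0)) (t (Fin.tail J)) + theta q (J 0) • t (Fin.tail J)
  map_add' t u := by
    funext J
    simp only [Pi.add_apply, map_add, smul_add]
    abel
  map_smul' r t := by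
    funext J
    simp only [Pi.smul_apply, map_smul, RingHom.id_apply, smul_add, smul_comm r]

/-- The tensor `t ⊗ θ`. -/
noncomputable def thetaRight (q : Param) {k : ℕ} : T q k →ₗ[ℂ] T q (k + 1) where
  toFun t J := theta q (J (Fin.last k)) • t (Fin.init J)
  map_add' t u := by
    funext J
    simp only [Pi.add_apply, smul_add]
  map_smul' r t := by
    funext J
    simp only [Pi.smul_apply, RingHom.id_apply, smul_comm r]

theorem thetaLeft_apply (q : Param) {k : ℕ} (t : T q k) (J : W (k + 1)) : thetaLeft q t J
    = act q (L q (J 0)) (t (Fin.tail J)) + theta q (J 0) • t (Fin.tail J) := rfl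

theorem thetaRight_apply (q : Param) {k : ℕ} (t : T q k) (J : W (k + 1)) :
    thetaRight q t J = theta q (J (Fin.last k)) • t (Fin.init J) := rfl

theorem diffTensor_succ (q : Param) (k : ℕ) (x : Fin (k + 1) → A q) :
    diffTensor q (k + 1) x = prepend q (diff q (x 0)) (diffTensor q k (Fin.tail x)) := rfl

/-- `θ x = d x + x θ`. -/
theorem thetaLeft_smul (q : Param) {k : ℕ} (x : A q) (t : T q k) :
    thetaLeft q (x • t) = prepend q (diff q x) t + x • thetaLeft q t := by
  funext J
  simp only [thetaLeft_apply, prepend_apply, Pi.add_apply, Pi.smul_apply, smul_eq_mul, L_mul, diff,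
    mul_add, mul_smul_comm]
  abel

theorem thetaRight_smul (q : Param) {k : ℕ} (x : A q) (t : T q k) :
    thetaRight q (x • t) = x • thetaRight q t := by
  funext J
  simp only [thetaRight_apply, Pi.smul_apply, smul_eq_mul, mul_smul_comm]

theorem prepend_smul_left (q : Param) {k : ℕ} (x : A q) (η : Fin 4 → A q) (t : T q k) :
    prepend q (x • η) t = x • prepend q η t := by
  funext J
  simp only [prepend_apply, Pi.smul_apply, smul_eq_mul, mul_assoc, Finset.mul_sum]

theorem prepend_add_left (q : Param) {k : ℕ} (η ζ : Fin 4 → A q) (t : T q k) :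
    prepend q (η + ζ) t = prepend q η t + prepend q ζ t := by
  funext J
  simp only [prepend_apply, Pi.add_apply, add_mul, Finset.sum_add_distrib]

theorem prepend_zero_left (q : Param) {k : ℕ} (t : T q k) : prepend q 0 t = 0 := by
  funext J
  simp [prepend_apply]

/-- `d x ⊗ y t = d (x y) ⊗ t - x d y ⊗ t`. -/
theorem prepend_diff_smul (q : Param) {k : ℕ} (x y : A q) (t : T q k) :
    prepend q (diff q x) (y • t)
      = prepend q (diff q (x * y)) t - x • prepend q (diff q y) t := by
  have h1 := thetaLeft_smul q x (y • t)
  have h2 := thetaLeft_smul q (x * y) t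
  have h3 := thetaLeft_smul q y t
  rw [smul_smul, h2, h3, smul_add, smul_smul] at h1
  rw [eq_sub_iff_add_eq]
  rw [← add_assoc] at h1
  exact (add_right_cancel h1).symm

theorem prepend_thetaRight (q : Param) {k : ℕ} (η : Fin 4 → A q) (t : T q k) :
    prepend q η (thetaRight q t) = thetaRight q (prepend q η t) := by
  funext J
  simp only [thetaRight_apply, prepend_apply, map_smul, mul_smul_comm, Finset.smul_sum]
  rfl

theorem braidAt_prepend (q : Param) (s : Bool) {k j : ℕ} (h : j + 1 < k) (η : Fin 4 → A q)
    (t : T q k) : braidAt q s (k + 1) (j + 1) (A q) (prepend q η t)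
      = prepend q η (braidAt q s k j (A q) t) := by
  funext J
  rw [braidAt_succ q s h, prepend_apply]
  simp only [prepend_apply, Fin.cons_zero, Fin.tail_cons]
  let φ : A q →ₗ[ℂ] A q := ∑ a, (LinearMap.mulLeft ℂ (η a)).comp (act q (f q a (J 0)))
  have hφ : ∀ y, φ y = ∑ a, η a * act q (f q a (J 0)) y := by
    intro y
    simp [φ, LinearMap.sum_apply]
  simp only [← hφ]
  exact braidAt_map q s j φ t _

theorem braidAt_thetaLeft (q : Param) (s : Bool) {k j : ℕ} (h : j + 1 < k)
    (t : T q k) : braidAt q s (k + 1) (j + 1) (A q) (thetaLeft q t)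
      = thetaLeft q (braidAt q s k j (A q) t) := by
  funext J
  rw [braidAt_succ q s h, thetaLeft_apply]
  simp only [thetaLeft_apply, Fin.cons_zero, Fin.tail_cons]
  exact braidAt_map q s j (act q (L q (J 0)) + theta q (J 0) • LinearMap.id) t _

theorem braidAt_thetaRight (q : Param) (s : Bool) {k j : ℕ} (h : j + 1 < k)
    (t : T q k) : braidAt q s (k + 1) j (A q) (thetaRight q t)
      = thetaRight q (braidAt q s k j (A q) t) := by
  funext J
  rw [braidAt_castSucc q s h, thetaRight_apply]
  simp only [thetaRight_apply, Fin.snoc_last, Fin.init_snoc]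
  exact braidAt_map q s j (theta q (J (Fin.last k)) • (LinearMap.id : A q →ₗ[ℂ] A q)) t _

/-- The anticommutator `θ ⊗ d x + d x ⊗ θ`, tensored with anything, is fixed by the braiding. -/
theorem braidAt_anticommutator (q : Param) {k : ℕ} (x : A q) (t : T q k) :
    braidAt q true (k + 2) 0 (A q)
        (thetaLeft q (prepend q (diff q x) t) + prepend q (diff q x) (thetaLeft q t))
      = thetaLeft q (prepend q (diff q x) t) + prepend q (diff q x) (thetaLeft q t) := by
  set p : Fin 4 → Fin 4 → U q := fun b c => L q b * L q c + theta q b • L q c + theta q c • L q b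
    with hp
  have hθ : ∀ b (y : A q), ∑ c, theta q c • act q (f q c b) y
      = act q (L q b) y + theta q b • y := by
    intro b y
    have h := congrArg (fun u => act q u y) (sum_theta_smul_f q b)
    simpa [LinearMap.sum_apply, map_sum, Algebra.algebraMap_eq_smul_one] using h
  -- the coefficients of the anticommutator, with all coefficients moved to the left
  have key : ∀ J : W (k + 2),
      (thetaLeft q (prepend q (diff q x) t) + prepend q (diff q x) (thetaLeft q t)) J
        = ∑ e, ∑ g, act q (p e g) x * act q (f q e (J 0) * f q g (J 1))
            (t (Fin.tail (Fin.tail J))) := by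
    intro J
    have e1 : Fin.tail J 0 = J 1 := rfl
    have e2 : ∑ e, ∑ g, (theta q e • act q (L q g) x) * act q (f q e (J 0))
          (act q (f q g (J 1)) (t (Fin.tail (Fin.tail J))))
        = ∑ g, act q (L q g) x * (act q (L q (J 0)) (act q (f q g (J 1))
          (t (Fin.tail (Fin.tail J)))) + theta q (J 0) • act q (f q g (J 1))
          (t (Fin.tail (Fin.tail J)))) := by
      rw [Finset.sum_comm]
      refine Finset.sum_congr rfl fun g _ => ?_
      simp only [← hθ, Finset.mul_sum, smul_mul_assoc, mul_smul_comm]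
    have e3 : ∑ e, ∑ g, (theta q g • act q (L q e) x) * act q (f q e (J 0))
          (act q (f q g (J 1)) (t (Fin.tail (Fin.tail J))))
        = ∑ e, act q (L q e) x * act q (f q e (J 0)) (act q (L q (J 1))
          (t (Fin.tail (Fin.tail J))) + theta q (J 1) • t (Fin.tail (Fin.tail J))) := by
      refine Finset.sum_congr rfl fun e _ => ?_
      simp only [← hθ, map_sum, map_smul, Finset.mul_sum, smul_mul_assoc, mul_smul_comm]
    simp only [hp, map_add, map_mul, map_smul, LinearMap.add_apply, LinearMap.smul_apply,
      Module.End.mul_apply, add_mul, Finset.sum_add_distrib, e2, e3]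
    simp only [Pi.add_apply, thetaLeft_apply, prepend_apply, e1, diff, map_sum, L_mul,
      map_add, map_smul, mul_add,
      Finset.sum_add_distrib, Finset.smul_sum, mul_smul_comm]
    rw [Finset.sum_comm (γ := Fin 4)]
    abel
  funext J
  rw [braidAt_zero]
  simp only [key, Fin.cons_zero, Fin.tail_cons, Fin.cons_one]
  generalize t (Fin.tail (Fin.tail J)) = y
  generalize J 0 = b
  generalize J 1 = c
  calc braidMix q true (fun a' b' => ∑ e, ∑ g, act q (p e g) x * act q (f q e a' * f q g b') y) b c
      = ∑ e, ∑ g, act q (p e g) x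
          * act q (braidMix q true (fun a' b' => f q e a' * f q g b') b c) y := by
        let φ : Fin 4 → Fin 4 → U q →ₗ[ℂ] A q := fun e g =>
          (LinearMap.mulLeft ℂ (act q (p e g) x)).comp
            ((LinearMap.applyₗ y).comp (act q).toLinearMap)
        have h : ∀ e g, act q (p e g) x
            * act q (braidMix q true (fun a' b' => f q e a' * f q g b') b c) y
              = braidMix q true (fun a' b' => act q (p e g) x * act q (f q e a' * f q g b') y)
                b c := fun e g => (braidMix_map q true (φ e g) _ b c).symm
        simp only [h]
        simp only [braidMix, Finset.smul_sum]
        exact sum_pair_comm _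
    _ = ∑ e, ∑ g, ∑ c', ∑ d', (braid q true e g c' d' • act q (p e g) x)
          * act q (f q c' b * f q d' c) y := by
        simp only [braidMix_f_mul_f, map_sum, map_smul, LinearMap.sum_apply, LinearMap.smul_apply,
          Finset.mul_sum, smul_mul_assoc, mul_smul_comm]
    _ = ∑ c', ∑ d', act q (braidMix q true p c' d') x * act q (f q c' b * f q d' c) y := by
        simp only [braidMix, map_sum, map_smul, LinearMap.sum_apply, LinearMap.smul_apply,
          Finset.sum_mul]
        exact sum_pair_comm _
    _ = _ := by
        have h : ∀ c' d', braidMix q true p c' d' = p c' d' := braidMix_L_mul_L q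
        simp only [h]

/-! ### The exterior derivative of three-forms -/

theorem act_K (q : Param) : act q (ugen q .K) = (kL q).toLinearMap := by rw [act, liftU_ugen]
theorem act_Ki (q : Param) : act q (ugen q .Ki) = (kiL q).toLinearMap := by rw [act, liftU_ugen]
theorem act_E (q : Param) : act q (ugen q .E) = eL q := by rw [act, liftU_ugen]
theorem act_F (q : Param) : act q (ugen q .F) = fL q := by rw [act, liftU_ugen]

/-- The tensor `θ ⊗ t + t ⊗ θ`, which represents the graded commutator of `θ` with a form of
degree three. -/
noncomputable def thetaAnti (q : Param) : T q 3 →ₗ[ℂ] T q 4 := thetaLeft q + thetaRight q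

theorem act_L_one (q : Param) (a : Fin 4) : act q (L q a) 1 = 0 := by
  have e1 : eL q 1 = 0 := by simpa using eL_algebraMap q 1
  have e2 : fL q 1 = 0 := by simpa using fL_algebraMap q 1
  fin_cases a <;>
  simp only [Fin.zero_eta, Fin.mk_one, Fin.reduceFinMk, L_0, L_1, L_2, L_3, map_smul, map_mul,
    map_add, map_sub, map_one, act_K, act_Ki, act_E, act_F, LinearMap.smul_apply,
    LinearMap.add_apply, LinearMap.sub_apply, Module.End.mul_apply, Module.End.one_apply,
    AlgHom.toLinearMap_apply, e1, e2, map_zero, smul_zero, sub_self, add_zero]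

theorem act_f_one (q : Param) (a b : Fin 4) :
    act q (f q a b) 1 = if a = b then 1 else 0 := by
  have e1 : eL q 1 = 0 := by simpa using eL_algebraMap q 1
  have e2 : fL q 1 = 0 := by simpa using fL_algebraMap q 1
  fin_cases a <;> fin_cases b <;>
  simp only [Fin.zero_eta, Fin.mk_one, Fin.reduceFinMk, f_00, f_01, f_02, f_03, f_10, f_11, f_12,
    f_13, f_20, f_21, f_22, f_23, f_30, f_31, f_32, f_33, map_smul, map_mul, map_add, map_sub,
    map_one, act_K, act_Ki, act_E, act_F, LinearMap.smul_apply, act_L_one, map_zero,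
    LinearMap.zero_apply, Fin.reduceEq, if_true, if_false,
    LinearMap.add_apply, LinearMap.sub_apply, Module.End.mul_apply, Module.End.one_apply,
    AlgHom.toLinearMap_apply, e1, e2, smul_zero, sub_self, add_zero]

/-- `θ ∧ d x ∧ d y ∧ d z + d x ∧ d y ∧ d z ∧ θ = 0`, since `θ` anticommutes with differentials. -/
theorem antisym_thetaAnti_diff (q : Param) (s : Bool) (x y z : A q) {u : T q 0}
    (hu : thetaRight q u = thetaLeft q u) :
    antisym q s 4 (A q) (thetaAnti q
      (prepend q (diff q x) (prepend q (diff q y) (prepend q (diff q z) u)))) = 0 := by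
  have h0 := antisym_four_eq_zero q s (j := 0) (by omega)
    (braidAt_anticommutator q x (prepend q (diff q y) (prepend q (diff q z) u)))
  have h1 := antisym_four_eq_zero q s (j := 1) (by omega)
    ((braidAt_prepend q true (j := 0) (by omega) (diff q x) _).trans
      (congrArg (prepend q (diff q x)) (braidAt_anticommutator q y (prepend q (diff q z) u))))
  have h2 := antisym_four_eq_zero q s (j := 2) (by omega)
    ((braidAt_prepend q true (j := 1) (by omega) (diff q x) _).trans
      (congrArg (prepend q (diff q x)) ((braidAt_prepend q true (j := 0) (by omega)
        (diff q y) _).trans (congrArg (prepend q (diff q y)) (braidAt_anticommutator q z u)))))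
  rw [thetaAnti, LinearMap.add_apply, ← prepend_thetaRight, ← prepend_thetaRight,
    ← prepend_thetaRight, hu]
  -- the alternating sum of the three anticommutators telescopes
  simp only [map_add] at h0 h1 h2 ⊢
  have h := congrArg₂ (· + ·) (congrArg₂ (· - ·) h0 h1) h2
  refine Eq.trans ?_ (h.trans (by rw [sub_zero, add_zero]))
  abel

theorem thetaRight_one (q : Param) :
    thetaRight q (fun _ => 1 : T q 0) = thetaLeft q (fun _ => 1) := by
  funext J
  rw [thetaRight_apply, thetaLeft_apply, act_L_one, zero_add]
  rfl

/-- The map `t ↦ θ ⊗ t + t ⊗ θ` descends to forms, since the antisymmetriser of four strands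
contains those of the first three and of the last three strands as right factors. -/
theorem antisym_thetaAnti_eq_zero (q : Param) (s : Bool) {t : T q 3}
    (ht : antisym q s 3 (A q) t = 0) : antisym q s 4 (A q) (thetaAnti q t) = 0 := by
  rw [antisym_three] at ht
  have hl : ((1 - braidAt q s 4 1 (A q)) * (1 - braidAt q s 4 2 (A q)
      + braidAt q s 4 2 (A q) * braidAt q s 4 1 (A q))) (thetaLeft q t) = 0 := by
    rw [← map_zero (thetaLeft q), ← ht]
    simp only [Module.End.mul_apply, LinearMap.sub_apply, LinearMap.add_apply,
      Module.End.one_apply, braidAt_thetaLeft q s (j := 0) (by omega : 0 + 1 < 3),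
      braidAt_thetaLeft q s (j := 1) (by omega : 1 + 1 < 3), map_sub, map_add]
  have hr : ((1 - braidAt q s 4 0 (A q)) * (1 - braidAt q s 4 1 (A q)
      + braidAt q s 4 1 (A q) * braidAt q s 4 0 (A q))) (thetaRight q t) = 0 := by
    rw [← map_zero (thetaRight q), ← ht]
    simp only [Module.End.mul_apply, LinearMap.sub_apply, LinearMap.add_apply,
      Module.End.one_apply, braidAt_thetaRight q s (j := 0) (by omega : 0 + 1 < 3),
      braidAt_thetaRight q s (j := 1) (by omega : 1 + 1 < 3), map_sub, map_add]
  rw [thetaAnti, LinearMap.add_apply, map_add, antisym_four_right, Module.End.mul_apply, hl,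
    map_zero, zero_add, ← antisym_four_right, antisym_four_left, Module.End.mul_apply, hr, map_zero]

/-- The map `ξ ↦ θ ∧ ξ + ξ ∧ θ` is an exterior derivative on three-forms. -/
theorem exists_isExteriorDerivative_three (q : Param) (s : Bool) :
    ∃ D, IsExteriorDerivative q s 3 D ∧
      ∀ t, D (wedge q s 3 t) = wedge q s 4 (thetaAnti q t) := by
  obtain ⟨r, hr⟩ := (wedge q s 3).exists_rightInverse_of_surjective
    (LinearMap.range_rangeRestrict _)
  have hD : ∀ t, ((wedge q s 4).comp ((thetaAnti q).comp r)) (wedge q s 3 t)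
      = wedge q s 4 (thetaAnti q t) := by
    intro t
    have h : wedge q s 3 (r (wedge q s 3 t)) = wedge q s 3 t :=
      LinearMap.congr_fun hr (wedge q s 3 t)
    rw [← sub_eq_zero, ← map_sub] at h
    have h' := antisym_thetaAnti_eq_zero q s (congrArg Subtype.val h)
    rw [map_sub, map_sub, sub_eq_zero] at h'
    exact Subtype.ext h'
  refine ⟨_, fun x => ?_, hD⟩
  rw [hD]
  refine Subtype.ext ?_
  change antisym q s 4 (A q) _ = antisym q s 4 (A q) _
  have e : thetaAnti q (fun J => x 0 * diffTensor q 3 (Fin.tail x) J)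
      = diffTensor q 4 x + x 0 • thetaAnti q (diffTensor q 3 (Fin.tail x)) := by
    change thetaAnti q (x 0 • diffTensor q 3 (Fin.tail x)) = _
    rw [thetaAnti, LinearMap.add_apply, thetaLeft_smul, thetaRight_smul, diffTensor_succ q 3 x,
      LinearMap.add_apply, smul_add, add_assoc]
  have hs : ∀ (y : A q) (t : T q 4), antisym q s 4 (A q) (y • t) = y • antisym q s 4 (A q) t := by
    intro y t
    have hb : ∀ j (u : T q 4), braidAt q s 4 j (A q) (y • u) = y • braidAt q s 4 j (A q) u :=
      fun j u => funext fun J => braidAt_map q s j (LinearMap.mulLeft ℂ y) u J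
    simp only [antisym_four, Module.End.mul_apply, LinearMap.sub_apply, LinearMap.add_apply,
      Module.End.one_apply, map_sub, map_add, hb, smul_sub, smul_add]
  have h0 : antisym q s 4 (A q) (thetaAnti q (diffTensor q 3 (Fin.tail x))) = 0 :=
    antisym_thetaAnti_diff q s _ _ _ (thetaRight_one q)
  rw [e, map_add, hs, h0, smul_zero, add_zero]

/-! ### One-forms are spanned by differentials -/

/-- The eigenvalue of `L_0` on the generators. -/
noncomputable def casimirHalf (q : Param) : ℂ := (lam q ^ 2)⁻¹ * (2 - qc q - (qc q)⁻¹) + 1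

theorem casimirHalf_ne_zero (q : Param) : casimirHalf q ≠ 0 := by
  have h0 := qc_ne_zero q
  have h1 := lam_ne_zero q
  have e : casimirHalf q = (lam q ^ 2)⁻¹ * (qc q ^ 2)⁻¹ * ((qc q - 1) * (qc q ^ 3 - 1)) := by
    have e2 : 2 - qc q - (qc q)⁻¹ + lam q ^ 2
        = (qc q ^ 2)⁻¹ * ((qc q - 1) * (qc q ^ 3 - 1)) := by
      rw [lam]
      field_simp
      ring
    rw [casimirHalf, mul_assoc, ← e2, mul_add, inv_mul_cancel₀ (pow_ne_zero 2 h1)]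
  have hq : (q : ℝ) < 1 := q.2.2
  have h3 : (q : ℝ) ^ 3 < 1 := pow_lt_one₀ q.2.1.le hq (by norm_num)
  rw [e]
  refine mul_ne_zero (mul_ne_zero (inv_ne_zero (pow_ne_zero 2 h1)) (inv_ne_zero (pow_ne_zero 2 h0)))
    (mul_ne_zero ?_ ?_)
  · rw [qc]
    exact_mod_cast (sub_neg.2 hq).ne
  · rw [qc]
    exact_mod_cast (sub_neg.2 h3).ne

/-- The differentials of the generators, in the order `ω₋, ω₊, ω₀, ω_z`. -/
theorem diff_gen (q : Param) :
    diff q (gen q .a) = ![0, -(qc q • gen q .cs), casimirHalf q • gen q .a,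
      ((lam q)⁻¹ * (qc q - 1)) • gen q .a] ∧
    diff q (gen q .c) = ![0, gen q .as, casimirHalf q • gen q .c,
      ((lam q)⁻¹ * (qc q - 1)) • gen q .c] ∧
    diff q (gen q .as) = ![gen q .c, 0, casimirHalf q • gen q .as,
      ((lam q)⁻¹ * ((qc q)⁻¹ - 1)) • gen q .as] ∧
    diff q (gen q .cs) = ![-((qc q)⁻¹ • gen q .a), 0, casimirHalf q • gen q .cs,
      ((lam q)⁻¹ * ((qc q)⁻¹ - 1)) • gen q .cs] := by
  have h0 := qh_ne_zero q
  have h1 := qh_pow_four_sub_one_ne_zero q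
  have hk := kL_gen q
  have hi := kiL_gen q
  have he := eL_gen q
  have hf := fL_gen q
  refine ⟨?_, ?_, ?_, ?_⟩ <;> funext b <;> fin_cases b <;>
  simp only [diff, Fin.zero_eta, Fin.mk_one, Fin.reduceFinMk, L_0, L_1, L_2, L_3, map_smul,
    map_mul, map_add, map_sub, map_one, act_K, act_Ki, act_E, act_F, LinearMap.smul_apply,
    LinearMap.add_apply, LinearMap.sub_apply, Module.End.mul_apply, Module.End.one_apply,
    AlgHom.toLinearMap_apply, hk, hi, he, hf, map_neg, map_zero, smul_zero, Matrix.cons_val_zero,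
    Matrix.cons_val_one, Matrix.cons_val, casimirHalf, lam_eq_qh, qc_eq_qh] <;>
  match_scalars <;> field_simp <;> ring

/-- One-forms are spanned by differentials, as the Maurer-Cartan forms of the fundamental
corepresentation show. -/
theorem span_diff (q : Param) : Submodule.span (A q) (Set.range (diff q)) = ⊤ := by
  set S := Submodule.span (A q) (Set.range (diff q))
  obtain ⟨ha, hc, has, hcs⟩ := diff_gen q
  have hm : ∀ x y, x • diff q y ∈ S := fun x y =>
    S.smul_mem _ (Submodule.subset_span ⟨y, rfl⟩)
  have hr : ∀ (r : ℂ) {v : Fin 4 → A q}, v ∈ S → r • v ∈ S := by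
    intro r v hv
    rw [← algebraMap_smul (A q) r v]
    exact S.smul_mem _ hv
  have h0 := qc_ne_zero q
  have hl := lam_ne_zero q
  have hβ := casimirHalf_ne_zero q
  -- two combinations in which `ω₋` and `ω₊` cancel, and two in which only `ω₊` or `ω₋` survives
  have u1 := S.add_mem (hm (gen q .as) (gen q .a)) (hm (gen q .cs) (gen q .c))
  have u2 := S.add_mem (hm (gen q .a) (gen q .as))
    (hr (qc q * qc q) (hm (gen q .c) (gen q .cs)))
  have up := S.sub_mem (hm (gen q .a) (gen q .c)) (hr (qc q) (hm (gen q .c) (gen q .a)))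
  have um := S.sub_mem (hm (gen q .cs) (gen q .as)) (hr (qc q) (hm (gen q .as) (gen q .cs)))
  have e1 : gen q .as • diff q (gen q .a) + gen q .cs • diff q (gen q .c)
      = ![0, 0, casimirHalf q • 1, ((lam q)⁻¹ * (qc q - 1)) • 1] := by
    rw [ha, hc]
    funext b
    fin_cases b <;>
    simp [gen_csas, ← smul_add, gen_asa]
  have e2 : gen q .a • diff q (gen q .as) + (qc q * qc q) • gen q .c • diff q (gen q .cs)
      = ![0, 0, casimirHalf q • 1, ((lam q)⁻¹ * ((qc q)⁻¹ - 1)) • 1] := by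
    rw [has, hcs]
    funext b
    fin_cases b <;>
    simp [gen_aas', gen_ccs, gen_ac, smul_smul, h0, mul_assoc] <;> module
  have e3 : gen q .a • diff q (gen q .c) - qc q • gen q .c • diff q (gen q .a)
      = ![0, 1, 0, 0] := by
    rw [ha, hc]
    funext b
    fin_cases b <;>
    simp [gen_aas', gen_ccs, gen_ac, smul_smul] <;> module
  have e4 : gen q .cs • diff q (gen q .as) - qc q • gen q .as • diff q (gen q .cs)
      = ![1, 0, 0, 0] := by
    rw [has, hcs]
    funext b
    fin_cases b <;>
    simp [gen_asa', gen_csas, smul_smul, h0] <;> module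
  rw [e1] at u1
  rw [e2] at u2
  rw [e3] at up
  rw [e4] at um
  -- `u1` and `u2` have the same `ω₀`-coefficient, and their `ω_z`-coefficients differ by one
  have uz : (![0, 0, 0, 1] : Fin 4 → A q) ∈ S := by
    have h := S.sub_mem u1 u2
    convert h using 1
    have : (lam q)⁻¹ * (qc q - 1) - (lam q)⁻¹ * ((qc q)⁻¹ - 1) = 1 := by
      rw [← mul_sub, sub_sub_sub_cancel_right, ← lam, inv_mul_cancel₀ hl]
    funext b
    fin_cases b <;> simp [← sub_smul, this]
  have u0 : (![0, 0, 1, 0] : Fin 4 → A q) ∈ S := by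
    have h := hr (casimirHalf q)⁻¹ (S.sub_mem u1 (hr ((lam q)⁻¹ * (qc q - 1)) uz))
    convert h using 1
    funext b
    fin_cases b <;> simp [smul_smul, hβ]
  refine eq_top_iff.2 fun v _ => ?_
  have hv : v = v 0 • ![1, 0, 0, 0] + v 1 • ![0, 1, 0, 0] + v 2 • ![0, 0, 1, 0]
      + v 3 • ![0, 0, 0, 1] := by
    funext b
    fin_cases b <;> simp
  rw [hv]
  exact S.add_mem (S.add_mem (S.add_mem (S.smul_mem _ um) (S.smul_mem _ up)) (S.smul_mem _ u0))
    (S.smul_mem _ uz)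

theorem prepend_single (q : Param) {k : ℕ} (J : W (k + 1)) :
    prepend q (Pi.single (J 0) 1) (Pi.single (Fin.tail J) 1) = Pi.single J 1 := by
  funext I
  have h1 : ∀ a b, act q (f q a b) ((Pi.single (Fin.tail J) (1 : A q) : T q k) (Fin.tail I))
      = if a = b then (if Fin.tail I = Fin.tail J then 1 else 0) else 0 := by
    intro a b
    by_cases h : Fin.tail I = Fin.tail J
    · rw [h, Pi.single_eq_same, act_f_one]
      simp
    · rw [Pi.single_eq_of_ne h, map_zero]
      simp [h]
  simp only [prepend_apply, h1]
  by_cases h : I = J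
  · subst h
    simp [Pi.single_apply]
  · rw [Pi.single_eq_of_ne h]
    by_cases h2 : Fin.tail I = Fin.tail J
    · have h3 : I 0 ≠ J 0 := by
        intro h3
        apply h
        rw [← Fin.cons_self_tail I, ← Fin.cons_self_tail J, h2, h3]
      simp [Pi.single_apply, h3]
    · simp [h2]

/-- The tensors `x₀ d x₁ ⊗ ⋯ ⊗ d x_k` span `Ω^{⊗k}`. -/
theorem span_diffTensor (q : Param) (k : ℕ) :
    Submodule.span (A q) (Set.range (diffTensor q k)) = ⊤ := by
  induction k with
  | zero =>
    refine eq_top_iff.2 fun t _ => ?_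
    have ht : t = t ![] • diffTensor q 0 Fin.elim0 := by
      funext J
      rw [Subsingleton.elim J ![]]
      exact (mul_one _).symm
    rw [ht]
    exact Submodule.smul_mem _ _ (Submodule.subset_span ⟨_, rfl⟩)
  | succ k ih =>
    set S := Submodule.span (A q) (Set.range (diffTensor q (k + 1)))
    have h1 : ∀ t : T q k, ∀ z, prepend q (diff q z) t ∈ S := by
      intro t
      have ht : t ∈ Submodule.span (A q) (Set.range (diffTensor q k)) := ih ▸ Submodule.mem_top
      induction ht using Submodule.span_induction with
      | mem t ht =>
        obtain ⟨x, rfl⟩ := ht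
        intro z
        exact Submodule.subset_span ⟨Fin.cons z x, rfl⟩
      | zero => intro z; rw [map_zero]; exact S.zero_mem
      | add t u _ _ ht hu => intro z; rw [map_add]; exact S.add_mem (ht z) (hu z)
      | smul y t _ ht =>
        intro z
        rw [prepend_diff_smul]
        exact S.sub_mem (ht _) (S.smul_mem _ (ht _))
    have h2 : ∀ (η : Fin 4 → A q) (t : T q k), prepend q η t ∈ S := by
      intro η t
      have hη : η ∈ Submodule.span (A q) (Set.range (diff q)) := span_diff q ▸ Submodule.mem_top
      induction hη using Submodule.span_induction with
      | mem η hη => obtain ⟨z, rfl⟩ := hη; exact h1 t z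
      | zero => rw [prepend_zero_left]; exact S.zero_mem
      | add η ζ _ _ hη hζ => rw [prepend_add_left]; exact S.add_mem hη hζ
      | smul y η _ hη => rw [prepend_smul_left]; exact S.smul_mem _ hη
    refine eq_top_iff.2 fun t _ => ?_
    have ht : t = ∑ J, t J • (Pi.single J 1 : T q (k + 1)) := by
      funext I
      simp [Finset.sum_apply, Pi.single_apply]
    rw [ht]
    refine S.sum_mem fun J _ => S.smul_mem _ ?_
    rw [← prepend_single]
    exact h2 _ _

/-- `d ξ = θ ∧ ξ + ξ ∧ θ` on three-forms. An exterior derivative is unique because forms are spanned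
by the `x₀ d x₁ ∧ d x₂ ∧ d x₃`, and `extD` is one because one exists. -/
theorem extD_wedge (q : Param) (s : Bool) (t : T q 3) :
    extD q s 3 (wedge q s 3 t) = wedge q s 4 (thetaAnti q t) := by
  obtain ⟨D, hD, hDθ⟩ := exists_isExteriorDerivative_three q s
  have h : ∃ D, IsExteriorDerivative q s 3 D := ⟨D, hD⟩
  have hd : IsExteriorDerivative q s 3 (extD q s 3) := by
    rw [extD, dif_pos h]
    exact h.choose_spec
  rw [← hDθ]
  have ht : t ∈ Submodule.span (A q) (Set.range (diffTensor q 3)) :=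
    span_diffTensor q 3 ▸ Submodule.mem_top
  -- neither side is known to be left linear over the algebra, so scalars are carried along
  have key : ∀ y : A q, extD q s 3 (wedge q s 3 (y • t)) = D (wedge q s 3 (y • t)) := by
    induction ht using Submodule.span_induction with
    | mem t ht =>
      obtain ⟨x, rfl⟩ := ht
      intro y
      exact (hd (Fin.cons y x)).trans (hD (Fin.cons y x)).symm
    | zero => intro y; simp only [smul_zero, map_zero]
    | add t u _ _ ht hu => intro y; simp only [smul_add, map_add, ht, hu]
    | smul z t _ ht => intro y; rw [smul_smul, ht]
  simpa only [one_smul] using key 1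

/-! ### The volume form -/

/-- The functional `ε` on four-tensors for which `ω_I = ε(ω_I) · ω₋ ∧ ω₊ ∧ ω_0 ∧ ω_z` in the
exterior algebras of both braidings. -/
noncomputable def volCoeff (q : Param) {M : Type*} [AddCommGroup M] [Module ℂ M] (t : W 4 → M) :
    M :=
    t ![0, 1, 2, 3] - t ![0, 1, 3, 2] - t ![0, 2, 1, 3] + (qc q ^ 2) • t ![0, 2, 3, 1]
      + (qc q ^ 2) • t ![0, 3, 1, 2] - (qc q ^ 2) • t ![0, 3, 2, 1] - t ![1, 0, 2, 3]
      + t ![1, 0, 3, 2] + t ![1, 2, 0, 3] - (qc q ^ 2)⁻¹ • t ![1, 2, 3, 0]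
      - (qc q ^ 2)⁻¹ • t ![1, 3, 0, 2] + (qc q ^ 2)⁻¹ • t ![1, 3, 2, 0] + t ![2, 0, 1, 3]
      - (qc q ^ 2) • t ![2, 0, 3, 1] - t ![2, 1, 0, 3] + (qc q ^ 2)⁻¹ • t ![2, 1, 3, 0]
      + t ![2, 3, 0, 1] - t ![2, 3, 1, 0] + (lam q ^ 2) • t ![2, 3, 2, 3]
      - (qc q ^ 2 - (qc q ^ 2)⁻¹) • t ![2, 3, 3, 3] - t ![3, 0, 1, 2] + t ![3, 0, 2, 1]
      + t ![3, 1, 0, 2] - t ![3, 1, 2, 0] - t ![3, 2, 0, 1] + t ![3, 2, 1, 0]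
      - (lam q ^ 2) • t ![3, 2, 3, 2] + (qc q ^ 2 - (qc q ^ 2)⁻¹) • t ![3, 2, 3, 3]
      - (qc q ^ 2 - (qc q ^ 2)⁻¹) • t ![3, 3, 2, 3] + (qc q ^ 2 - (qc q ^ 2)⁻¹) • t ![3, 3, 3, 2]

/-- The antisymmetriser of degree four has rank one, for both braidings, and its rows are multiples
of `volCoeff`. This is the row of `ω₋ ⊗ ω₊ ⊗ ω_z ⊗ ω₀`. -/
theorem antisym_four_row (q : Param) (s : Bool) {M : Type*} [AddCommGroup M] [Module ℂ M]
    (t : W 4 → M) : antisym q s 4 M t ![0, 1, 3, 2] = -volCoeff q t := by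
  have h0 := qc_ne_zero q
  cases s <;>
  simp only [antisym_four, Module.End.mul_apply, LinearMap.sub_apply, LinearMap.add_apply,
    Module.End.one_apply, Pi.sub_apply, Pi.add_apply, braidAt_four_zero, braidAt_four_one,
    braidAt_four_two, braidMix_true, braidMix_false, volCoeff, lam] <;>
  match_scalars <;> field_simp <;> ring

/-- The row of `ω₋ ⊗ ω₊ ⊗ ω_z ⊗ ω_z` vanishes. By the shape of the metric, this row and that of
`ω₋ ⊗ ω₊ ⊗ ω_z ⊗ ω₀` are the only ones seen by the Hodge operator. -/
theorem antisym_four_row_zero (q : Param) (s : Bool) {M : Type*} [AddCommGroup M] [Module ℂ M]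
    (t : W 4 → M) : antisym q s 4 M t ![0, 1, 3, 3] = 0 := by
  have h0 := qc_ne_zero q
  cases s <;>
  simp only [antisym_four, Module.End.mul_apply, LinearMap.sub_apply, LinearMap.add_apply,
    Module.End.one_apply, Pi.sub_apply, Pi.add_apply, braidAt_four_zero, braidAt_four_one,
    braidAt_four_two, braidMix_true, braidMix_false, lam] <;>
  match_scalars <;> field_simp <;> ring

/-! ### A representation of `A(SU_q(2))` -/

/-- The operators of the representation of `A(SU_q(2))` on sequences in which `c` and `c^*` are
diagonal with eigenvalues `q^n`, `a^*` is the shift and `a` a weighted shift in the other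
direction. -/
noncomputable def seqOp (q : Param) : AGen → Module.End ℂ (ℕ → ℂ)
  | .a =>
    { toFun := fun u n => (1 - (qc q * qc q) ^ (n + 1)) * u (n + 1)
      map_add' := fun u v => funext fun n => mul_add _ _ _
      map_smul' := fun r u => funext fun n => mul_left_comm _ _ _ }
  | .as =>
    { toFun := fun u n => if n = 0 then 0 else u (n - 1)
      map_add' := fun u v => by funext n; by_cases h : n = 0 <;> simp [h]
      map_smul' := fun r u => by funext n; by_cases h : n = 0 <;> simp [h] }
  | .c =>
    { toFun := fun u n => qc q ^ n * u n
      map_add' := fun u v => funext fun n => mul_add _ _ _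
      map_smul' := fun r u => funext fun n => mul_left_comm _ _ _ }
  | .cs =>
    { toFun := fun u n => qc q ^ n * u n
      map_add' := fun u v => funext fun n => mul_add _ _ _
      map_smul' := fun r u => funext fun n => mul_left_comm _ _ _ }

theorem seqOp_a (q : Param) (u : ℕ → ℂ) (n : ℕ) :
    seqOp q .a u n = (1 - (qc q * qc q) ^ (n + 1)) * u (n + 1) := rfl
theorem seqOp_as_zero (q : Param) (u : ℕ → ℂ) : seqOp q .as u 0 = 0 := rfl
theorem seqOp_as_succ (q : Param) (u : ℕ → ℂ) (n : ℕ) : seqOp q .as u (n + 1) = u n := rfl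
theorem seqOp_c (q : Param) (u : ℕ → ℂ) (n : ℕ) : seqOp q .c u n = qc q ^ n * u n := rfl
theorem seqOp_cs (q : Param) (u : ℕ → ℂ) (n : ℕ) : seqOp q .cs u n = qc q ^ n * u n := rfl

/-- The representation of `A(SU_q(2))` on sequences. -/
noncomputable def seqRep (q : Param) : A q →ₐ[ℂ] Module.End ℂ (ℕ → ℂ) := by
  refine liftA q (seqOp q) ?_ ?_ ?_ ?_ ?_ ?_ ?_ <;>
  refine LinearMap.ext fun u => funext fun n => ?_ <;>
  rcases n with _ | n <;>
  simp only [Module.End.mul_apply, LinearMap.smul_apply, LinearMap.add_apply, Pi.smul_apply,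
    Pi.add_apply, Module.End.one_apply, seqOp_a, seqOp_as_zero, seqOp_as_succ, seqOp_c, seqOp_cs,
    smul_eq_mul] <;>
  ring

theorem seqRep_gen (q : Param) (x : AGen) : seqRep q (gen q x) = seqOp q x := by
  rw [seqRep, liftA_gen]

theorem one_sub_qc_pow_ne_zero (q : Param) (n : ℕ) : 1 - (qc q * qc q) ^ (n + 1) ≠ 0 := by
  have h : ((q : ℝ) * q) ^ (n + 1) < 1 :=
    pow_lt_one₀ (mul_self_nonneg _) (by nlinarith [q.2.1, q.2.2]) (Nat.succ_ne_zero n)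
  rw [qc]
  exact_mod_cast (sub_pos.2 h).ne'

/-- The monomials `a^m (c^*)^n` do not vanish. -/
theorem gen_a_pow_mul_cs_pow_ne_zero (q : Param) (m n : ℕ) :
    gen q .a ^ m * gen q .cs ^ n ≠ 0 := by
  intro h
  have hcs : ∀ (n : ℕ) (u : ℕ → ℂ), (∀ i, u i ≠ 0) → ∀ i, (seqOp q .cs ^ n) u i ≠ 0 := by
    intro n
    induction n with
    | zero => intro u hu i; simpa using hu i
    | succ n ih =>
      intro u hu i
      rw [pow_succ, Module.End.mul_apply]
      exact ih _ (fun i => mul_ne_zero (pow_ne_zero _ (qc_ne_zero q)) (hu i)) i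
  have ha : ∀ (n : ℕ) (u : ℕ → ℂ), (∀ i, u i ≠ 0) → ∀ i, (seqOp q .a ^ n) u i ≠ 0 := by
    intro n
    induction n with
    | zero => intro u hu i; simpa using hu i
    | succ n ih =>
      intro u hu i
      rw [pow_succ, Module.End.mul_apply]
      exact ih _ (fun i => mul_ne_zero (one_sub_qc_pow_ne_zero q i) (hu (i + 1))) i
  have h' := congrFun (LinearMap.congr_fun (congrArg (seqRep q) h) (fun _ => 1)) 0
  simp only [map_mul, map_pow, seqRep_gen, map_zero, Module.End.mul_apply,
    LinearMap.zero_apply] at h'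
  exact ha m _ (hcs n _ fun _ => one_ne_zero) 0 h'

theorem gen_a_ne_zero (q : Param) : gen q .a ≠ 0 := by
  simpa using gen_a_pow_mul_cs_pow_ne_zero q 1 0

theorem gen_as_ne_zero (q : Param) : gen q .as ≠ 0 := by
  intro h
  have h' := congrFun (LinearMap.congr_fun (congrArg (seqRep q) h) (fun _ => 1)) 1
  rw [seqRep_gen, map_zero] at h'
  exact one_ne_zero h'

/-! ### The `σ`-metrics -/

/-- The bimodule property, written out for the values `g a b`: the identity
`g(ω_c ⊗ ω_d · y) = g(ω_c, ω_d) y`. -/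
theorem IsSigmaMetric.sum_smul_act {q : Param} {g : Matrix (Fin 4) (Fin 4) ℂ}
    (hg : IsSigmaMetric q g) (c d : Fin 4) (y : A q) :
    ∑ a, ∑ b, g a b • act q (f q c a) (act q (f q d b) y) = g c d • y := by
  have h := hg.bimodule (Pi.single ![c, d] 1) y
  have e : ∀ J : W 2, rmul q (Pi.single ![c, d] 1 : T q 2) y J
      = act q (f q c (J 0)) (act q (f q d (J 1)) y) := by
    intro J
    simp [rmul, Pi.single_apply, fT]
  simp only [evalMetric, e] at h
  refine h.trans ?_
  have e2 : ∀ a b, (Pi.single ![c, d] 1 : T q 2) ![a, b] = if a = c then if b = d then 1 else 0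
      else 0 := by
    intro a b
    rw [Pi.single_apply]
    simp [funext_iff, Fin.forall_fin_two, ite_and]
  simp [e2]

/-- The `σ`-metrics form a real one parameter family. The symmetry gives two linear relations
between the values of charge zero. The remaining ones come from the bimodule property at the pairs
`ω₀, ω₀` and `ω_z, ω_z`, evaluated on `a` and `a^*`. -/
theorem IsSigmaMetric.values {q : Param} {g : Matrix (Fin 4) (Fin 4) ℂ}
    (hg : IsSigmaMetric q g) : ∃ α : ℝ, α ≠ 0 ∧ contraction g =
      !![(α : ℂ), 0, 0, 0; 0, qc q ^ 2 * α, 0, 0; 0, 0, 0, (1 - qc q ^ 2) * α;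
        0, 0, (1 - qc q ^ 2) * α, (1 + qc q ^ 2) * α] := by
  have h0 := qc_ne_zero q
  have hh := qh_ne_zero q
  have h4 := qh_pow_four_sub_one_ne_zero q
  have hz : ∀ a b, charge a + charge b ≠ 0 → g a b = 0 := hg.coinvariant
  have z00 : g 0 0 = 0 := hz 0 0 (by decide)
  have z02 : g 0 2 = 0 := hz 0 2 (by decide)
  have z03 : g 0 3 = 0 := hz 0 3 (by decide)
  have z11 : g 1 1 = 0 := hz 1 1 (by decide)
  have z12 : g 1 2 = 0 := hz 1 2 (by decide)
  have z13 : g 1 3 = 0 := hz 1 3 (by decide)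
  have z20 : g 2 0 = 0 := hz 2 0 (by decide)
  have z21 : g 2 1 = 0 := hz 2 1 (by decide)
  have z30 : g 3 0 = 0 := hz 3 0 (by decide)
  have z31 : g 3 1 = 0 := hz 3 1 (by decide)
  -- symmetry under the braiding
  have sym : ∀ c d, ∑ a, ∑ b, (g a b * braid q true c d a b) • gen q .a = g c d • gen q .a := by
    intro c d
    have h := hg.symmetric true (Pi.single ![c, d] (gen q .a))
    have e2 : ∀ a b, (Pi.single ![c, d] (gen q .a) : T q 2) ![a, b]
        = if a = c then if b = d then gen q .a else 0 else 0 := by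
      intro a b
      rw [Pi.single_apply]
      simp [funext_iff, Fin.forall_fin_two, ite_and]
    have e3 : ∀ a b, braidAt q true 2 0 (A q) (Pi.single ![c, d] (gen q .a)) ![a, b]
        = braid q true c d a b • gen q .a := by
      intro a b
      refine (braidAt_zero q true (k := 0) _ _).trans ?_
      change braidMix q true (fun a b => (Pi.single ![c, d] (gen q .a) : T q 2) ![a, b]) a b = _
      simp [braidMix, e2]
    simpa [evalMetric, e2, e3, smul_smul] using h
  have inj := smul_left_injective ℂ (gen_a_ne_zero q)
  have inj' := smul_left_injective ℂ (gen_as_ne_zero q)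
  have s01 : g 1 0 - g 3 2 = g 0 1 := by
    apply inj
    refine Eq.trans ?_ (sym 0 1)
    simp [Fin.sum_univ_four, braid, e]
    module
  have s32 : g 2 3 = g 3 2 := by
    have h := sym 3 2
    have h' : (-(lam q ^ 2) * g 3 2 + g 2 3 - lam q ^ 2 * g 0 1 + lam q ^ 2 * g 1 0) = g 3 2 := by
      apply inj
      refine Eq.trans ?_ h
      simp [Fin.sum_univ_four, braid, e]
      module
    rw [← s01] at h'
    linear_combination h'
  -- the bimodule property: `a` and `a^*` are non zero, so coefficients may be compared
  have b22 : g 2 2 = 0 := by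
    have h := hg.sum_smul_act 2 2 (gen q .a)
    have h' : g 2 2 * (qc q ^ 2)⁻¹ = g 2 2 := by
      apply inj
      refine Eq.trans ?_ h
      simp only [Fin.sum_univ_four, f_20, f_21, f_22, f_23, map_zero, LinearMap.zero_apply,
        smul_zero, zero_add, add_zero, map_mul, act_K, Module.End.mul_apply,
        AlgHom.toLinearMap_apply, kL_gen, map_smul, qc_eq_qh]
      match_scalars
      field_simp
    have hq : 1 - qc q * qc q ≠ 0 := by simpa using one_sub_qc_pow_ne_zero q 0
    field_simp at h'
    have h'' : g 2 2 * (1 - qc q * qc q) = 0 := by linear_combination h'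
    exact (mul_eq_zero.1 h'').resolve_right hq
  have b33 : lam q ^ 2 * g 0 1 + qc q ^ 2 * (g 2 3 + g 3 2 + g 3 3) = g 3 3 := by
    have h := hg.sum_smul_act 3 3 (gen q .a)
    apply inj
    refine Eq.trans ?_ h
    simp only [Fin.sum_univ_four, f_30, f_31, f_32, f_33, L_0, L_1, z02, z03, z11, z12, z13,
      z21, z31, b22, zero_smul, zero_add, add_zero, map_zero, smul_zero, map_mul, map_add,
      map_sub, map_neg, act_K, act_Ki, act_E, act_F, Module.End.mul_apply, LinearMap.smul_apply,
      LinearMap.add_apply, LinearMap.sub_apply, AlgHom.toLinearMap_apply, kL_gen, kiL_gen, eL_gen,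
      fL_gen, map_smul, qc_eq_qh, lam_eq_qh]
    match_scalars
    field_simp
    ring
  have b33' : lam q ^ 2 * g 1 0 + (qc q ^ 2)⁻¹ * (g 3 3 - g 2 3 - g 3 2) = g 3 3 := by
    have h := hg.sum_smul_act 3 3 (gen q .as)
    apply inj'
    refine Eq.trans ?_ h
    simp only [Fin.sum_univ_four, f_30, f_31, f_32, f_33, L_0, L_1, z00, z02, z03, z12, z13,
      z20, z30, b22, zero_smul, zero_add, add_zero, map_zero, smul_zero, map_mul, map_add,
      map_sub, act_K, act_Ki, act_E, act_F, Module.End.mul_apply, LinearMap.smul_apply,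
      LinearMap.add_apply, LinearMap.sub_apply, AlgHom.toLinearMap_apply, kL_gen, kiL_gen, eL_gen,
      fL_gen, map_smul, qc_eq_qh, lam_eq_qh]
    match_scalars
    field_simp
    ring
  have hq : 1 - qc q * qc q ≠ 0 := by simpa using one_sub_qc_pow_ne_zero q 0
  have hl2 : lam q ^ 2 * qc q ^ 2 = (1 - qc q * qc q) ^ 2 := by
    rw [lam]
    field_simp
    ring
  have hq2 : qc q ^ 2 * (qc q ^ 2)⁻¹ = 1 := mul_inv_cancel₀ (pow_ne_zero 2 h0)
  have b10 : lam q ^ 2 * qc q ^ 2 * g 1 0 + (g 3 3 - g 2 3 - g 3 2) = qc q ^ 2 * g 3 3 := by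
    linear_combination qc q ^ 2 * b33' - (g 3 3 - g 2 3 - g 3 2) * hq2
  have hq1 : 1 + qc q ^ 2 ≠ 0 := by
    have h : 1 + (q : ℝ) ^ 2 ≠ 0 := by positivity
    rw [qc]
    exact_mod_cast h
  have v01 : g 0 1 = qc q ^ 2 * g 1 0 := by
    have h : (1 - qc q * qc q) * (1 + qc q ^ 2) * (g 0 1 - qc q ^ 2 * g 1 0) = 0 := by
      linear_combination qc q ^ 2 * b33 + qc q ^ 2 * b10
        - (g 0 1 + qc q ^ 2 * g 1 0) * hl2 - (qc q ^ 4 - qc q ^ 2) * s32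
        + 2 * (qc q ^ 4 - qc q ^ 2) * s01
    exact sub_eq_zero.1 ((mul_eq_zero.1 h).resolve_left (mul_ne_zero hq hq1))
  have v33 : g 3 3 = (1 + qc q ^ 2) * g 1 0 := by
    refine mul_left_cancel₀ hq ?_
    linear_combination b10 - g 1 0 * hl2 + s32 - 2 * s01 - 2 * v01
  have hreal : star (g 1 0) = g 1 0 := hg.real 1 0
  have hα : ((-(g 1 0).re : ℝ) : ℂ) = -g 1 0 := by
    push_cast
    rw [neg_inj]
    exact Complex.conj_eq_iff_re.1 hreal
  have v32 : g 3 2 = (1 - qc q ^ 2) * g 1 0 := by linear_combination -s01 - v01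
  have v23 : g 2 3 = (1 - qc q ^ 2) * g 1 0 := by rw [s32, v32]
  refine ⟨-(g 1 0).re, ?_, ?_⟩
  · intro h
    rw [h] at hα
    have h10 : g 1 0 = 0 := by simpa using hα.symm
    apply hg.nondegenerate
    have : g = 0 := by
      ext i j
      fin_cases i <;> fin_cases j <;>
        simp [z00, z02, z03, z11, z12, z13, z20, z21, z30, z31, b22, v01, v33, v32, v23, h10]
    rw [this, Matrix.det_zero]
  · rw [hα]
    ext i j
    fin_cases i <;> fin_cases j <;>
      simp [contraction, bar, z00, z02, z03, z11, z12, z13, z20, z21, z30, z31, b22, v01, v33, v32,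
        v23]

/-! ### The Hodge operator on four-forms -/

/-- The contraction of the `σ`-metric with parameter `α`. -/
noncomputable def stdContraction (q : Param) (α : ℝ) : Matrix (Fin 4) (Fin 4) ℂ :=
  !![(α : ℂ), 0, 0, 0; 0, qc q ^ 2 * α, 0, 0; 0, 0, 0, (1 - qc q ^ 2) * α;
    0, 0, (1 - qc q ^ 2) * α, (1 + qc q ^ 2) * α]

/-- The absolute value of the quantum determinant of `stdContraction q α`. -/
noncomputable def detAbs (q : Param) (α : ℝ) : ℝ :=
  (q : ℝ) ^ 2 * (1 - (q : ℝ) ^ 2) ^ 2 * α ^ 4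

theorem detAbs_pos (q : Param) {α : ℝ} (hα : α ≠ 0) : 0 < detAbs q α := by
  have h : 1 - (q : ℝ) ^ 2 ≠ 0 := by nlinarith [q.2.1, q.2.2]
  have h0 : (q : ℝ) ≠ 0 := q.2.1.ne'
  have : 0 < α ^ 4 := by positivity
  rw [detAbs]
  positivity

theorem star_qc (q : Param) : star (qc q) = qc q := Complex.conj_ofReal _

theorem star_stdContraction (q : Param) (α : ℝ) (a b : Fin 4) :
    star (stdContraction q α a b) = stdContraction q α b a := by
  have h : star ((α : ℝ) : ℂ) = α := Complex.conj_ofReal α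
  fin_cases a <;> fin_cases b <;>
    simp only [stdContraction, Fin.zero_eta, Fin.mk_one, Fin.reduceFinMk, Matrix.of_apply,
      Matrix.cons_val_zero, Matrix.cons_val_one, Matrix.cons_val, star_zero, star_mul', star_sub,
      star_add, star_one, star_pow, star_qc, h]

/-- The Hodge operator on four-forms is linear: the contraction is antilinear in its first argument,
and its value is conjugated. -/
theorem hodgeTop_eq_sum (Γ : Matrix (Fin 4) (Fin 4) ℂ) (m : ℝ) (ξ : W 4 → ℂ) :
    hodgeTop Γ m ξ = ∑ J, hodgeTop Γ m (basisTensor J) * ξ J := by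
  have h : ∀ J, hodgeTop Γ m (basisTensor J)
      = star (∑ K, (∏ i, Γ (J i) (K i)) * vartheta m K) := by
    intro J
    simp [hodgeTop, contractFull, basisTensor, apply_ite]
  simp only [h]
  simp only [hodgeTop, contractFull, star_sum, star_mul', star_star, Finset.sum_mul]
  exact Finset.sum_congr rfl fun J _ => Finset.sum_congr rfl fun K _ => by ring

theorem hodgeTop_basisTensor (Γ : Matrix (Fin 4) (Fin 4) ℂ) (m : ℝ) (J : W 4) :
    hodgeTop Γ m (basisTensor J) = -(Complex.I * m)
      * star (Γ (J 0) 0 * Γ (J 1) 1 * Γ (J 2) 2 * Γ (J 3) 3) := by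
  simp [hodgeTop, contractFull, basisTensor, vartheta, apply_ite, Fin.prod_univ_four]
  ring

/-- The Hodge dual of an antisymmetrised four-tensor. -/
theorem sum_hodgeTop_smul_antisym (q : Param) (s : Bool) (α m : ℝ) {M : Type*} [AddCommGroup M]
    [Module ℂ M] (t : W 4 → M) :
    ∑ J, hodgeTop (stdContraction q α) m (basisTensor J) • antisym q s 4 M t J
      = (Complex.I * m * detAbs q α) • volCoeff q t := by
  have c0 : ∀ a, a ≠ 0 → stdContraction q α a 0 = 0 := by
    intro a ha; fin_cases a <;> first | exact absurd rfl ha | rfl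
  have c1 : ∀ a, a ≠ 1 → stdContraction q α a 1 = 0 := by
    intro a ha; fin_cases a <;> first | exact absurd rfl ha | rfl
  have c2 : ∀ a, a ≠ 3 → stdContraction q α a 2 = 0 := by
    intro a ha; fin_cases a <;> first | exact absurd rfl ha | rfl
  have c3 : ∀ a, a ≠ 2 → a ≠ 3 → stdContraction q α a 3 = 0 := by
    intro a ha hb; fin_cases a <;> first | exact absurd rfl ha | exact absurd rfl hb | rfl
  -- `Γ` couples `ω₀` to `ω_z` only, so the contraction with `ϑ` sees the indices `0, 1, 3, 2` and
  -- `0, 1, 3, 3`, and the antisymmetriser vanishes at the latter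
  rw [Finset.sum_eq_single ![0, 1, 3, 2]]
  · rw [antisym_four_row, hodgeTop_basisTensor, smul_neg, ← neg_smul]
    congr 1
    simp only [Matrix.cons_val_zero, Matrix.cons_val_one, Matrix.cons_val, star_mul',
      star_stdContraction]
    simp only [stdContraction, detAbs, qc, Matrix.of_apply, Matrix.cons_val_zero,
      Matrix.cons_val_one, Matrix.cons_val]
    push_cast
    ring
  · intro J _ hJ
    rw [hodgeTop_basisTensor]
    by_cases h0 : J 0 = 0
    swap
    · simp [c0 _ h0]
    by_cases h1 : J 1 = 1
    swap
    · simp [c1 _ h1]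
    by_cases h2 : J 2 = 3
    swap
    · simp [c2 _ h2]
    by_cases h3 : J 3 = 3
    · have hJ' : J = ![0, 1, 3, 3] := by rw [vec_four_eta J, h0, h1, h2, h3]
      rw [hJ', antisym_four_row_zero, smul_zero]
    · by_cases h4 : J 3 = 2
      · exact absurd (by rw [vec_four_eta J, h0, h1, h2, h4]) hJ
      · simp [c3 _ h4 h3]
  · intro h
    exact absurd (Finset.mem_univ _) h

theorem volCoeff_vartheta (q : Param) (m : ℝ) : volCoeff q (vartheta m) = Complex.I * m := by
  simp [volCoeff, vartheta, basisTensor]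

theorem hodgeTop_vol (q : Param) (s : Bool) (α m : ℝ) :
    hodgeTop (stdContraction q α) m (vol q s m) = -(m ^ 2 * detAbs q α : ℝ) := by
  rw [hodgeTop_eq_sum]
  have h := sum_hodgeTop_smul_antisym q s α m (vartheta m)
  simp only [smul_eq_mul, volCoeff_vartheta] at h
  rw [vol, h]
  push_cast
  linear_combination (m ^ 2 * detAbs q α : ℂ) * Complex.I_sq

/-- As the contraction is hermitian, the quantum determinant is the Hodge dual of the volume form
at `m = 1`. -/
theorem detq_stdContraction (q : Param) (s : Bool) (α : ℝ) :
    detq q s (stdContraction q α) = -(detAbs q α : ℝ) := by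
  have h := hodgeTop_vol q s α 1
  rw [one_pow, one_mul] at h
  rw [← h, detq, hodgeTop, contractFull, contractFull, star_sum, Finset.sum_comm]
  refine Finset.sum_congr rfl fun J _ => ?_
  rw [star_sum]
  refine Finset.sum_congr rfl fun I _ => ?_
  simp only [star_mul', star_star, star_prod, star_stdContraction]
  ring

/-- The quantum determinant is negative, so that the normalisation says `m² |det_q Γ| = 1`. -/
theorem IsNormalised.sq_mul_detAbs {q : Param} {s : Bool} {α m : ℝ} (hα : α ≠ 0)
    (h : IsNormalised q s (stdContraction q α) m) : m ^ 2 * detAbs q α = 1 := by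
  have h2 := h.2
  have hp := detAbs_pos q hα
  rw [hodgeTop_vol, detq_stdContraction, norm_neg, Complex.norm_real, Real.norm_of_nonneg hp.le,
    neg_div, div_self (by exact_mod_cast hp.ne'), neg_inj] at h2
  exact_mod_cast h2

/-! ### The Hodge operator on one-forms -/

/-- The braiding of `ω_w ⊗ ω_x` with `ω_c ⊗ ω_d` replaced by `G c d`. It expresses the braidings of
basis tensors through basis tensors. -/
noncomputable def braidCol (q : Param) (s : Bool) {M : Type*} [AddCommGroup M] [Module ℂ M]
    (w x : Fin 4) (G : Fin 4 → Fin 4 → M) : M :=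
  ∑ c, ∑ d, braid q s w x c d • G c d

theorem braidMix_ite (q : Param) (s : Bool) (w x y z : Fin 4) :
    braidMix q s (fun a b => if a = w ∧ b = x then (1 : ℂ) else 0) y z = braid q s w x y z := by
  simp [braidMix, ite_and]

theorem braidMix_zero (q : Param) (s : Bool) (y z : Fin 4) :
    braidMix q s (fun _ _ => (0 : ℂ)) y z = 0 := by
  simp [braidMix]

theorem braidAt_four_zero_basisTensor (q : Param) (s : Bool) (w x y z : Fin 4) :
    braidAt q s 4 0 ℂ (basisTensor ![w, x, y, z])
      = braidCol q s w x fun c d => basisTensor ![c, d, y, z] := by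
  funext J
  rw [vec_four_eta J, braidAt_four_zero]
  have h := braidMix_ite q s w x (J 0) (J 1)
  by_cases h1 : J 2 = y <;> by_cases h2 : J 3 = z <;>
    simp [braidCol, basisTensor, Finset.sum_apply, Matrix.vecCons_inj, h1, h2, ite_and,
      braidMix_zero] at h ⊢
  exact h

theorem braidAt_four_one_basisTensor (q : Param) (s : Bool) (w x y z : Fin 4) :
    braidAt q s 4 1 ℂ (basisTensor ![w, x, y, z])
      = braidCol q s x y fun c d => basisTensor ![w, c, d, z] := by
  funext J
  rw [vec_four_eta J, braidAt_four_one]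
  have h := braidMix_ite q s x y (J 1) (J 2)
  by_cases h1 : J 0 = w <;> by_cases h2 : J 3 = z <;>
    simp [braidCol, basisTensor, Finset.sum_apply, Matrix.vecCons_inj, h1, h2, ite_and,
      braidMix_zero] at h ⊢
  exact h

theorem braidAt_four_two_basisTensor (q : Param) (s : Bool) (w x y z : Fin 4) :
    braidAt q s 4 2 ℂ (basisTensor ![w, x, y, z])
      = braidCol q s y z fun c d => basisTensor ![w, x, c, d] := by
  funext J
  rw [vec_four_eta J, braidAt_four_two]
  have h := braidMix_ite q s y z (J 2) (J 3)
  by_cases h1 : J 0 = w <;> by_cases h2 : J 1 = x <;>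
    simp [braidCol, basisTensor, Finset.sum_apply, Matrix.vecCons_inj, h1, h2, ite_and,
      braidMix_zero] at h ⊢
  exact h

theorem braidCol_true (q : Param) {M : Type*} [AddCommGroup M] [Module ℂ M]
    (G : Fin 4 → Fin 4 → M) :
    braidCol q true 0 1 G = -G 3 2 + G 1 0 ∧
    braidCol q true 0 2 G = (1 - qc q ^ 2) • G 0 2 + G 2 0 ∧
    braidCol q true 0 3 G = (1 + qc q ^ 2) • G 0 2 + G 3 0 ∧
    braidCol q true 1 2 G = (1 - (qc q ^ 2)⁻¹) • G 1 2 + G 2 1 ∧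
    braidCol q true 1 3 G = (-1 - (qc q ^ 2)⁻¹) • G 1 2 + G 3 1 ∧
    braidCol q true 2 3 G = G 3 2 :=
  have h := sum_braid_true_smul q G
  ⟨h.2.1, h.2.2.1, h.2.2.2.1, h.2.2.2.2.2.2.1, h.2.2.2.2.2.2.2.1, h.2.2.2.2.2.2.2.2.2.2.2.1⟩

theorem braidCol_false (q : Param) {M : Type*} [AddCommGroup M] [Module ℂ M]
    (G : Fin 4 → Fin 4 → M) :
    braidCol q false 0 0 G = G 0 0 ∧
    braidCol q false 0 1 G = -G 2 3 + G 1 0 ∧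
    braidCol q false 0 2 G = ((qc q ^ 2)⁻¹) • G 2 0 ∧
    braidCol q false 0 3 G = (1 + qc q ^ 2) • G 2 0 + (1 - qc q ^ 2) • G 0 3
      + (qc q ^ 2) • G 3 0 ∧
    braidCol q false 1 0 G = G 2 3 + G 0 1 ∧
    braidCol q false 1 1 G = G 1 1 ∧
    braidCol q false 1 2 G = (qc q ^ 2) • G 2 1 ∧
    braidCol q false 1 3 G = (-1 - (qc q ^ 2)⁻¹) • G 2 1 + (1 - (qc q ^ 2)⁻¹) • G 1 3
      + ((qc q ^ 2)⁻¹) • G 3 1 ∧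
    braidCol q false 2 3 G = G 3 2 - (lam q ^ 2) • G 2 3 - (lam q ^ 2) • G 0 1
      + (lam q ^ 2) • G 1 0 := by
  refine ⟨?_, ?_, ?_, ?_, ?_, ?_, ?_, ?_, ?_⟩
  all_goals
    simp [braidCol, Fin.sum_univ_four, braid, e]
    try module

theorem shuffleOne_four (q : Param) (s : Bool) {M : Type*} [AddCommGroup M] [Module ℂ M] :
    shuffleOne q s 4 M = 1 - braidAt q s 4 0 M + braidAt q s 4 0 M * braidAt q s 4 1 M
      - braidAt q s 4 0 M * braidAt q s 4 1 M * braidAt q s 4 2 M := by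
  simp only [shuffleOne, Finset.sum_range_succ, Finset.sum_range_zero, braidUp]
  norm_num
  module

/-- The tensor `B_{1,3}(ω₋ ⊗ ω₊ ⊗ ω₀ ⊗ ω_z)` for `σ`. -/
theorem shuffleOne_true_basisTensor (q : Param) :
    shuffleOne q true 4 ℂ (basisTensor ![0, 1, 2, 3])
      = basisTensor ![0, 1, 2, 3] + (qc q ^ 2)⁻¹ • basisTensor ![3, 2, 2, 3]
        - (qc q ^ 2)⁻¹ • basisTensor ![1, 0, 2, 3] + (1 - qc q ^ 2) • basisTensor ![0, 2, 1, 3]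
        + basisTensor ![2, 0, 1, 3] - (1 + (qc q ^ 2)⁻¹) • basisTensor ![3, 2, 2, 2]
        + (1 + (qc q ^ 2)⁻¹) • basisTensor ![1, 0, 2, 2]
        - (1 + qc q ^ 2) • basisTensor ![0, 2, 1, 2] - basisTensor ![3, 0, 1, 2] := by
  have h0 := qc_ne_zero q
  simp only [shuffleOne_four, LinearMap.sub_apply, LinearMap.add_apply, Module.End.one_apply,
    Module.End.mul_apply, braidAt_four_zero_basisTensor, braidAt_four_one_basisTensor,
    braidAt_four_two_basisTensor, braidCol_true, map_add, map_smul]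
  match_scalars <;> field_simp <;> ring

/-- The tensor `B_{1,3}(ω₋ ⊗ ω₊ ⊗ ω₀ ⊗ ω_z)` for `σ⁻¹`. -/
theorem shuffleOne_false_basisTensor (q : Param) :
    shuffleOne q false 4 ℂ (basisTensor ![0, 1, 2, 3])
      = basisTensor ![0, 1, 2, 3] + basisTensor ![2, 3, 2, 3] - basisTensor ![1, 0, 2, 3]
        + ((qc q ^ 2)⁻¹ - 1 + qc q ^ 2) • basisTensor ![2, 0, 1, 3]
        + ((qc q ^ 4)⁻¹ - 1) • basisTensor ![2, 0, 1, 2]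
        + (1 - (qc q ^ 2)⁻¹) • basisTensor ![2, 3, 3, 2]
        + ((qc q ^ 2)⁻¹ - 1) • basisTensor ![1, 0, 3, 2]
        + (1 - (qc q ^ 2)⁻¹) • basisTensor ![0, 3, 1, 2] - basisTensor ![3, 0, 1, 2]
        + lam q ^ 2 • basisTensor ![0, 0, 1, 1] + lam q ^ 2 • basisTensor ![2, 3, 1, 0]
        - lam q ^ 2 • basisTensor ![1, 0, 1, 0]
        + ((qc q ^ 4)⁻¹ - 2 * (qc q ^ 2)⁻¹ + 1) • basisTensor ![2, 0, 3, 1] := by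
  have h0 := qc_ne_zero q
  simp only [shuffleOne_four, LinearMap.sub_apply, LinearMap.add_apply, Module.End.one_apply,
    Module.End.mul_apply, braidAt_four_zero_basisTensor, braidAt_four_one_basisTensor,
    braidAt_four_two_basisTensor, braidCol_false, map_add, map_sub, map_smul, lam]
  match_scalars <;> field_simp <;> ring

theorem contractOne_add (Γ : Matrix (Fin 4) (Fin 4) ℂ) {k : ℕ} (a : Fin 4)
    (t u : W (k + 1) → ℂ) : contractOne Γ a (t + u) = contractOne Γ a t + contractOne Γ a u := by
  funext J
  simp only [contractOne, Pi.add_apply, mul_add, Finset.sum_add_distrib]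

theorem contractOne_smul (Γ : Matrix (Fin 4) (Fin 4) ℂ) {k : ℕ} (a : Fin 4) (r : ℂ)
    (t : W (k + 1) → ℂ) : contractOne Γ a (r • t) = r • contractOne Γ a t := by
  funext J
  simp only [contractOne, Pi.smul_apply, smul_eq_mul, Finset.mul_sum]
  exact Finset.sum_congr rfl fun b _ => by ring

theorem contractOne_neg (Γ : Matrix (Fin 4) (Fin 4) ℂ) {k : ℕ} (a : Fin 4)
    (t : W (k + 1) → ℂ) : contractOne Γ a (-t) = -contractOne Γ a t := by
  rw [← neg_one_smul ℂ t, contractOne_smul, neg_one_smul]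

theorem contractOne_basisTensor (Γ : Matrix (Fin 4) (Fin 4) ℂ) {k : ℕ} (a b : Fin 4) (I : W k) :
    contractOne Γ a (basisTensor (Matrix.vecCons b I)) = Γ a b • basisTensor I := by
  funext J
  have h : ∀ c, (Fin.cons c J : W (k + 1)) = Matrix.vecCons b I ↔ c = b ∧ J = I := by
    intro c
    exact Fin.cons_inj
  simp only [contractOne, basisTensor, Pi.smul_apply, smul_eq_mul, h]
  by_cases hJ : J = I <;> simp [hJ]

theorem starTensor_add {k : ℕ} (t u : W k → ℂ) :
    starTensor (t + u) = starTensor t + starTensor u := by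
  funext J
  simp only [starTensor, Pi.add_apply, star_add, mul_add]

theorem starTensor_smul {k : ℕ} (r : ℂ) (t : W k → ℂ) :
    starTensor (r • t) = star r • starTensor t := by
  funext J
  simp only [starTensor, Pi.smul_apply, smul_eq_mul, star_mul']
  ring

theorem starTensor_neg {k : ℕ} (t : W k → ℂ) : starTensor (-t) = -starTensor t := by
  rw [← neg_one_smul ℂ t, starTensor_smul, star_neg, star_one, neg_one_smul]

theorem bar_bar (a : Fin 4) : bar (bar a) = a := by fin_cases a <;> rfl

theorem starTensor_basisTensor (x y z : Fin 4) :
    starTensor (basisTensor ![x, y, z]) = basisTensor ![bar z, bar y, bar x] := by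
  funext J
  have h : (fun i => bar (J (Fin.rev i))) = ![x, y, z] ↔ J = ![bar z, bar y, bar x] := by
    constructor
    · intro h
      rw [vec_three_eta J]
      have h0 : bar (J 2) = x := congrFun h 0
      have h1 : bar (J 1) = y := congrFun h 1
      have h2 : bar (J 0) = z := congrFun h 2
      rw [← h0, ← h1, ← h2, bar_bar, bar_bar, bar_bar]
    · rintro rfl
      funext i
      fin_cases i <;> simp [bar_bar]
  by_cases hJ : J = ![bar z, bar y, bar x]
  · simp only [starTensor, basisTensor, h.2 hJ, if_pos hJ]
    norm_num
  · simp [starTensor, basisTensor, hJ, mt h.1 hJ]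

/-- The left invariant three-tensors which represent, up to one common factor, the Hodge duals
of `ω₋, ω₊, ω₀, ω_z`. -/
noncomputable def hodgeShape (q : Param) : Bool → Fin 4 → (W 3 → ℂ)
  | true, 0 => basisTensor ![3, 2, 0] + (1 - qc q ^ 2) • basisTensor ![3, 0, 2]
      - (1 + qc q ^ 2) • basisTensor ![2, 0, 2]
  | true, 1 => (1 + qc q ^ 2) • basisTensor ![2, 2, 1] - basisTensor ![3, 2, 1]
  | true, 2 => ((qc q ^ 2)⁻¹ - 1) • basisTensor ![3, 2, 2]
      + (qc q ^ 2 - (qc q ^ 2)⁻¹) • basisTensor ![2, 2, 2]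
      + (qc q ^ 2 - 1) • basisTensor ![2, 0, 1]
  | true, 3 => (1 - qc q ^ 2) • basisTensor ![3, 0, 1]
      + (1 + (qc q ^ 2)⁻¹) • basisTensor ![3, 2, 2]
      - ((qc q ^ 2)⁻¹ + 2 + qc q ^ 2) • basisTensor ![2, 2, 2]
      - (1 + qc q ^ 2) • basisTensor ![2, 0, 1]
  | false, 0 => basisTensor ![3, 2, 0] + (1 - (qc q ^ 2)⁻¹) • basisTensor ![2, 0, 3]
      + lam q ^ 2 • basisTensor ![0, 0, 1]
  | false, 1 => (1 - qc q ^ 2) • basisTensor ![2, 3, 1] - qc q ^ 2 • basisTensor ![3, 2, 1]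
      - (1 - qc q ^ 2) ^ 2 • basisTensor ![1, 0, 1]
  | false, 2 => (qc q ^ 2 - 1) • basisTensor ![2, 0, 1]
  | false, 3 => (1 - qc q ^ 2) • basisTensor ![3, 2, 3]
      + ((qc q ^ 2)⁻¹ - 2 + 2 * qc q ^ 2 - qc q ^ 4) • basisTensor ![3, 0, 1]
      + ((qc q ^ 4)⁻¹ - (qc q ^ 2)⁻¹ - 2) • basisTensor ![2, 0, 1]
      - lam q ^ 2 • basisTensor ![2, 3, 3]
      + ((qc q ^ 4)⁻¹ - 3 * (qc q ^ 2)⁻¹ + 3 - qc q ^ 2) • basisTensor ![0, 3, 1]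
      + ((qc q ^ 2)⁻¹ - 3 + 3 * qc q ^ 2 - qc q ^ 4) • basisTensor ![1, 0, 3]

/-- The common factor is `-i m α`: conjugation turns `i m` into `-i m`, and every value of the
contraction is a multiple of `α`. -/
theorem hodgeOne_stdContraction (q : Param) (s : Bool) (α m : ℝ) (a : Fin 4) :
    hodgeOne q s (stdContraction q α) m a = (-(Complex.I * m) * α) • hodgeShape q s a := by
  have h0 := qc_ne_zero q
  have hi : star (Complex.I * (m : ℂ)) = -(Complex.I * m) := by simp
  have hα : star ((α : ℝ) : ℂ) = α := Complex.conj_ofReal α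
  rw [hodgeOne, vartheta, map_smul, contractOne_smul, starTensor_smul, hi]
  cases s <;> fin_cases a <;>
  simp only [Fin.zero_eta, Fin.mk_one, Fin.reduceFinMk, shuffleOne_true_basisTensor,
    shuffleOne_false_basisTensor, sub_eq_add_neg, contractOne_add, contractOne_neg,
    contractOne_smul, contractOne_basisTensor, stdContraction, Matrix.of_apply,
    Matrix.cons_val_zero, Matrix.cons_val_one, Matrix.cons_val, starTensor_add, starTensor_neg,
    starTensor_smul, starTensor_basisTensor, star_add, star_neg, star_one, star_mul',
    star_pow, star_inv₀, star_qc, star_ofNat, hα, bar, hodgeShape, lam, zero_smul, smul_zero,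
    neg_zero, add_zero, zero_add] <;>
  match_scalars <;> field_simp <;> ring

/-- The functional `volCoeff` is additive over finite sums, as a matrix row of a linear map. -/
theorem volCoeff_sum (q : Param) {M ι : Type*} [AddCommGroup M] [Module ℂ M] (S : Finset ι)
    (t : ι → W 4 → M) : volCoeff q (∑ i ∈ S, t i) = ∑ i ∈ S, volCoeff q (t i) := by
  have h : ∀ t : W 4 → M, volCoeff q t = -antisym q true 4 M t ![0, 1, 3, 2] := fun t => by
    rw [antisym_four_row, neg_neg]
  simp only [h, map_sum, Finset.sum_apply, Finset.sum_neg_distrib]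

theorem volCoeff_add (q : Param) {M : Type*} [AddCommGroup M] [Module ℂ M] (t u : W 4 → M) :
    volCoeff q (t + u) = volCoeff q t + volCoeff q u := by
  simp only [volCoeff, Pi.add_apply]
  module

theorem volCoeff_map (q : Param) {M N : Type*} [AddCommGroup M] [Module ℂ M] [AddCommGroup N]
    [Module ℂ N] (φ : M →ₗ[ℂ] N) (t : W 4 → M) :
    volCoeff q (fun J => φ (t J)) = φ (volCoeff q t) := by
  simp only [volCoeff, map_add, map_sub, map_smul]

/-! ### The pairing of one-forms with Hodge duals -/

/-- The tensor `ω_b ⊗ u`. -/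
def consTensor {k : ℕ} (b : Fin 4) (u : W k → ℂ) : W (k + 1) → ℂ :=
  fun J => if J 0 = b then u (Fin.tail J) else 0

/-- The tensor `u ⊗ ω_c`. -/
def snocTensor {k : ℕ} (c : Fin 4) (u : W k → ℂ) : W (k + 1) → ℂ :=
  fun J => if J (Fin.last k) = c then u (Fin.init J) else 0

/-- The coefficients `κ_{ba} = ε(ω_b ∧ ⋆ω_a)`, up to the factor that is left out of `hodgeShape`.
They are the coefficients of the Laplacian in the products `L_b L_a`. -/
noncomputable def hodgePair (q : Param) : Fin 4 → Fin 4 → ℂ :=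
  ![![0, qc q ^ 2, 0, 0], ![1, 0, 0, 0], ![0, 0, 0, 1 - qc q ^ 2],
    ![0, 0, 1 - qc q ^ 2, 1 + qc q ^ 2]]

theorem consTensor_add {k : ℕ} (b : Fin 4) (u v : W k → ℂ) :
    consTensor b (u + v) = consTensor b u + consTensor b v := by
  funext J; by_cases h : J 0 = b <;> simp [consTensor, h]

theorem consTensor_smul {k : ℕ} (b : Fin 4) (r : ℂ) (u : W k → ℂ) :
    consTensor b (r • u) = r • consTensor b u := by
  funext J; by_cases h : J 0 = b <;> simp [consTensor, h]

theorem snocTensor_add {k : ℕ} (b : Fin 4) (u v : W k → ℂ) :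
    snocTensor b (u + v) = snocTensor b u + snocTensor b v := by
  funext J; by_cases h : J (Fin.last k) = b <;> simp [snocTensor, h]

theorem snocTensor_smul {k : ℕ} (b : Fin 4) (r : ℂ) (u : W k → ℂ) :
    snocTensor b (r • u) = r • snocTensor b u := by
  funext J; by_cases h : J (Fin.last k) = b <;> simp [snocTensor, h]

theorem consTensor_basisTensor (b x y z : Fin 4) :
    consTensor b (basisTensor ![x, y, z]) = basisTensor ![b, x, y, z] := by
  funext J
  have h : J = ![b, x, y, z] ↔ J 0 = b ∧ Fin.tail J = ![x, y, z] := by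
    conv_lhs => rw [← Fin.cons_self_tail J]
    exact Fin.cons_inj
  by_cases h1 : J 0 = b <;> simp [consTensor, basisTensor, h, h1]

theorem snocTensor_basisTensor (c x y z : Fin 4) :
    snocTensor c (basisTensor ![x, y, z]) = basisTensor ![x, y, z, c] := by
  funext J
  have h : J = ![x, y, z, c] ↔ J (Fin.last 3) = c ∧ Fin.init J = ![x, y, z] := by
    have h2 : Fin.init J = ![J 0, J 1, J 2] := vec_three_eta (Fin.init J)
    have h3 : J (Fin.last 3) = J 3 := rfl
    rw [h2, h3]
    conv_lhs => rw [vec_four_eta J]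
    simp [Matrix.vecCons_inj]
    tauto
  simp only [snocTensor, basisTensor, h]
  by_cases h1 : J (Fin.last 3) = c <;> simp only [h1, if_true, if_false, true_and, false_and]

theorem volCoeff_smul (q : Param) {M : Type*} [AddCommGroup M] [Module ℂ M] (r : ℂ) (t : W 4 → M) :
    volCoeff q (r • t) = r • volCoeff q t := by
  simp only [volCoeff, Pi.smul_apply]
  module

set_option maxHeartbeats 2000000 in
/-- The products `ω_b ∧ ⋆ω_a` are the same for both braidings, although the Hodge duals differ. -/
theorem volCoeff_consTensor (q : Param) (s : Bool) (a b : Fin 4) :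
    volCoeff q (consTensor b (hodgeShape q s a)) = hodgePair q b a := by
  have h0 := qc_ne_zero q
  cases s <;> fin_cases a <;>
  simp only [Fin.zero_eta, Fin.mk_one, Fin.reduceFinMk, hodgeShape, sub_eq_add_neg,
    ← neg_one_smul ℂ (basisTensor _), ← neg_smul, consTensor_add, consTensor_smul,
    consTensor_basisTensor] <;>
  fin_cases b <;>
  simp [volCoeff, basisTensor, hodgePair, lam] <;> field_simp <;> ring

set_option maxHeartbeats 2000000 in
/-- The products `⋆ω_a ∧ ω_b = -ω_a ∧ ⋆ω_b`, with the indices exchanged. -/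
theorem volCoeff_snocTensor (q : Param) (s : Bool) (a b : Fin 4) :
    volCoeff q (snocTensor b (hodgeShape q s a)) = -hodgePair q a b := by
  have h0 := qc_ne_zero q
  cases s <;> fin_cases a <;>
  simp only [Fin.zero_eta, Fin.mk_one, Fin.reduceFinMk, hodgeShape, sub_eq_add_neg,
    ← neg_one_smul ℂ (basisTensor _), ← neg_smul, snocTensor_add, snocTensor_smul,
    snocTensor_basisTensor] <;>
  fin_cases b <;>
  simp [volCoeff, basisTensor, hodgePair, lam] <;> field_simp <;> ring

/-! ### The left Laplacian -/

theorem volCoeff_smul_const (q : Param) {M : Type*} [AddCommGroup M] [Module ℂ M] (u : W 4 → ℂ)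
    (y : M) : volCoeff q (fun J => u J • y) = volCoeff q u • y :=
  volCoeff_map q ((LinearMap.id : ℂ →ₗ[ℂ] ℂ).smulRight y) u

theorem sum_consTensor_smul {M : Type*} [AddCommGroup M] [Module ℂ M] {k : ℕ} (u : W k → ℂ)
    (v : Fin 4 → M) (J : W (k + 1)) :
    ∑ b, consTensor b u J • v b = u (Fin.tail J) • v (J 0) := by
  simp [consTensor]

theorem sum_snocTensor_smul {M : Type*} [AddCommGroup M] [Module ℂ M] {k : ℕ} (u : W k → ℂ)
    (v : Fin 4 → M) (J : W (k + 1)) :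
    ∑ b, snocTensor b u J • v b = u (Fin.init J) • v (J (Fin.last k)) := by
  simp [snocTensor]

/-- The volume coefficient of `d (∑ x_a ⋆ω_a)`. -/
theorem volCoeff_thetaAnti (q : Param) (s : Bool) (x : Fin 4 → A q) :
    volCoeff q (thetaAnti q fun J => ∑ a, hodgeShape q s a J • x a)
      = ∑ a, ∑ b, hodgePair q b a • act q (L q b) (x a) := by
  have h : (thetaAnti q fun J => ∑ a, hodgeShape q s a J • x a)
      = ∑ a, ∑ b, ((fun J => consTensor b (hodgeShape q s a) J
          • (act q (L q b) (x a) + theta q b • x a))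
        + fun J => snocTensor b (hodgeShape q s a) J • (theta q b • x a)) := by
    funext J
    simp only [Finset.sum_apply, Pi.add_apply, Finset.sum_add_distrib, sum_snocTensor_smul,
      sum_consTensor_smul, thetaAnti, LinearMap.add_apply, thetaLeft_apply, thetaRight_apply,
      map_sum, map_smul, Finset.smul_sum, smul_add]
    simp only [← mul_smul, mul_comm (theta q _)]
  rw [h, volCoeff_sum]
  have h2 : ∀ a, volCoeff q (∑ b, ((fun J => consTensor b (hodgeShape q s a) J
          • (act q (L q b) (x a) + theta q b • x a))
        + fun J => snocTensor b (hodgeShape q s a) J • (theta q b • x a)))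
      = ∑ b, (hodgePair q b a • (act q (L q b) (x a) + theta q b • x a)
        + -hodgePair q a b • (theta q b • x a)) := by
    intro a
    rw [volCoeff_sum]
    refine Finset.sum_congr rfl fun b _ => ?_
    rw [volCoeff_add, volCoeff_smul_const, volCoeff_smul_const, volCoeff_consTensor,
      volCoeff_snocTensor]
  -- the terms with `θ` cancel, as `κ` is symmetric on the indices of `ω₀, ω_z`, where `θ` lives
  rw [Finset.sum_congr rfl fun a _ => h2 a]
  simp only [Fin.sum_univ_four, hodgePair, theta_0, theta_1,
    Matrix.cons_val_zero, Matrix.cons_val_one, Matrix.cons_val]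
  module

/-- The mixed terms are collected because `L_0` is central. -/
theorem sum_hodgePair (q : Param) :
    ∑ a, ∑ b, hodgePair q b a • (L q b * L q a)
      = L q 1 * L q 0 + (qc q ^ 2) • (L q 0 * L q 1) + (1 + qc q ^ 2) • (L q 3 * L q 3)
        - (2 * (qc q ^ 2 - 1)) • (L q 2 * L q 3) := by
  simp only [Fin.sum_univ_four, hodgePair, Matrix.cons_val_zero,
    Matrix.cons_val_one, Matrix.cons_val, L_two_central]
  module

/-- The left Laplacian is `-α ∑ κ_{ba} L_b L_a`, with a factor `i m |det_q Γ|` from the Hodge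
operator on four-forms and a factor `-i m α` from that on one-forms. -/
theorem lapL_eq (q : Param) (s : Bool) {α m : ℝ} (h : m ^ 2 * detAbs q α = 1) (x : A q) :
    lapL q s (stdContraction q α) m x = (-(α : ℂ)) • act q
      (L q 1 * L q 0 + (qc q ^ 2) • (L q 0 * L q 1) + (1 + qc q ^ 2) • (L q 3 * L q 3)
        - (2 * (qc q ^ 2 - 1)) • (L q 2 * L q 3)) x := by
  have hc : ((m : ℂ) ^ 2 * detAbs q α) = 1 := by exact_mod_cast h
  have ht : (fun J => ∑ a, hodgeOne q s (stdContraction q α) m a J • diff q x a)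
      = (-(Complex.I * m) * α) • fun J => ∑ a, hodgeShape q s a J • diff q x a := by
    funext J
    simp only [hodgeOne_stdContraction, Pi.smul_apply, smul_eq_mul, mul_smul, Finset.smul_sum]
  rw [lapL, starL₄, starL₁, extD_wedge, ht]
  have hw : ∀ t : T q 4, (wedge q s 4 t : T q 4) = antisym q s 4 (A q) t := fun t => rfl
  simp only [hw]
  rw [sum_hodgeTop_smul_antisym, map_smul, volCoeff_smul, volCoeff_thetaAnti, smul_smul,
    ← neg_smul, ← sum_hodgePair]
  simp only [map_sum, map_smul, map_mul, LinearMap.sum_apply, LinearMap.smul_apply,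
    Module.End.mul_apply, diff]
  congr 1
  linear_combination (α : ℂ) * m ^ 2 * detAbs q α * Complex.I_sq - α * hc

/-! ### Right multiplication of left invariant tensors -/

/-- The elements of `U_q(su(2))` with `u · y = ∑_J (rightAct u J ▷ y) ω_J` for a left invariant
tensor `u`. -/
noncomputable def rightAct (q : Param) {k : ℕ} (u : W k → ℂ) : W k → U q :=
  fun J => ∑ I, u I • fT q I J

theorem sum_cons {M : Type*} [AddCommMonoid M] {k : ℕ} (F : W (k + 1) → M) :
    ∑ I, F I = ∑ a, ∑ I : W k, F (Fin.cons a I : W (k + 1)) := by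
  rw [← (Fin.consEquiv fun _ => Fin 4).sum_comp, Fintype.sum_prod_type]
  rfl

theorem sum_snoc {M : Type*} [AddCommMonoid M] {k : ℕ} (F : W (k + 1) → M) :
    ∑ I, F I = ∑ c, ∑ I : W k, F (Fin.snoc I c : W (k + 1)) := by
  rw [← (Fin.snocEquiv fun _ => Fin 4).sum_comp, Fintype.sum_prod_type]
  rfl

theorem fT_zero (q : Param) (I J : W 0) : fT q I J = 1 := by
  simp [fT]

theorem fT_cons (q : Param) {k : ℕ} (a : Fin 4) (I : W k) (J : W (k + 1)) :
    fT q (Fin.cons a I : W (k + 1)) J = f q a (J 0) * fT q I (Fin.tail J) := by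
  simp [fT, List.ofFn_succ, Fin.tail]

theorem fT_snoc (q : Param) {k : ℕ} (c : Fin 4) (I : W k) (J : W (k + 1)) :
    fT q (Fin.snoc I c : W (k + 1)) J = fT q I (Fin.init J) * f q c (J (Fin.last k)) := by
  rw [fT, List.ofFn_succ', List.prod_concat, Fin.snoc_last]
  simp only [Fin.snoc_castSucc]
  rfl

theorem rightAct_succ (q : Param) {k : ℕ} (u : W (k + 1) → ℂ) (J : W (k + 1)) :
    rightAct q u J = ∑ a, f q a (J 0) * rightAct q (fun I => u (Fin.cons a I)) (Fin.tail J) := by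
  simp only [rightAct, sum_cons, fT_cons, Finset.mul_sum, mul_smul_comm]

theorem rightAct_consTensor (q : Param) {k : ℕ} (b : Fin 4) (u : W k → ℂ) (J : W (k + 1)) :
    rightAct q (consTensor b u) J = f q b (J 0) * rightAct q u (Fin.tail J) := by
  rw [rightAct_succ, Finset.sum_eq_single b]
  · simp [consTensor]
  · intro a _ ha
    simp [consTensor, ha, rightAct]
  · intro h
    exact absurd (Finset.mem_univ _) h

theorem rightAct_snocTensor (q : Param) {k : ℕ} (c : Fin 4) (u : W k → ℂ) (J : W (k + 1)) :
    rightAct q (snocTensor c u) J = rightAct q u (Fin.init J) * f q c (J (Fin.last k)) := by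
  rw [rightAct, sum_snoc, Finset.sum_eq_single c]
  · simp [snocTensor, rightAct, fT_snoc, Finset.sum_mul]
  · intro a _ ha
    simp [snocTensor, ha]
  · intro h
    exact absurd (Finset.mem_univ _) h

theorem braidAt_sum_mul (q : Param) (s : Bool) {k j : ℕ} (φ : Fin 4 → U q)
    (v : Fin 4 → W k → U q) (J : W k) :
    braidAt q s k j (U q) (fun I => ∑ a, φ a * v a I) J
      = ∑ a, φ a * braidAt q s k j (U q) (v a) J := by
  have h : (fun I => ∑ a, φ a * v a I) = ∑ a, fun I => φ a * v a I := by
    funext I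
    simp only [Finset.sum_apply]
  rw [h, map_sum, Finset.sum_apply]
  exact Finset.sum_congr rfl fun a _ => braidAt_map q s j (LinearMap.mulLeft ℂ (φ a)) (v a) J

/-- Right multiplication commutes with the braiding, which is a map of bimodules. -/
theorem braidAt_true_rightAct (q : Param) {k : ℕ} (j : ℕ) (u : W k → ℂ) :
    braidAt q true k j (U q) (rightAct q u) = rightAct q (braidAt q true k j ℂ u) := by
  by_cases h : j + 1 < k
  swap
  · rw [braidAt, braidAt, dif_neg h, dif_neg h, Module.End.one_apply, Module.End.one_apply]
  induction j generalizing k with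
  | zero =>
    obtain ⟨k, rfl⟩ : ∃ l, k = l + 2 := ⟨k - 2, by omega⟩
    funext J
    have e1 : ∀ (G : Fin 4 → Fin 4 → W k → ℂ) (a b : Fin 4) (K : W k),
        rightAct q (fun I => braidMix q true (fun c d => G c d I) a b) K
          = braidMix q true (fun c d => rightAct q (G c d) K) a b := by
      intro G a b K
      simp only [rightAct, braidMix, Finset.sum_smul, smul_eq_mul, mul_smul, Finset.smul_sum]
      rw [Finset.sum_comm]
      exact Finset.sum_congr rfl fun c _ => Finset.sum_comm
    have e2 : ∀ (R : Fin 4 → Fin 4 → U q) (x y : Fin 4),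
        braidMix q true (fun a b => ∑ c, f q c a * ∑ d, f q d b * R c d) x y
          = ∑ c, f q c x * ∑ d, f q d y * braidMix q true R c d := by
      intro R x y
      calc _ = ∑ a, ∑ b, braidMix q true (fun c d => f q a c * f q b d) x y * R a b := by
            simp only [braidMix, Finset.sum_mul, Finset.mul_sum, Finset.smul_sum, smul_mul_assoc,
              mul_assoc]
            exact sum_pair_comm _
        _ = _ := by
            simp only [braidMix_f_mul_f]
            simp only [braidMix, Finset.sum_mul, Finset.mul_sum, smul_mul_assoc, mul_smul_comm,
              mul_assoc]
            exact sum_pair_comm _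
    rw [braidAt_zero, rightAct_succ]
    simp only [rightAct_succ, Fin.cons_zero, Fin.tail_cons, braidAt_zero, Fin.cons_one]
    rw [e2]
    simp only [e1]
    rfl
  | succ j ih =>
    obtain ⟨k, rfl⟩ : ∃ l, k = l + 1 := ⟨k - 1, by omega⟩
    have h' : j + 1 < k := by omega
    funext J
    rw [braidAt_succ q true h', rightAct_succ]
    simp only [rightAct_succ, Fin.cons_zero, Fin.tail_cons, braidAt_succ q true h']
    rw [braidAt_sum_mul]
    simp only [ih _ h']

theorem braidAt_rightAct (q : Param) (s : Bool) {k : ℕ} (j : ℕ) (u : W k → ℂ) :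
    braidAt q s k j (U q) (rightAct q u) = rightAct q (braidAt q s k j ℂ u) := by
  cases s with
  | true => exact braidAt_true_rightAct q j u
  | false =>
    by_cases h : j + 1 < k
    swap
    · rw [braidAt, braidAt, dif_neg h, dif_neg h, Module.End.one_apply, Module.End.one_apply]
    -- the inverse of an intertwiner is an intertwiner
    have h1 : ∀ t : W k → ℂ, braidAt q true k j ℂ (braidAt q false k j ℂ t) = t := fun t =>
      LinearMap.congr_fun (braidAt_mul_not q true h) t
    have h2 : ∀ t : W k → U q,
        braidAt q false k j (U q) (braidAt q true k j (U q) t) = t := fun t =>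
      LinearMap.congr_fun (braidAt_mul_not q false h) t
    conv_lhs => rw [← h1 u]
    rw [← braidAt_true_rightAct, h2]

theorem antisym_rightAct (q : Param) (s : Bool) (u : W 4 → ℂ) :
    antisym q s 4 (U q) (rightAct q u) = rightAct q (antisym q s 4 ℂ u) := by
  have hadd : ∀ t v : W 4 → ℂ, rightAct q (t + v) = rightAct q t + rightAct q v := by
    intro t v
    funext J
    simp only [rightAct, Pi.add_apply, add_smul, Finset.sum_add_distrib]
  have hsub : ∀ t v : W 4 → ℂ, rightAct q (t - v) = rightAct q t - rightAct q v := by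
    intro t v
    funext J
    simp only [rightAct, Pi.sub_apply, sub_smul, Finset.sum_sub_distrib]
  simp only [antisym_four, Module.End.mul_apply, LinearMap.sub_apply, LinearMap.add_apply,
    Module.End.one_apply, hadd, hsub, braidAt_rightAct, map_add, map_sub]

/-- The antisymmetriser acts on the indices only, so it commutes with linear maps of the
coefficients. -/
theorem antisym_map (q : Param) (s : Bool) {M N : Type*} [AddCommGroup M] [Module ℂ M]
    [AddCommGroup N] [Module ℂ N] (φ : M →ₗ[ℂ] N) (t : W 4 → M) :
    antisym q s 4 N (fun J => φ (t J)) = fun J => φ (antisym q s 4 M t J) := by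
  have hb : ∀ j (t : W 4 → M), braidAt q s 4 j N (fun J => φ (t J))
      = fun J => φ (braidAt q s 4 j M t J) := fun j t => funext (braidAt_map q s j φ t)
  have hadd : ∀ t v : W 4 → M, (fun J => φ (t J)) + (fun J => φ (v J))
      = fun J => φ ((t + v) J) := fun t v => funext fun J => (map_add φ _ _).symm
  have hsub : ∀ t v : W 4 → M, (fun J => φ (t J)) - (fun J => φ (v J))
      = fun J => φ ((t - v) J) := fun t v => funext fun J => (map_sub φ _ _).symm
  simp only [antisym_four, Module.End.mul_apply, LinearMap.sub_apply, LinearMap.add_apply,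
    Module.End.one_apply, hadd, hsub, hb]

/-- The left and the right basis of `Ω^{⊗k}` are related by inverse matrices. -/
theorem sum_sInv_fT_mul_fT (q : Param) {k : ℕ} (J K : W k) :
    ∑ I, sInv q (fT q I J) * fT q K I = if K = J then 1 else 0 := by
  induction k with
  | zero =>
    have : K = J := Subsingleton.elim _ _
    simp [fT_zero, sInv_one, this]
  | succ k ih =>
    rw [← Fin.cons_self_tail K]
    simp only [sum_cons, fT_cons, sInv_mul, Fin.cons_zero, Fin.tail_cons]
    rw [Finset.sum_comm]
    have h : ∀ I : W k, ∑ a, sInv q (fT q I (Fin.tail J)) * sInv q (f q a (J 0))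
          * (f q (K 0) a * fT q (Fin.tail K) I)
        = if K 0 = J 0 then sInv q (fT q I (Fin.tail J)) * fT q (Fin.tail K) I else 0 := by
      intro I
      have h1 := sum_sInv_f_mul_f q (J 0) (K 0)
      calc _ = sInv q (fT q I (Fin.tail J)) * (∑ a, sInv q (f q a (J 0)) * f q (K 0) a)
            * fT q (Fin.tail K) I := by
            simp only [Finset.mul_sum, Finset.sum_mul, mul_assoc]
        _ = _ := by rw [h1]; split_ifs <;> simp
    simp only [h]
    have h2 : (Fin.cons (K 0) (Fin.tail K) : W (k + 1)) = J
        ↔ K 0 = J 0 ∧ Fin.tail K = Fin.tail J := by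
      conv_lhs => rw [← Fin.cons_self_tail J]
      exact Fin.cons_inj
    simp only [h2]
    by_cases h0 : K 0 = J 0 <;> simp [h0, ih]

/-! ### The right Laplacian -/

theorem rmul_algebraMap (q : Param) {k : ℕ} (u : W k → ℂ) (y : A q) :
    rmul q (fun I => algebraMap ℂ (A q) (u I)) y = fun J => act q (rightAct q u J) y := by
  funext J
  simp only [rmul, rightAct, map_sum, map_smul, LinearMap.sum_apply, LinearMap.smul_apply,
    ← Algebra.smul_def]

theorem antisym_rmul_algebraMap (q : Param) (s : Bool) (u : W 4 → ℂ) (y : A q) :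
    antisym q s 4 (A q) (rmul q (fun I => algebraMap ℂ (A q) (u I)) y)
      = rmul q (fun I => algebraMap ℂ (A q) (antisym q s 4 ℂ u I)) y := by
  rw [rmul_algebraMap, rmul_algebraMap, ← antisym_rightAct]
  exact antisym_map q s ((LinearMap.applyₗ y).comp (act q).toLinearMap) (rightAct q u)

/-- The right coordinates of `u · y` for a left invariant tensor `u` are `u_J y`. -/
theorem rightCoord_rmul_algebraMap (q : Param) {k : ℕ} (u : W k → ℂ) (y : A q) (J : W k) :
    rightCoord q (rmul q (fun I => algebraMap ℂ (A q) (u I)) y) J = u J • y := by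
  have h : ∑ I, sInv q (fT q I J) * rightAct q u I = u J • 1 := by
    simp only [rightAct, Finset.mul_sum, mul_smul_comm]
    rw [Finset.sum_comm]
    simp only [← Finset.smul_sum, sum_sInv_fT_mul_fT]
    simp
  have h' := congrArg (fun u => act q u y) h
  rw [rmul_algebraMap]
  simpa [rightCoord, map_sum, LinearMap.sum_apply] using h'

/-- The right linear extension of the Hodge operator on four-forms, on all four-tensors. -/
noncomputable def hodgeRight (q : Param) (s : Bool) (α m : ℝ) : T q 4 →ₗ[ℂ] A q where
  toFun t := ∑ J, hodgeTop (stdContraction q α) m (basisTensor J)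
    • rightCoord q (antisym q s 4 (A q) t) J
  map_add' t u := by
    simp only [rightCoord, map_add, Pi.add_apply, Finset.sum_add_distrib, smul_add]
  map_smul' r t := by
    simp only [rightCoord, map_smul, Pi.smul_apply, Finset.smul_sum, smul_comm r, RingHom.id_apply]

theorem hodgeRight_apply (q : Param) (s : Bool) (α m : ℝ) (t : T q 4) :
    hodgeRight q s α m t = ∑ J, hodgeTop (stdContraction q α) m (basisTensor J)
      • rightCoord q (antisym q s 4 (A q) t) J := rfl

/-- On `u · y` with `u` left invariant the right linear Hodge operator has the same factor as the
left linear one in `sum_hodgeTop_smul_antisym`. -/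
theorem hodgeRight_rmul (q : Param) (s : Bool) (α m : ℝ) (u : W 4 → ℂ) (y : A q) :
    hodgeRight q s α m (rmul q (fun I => algebraMap ℂ (A q) (u I)) y)
      = (Complex.I * m * detAbs q α * volCoeff q u) • y := by
  have h := sum_hodgeTop_smul_antisym q s α m u
  simp only [smul_eq_mul] at h
  rw [← h, hodgeRight_apply]
  simp only [antisym_rmul_algebraMap, rightCoord_rmul_algebraMap, Finset.sum_smul, mul_smul]

/-- The right derivations, moved back to the left basis. -/
theorem sum_f_mul_sInv_L (q : Param) (b : Fin 4) :
    ∑ c, f q c b * sInv q (L q c) = -L q b := by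
  have h : ∀ c, sInv q (L q c) = -∑ a, sInv q (f q a c) * L q a := fun c => by
    rw [sum_sInv_f_mul_L, neg_neg]
  simp only [h, mul_neg, Finset.sum_neg_distrib, Finset.mul_sum]
  rw [Finset.sum_comm]
  simp only [← mul_assoc, ← Finset.sum_mul, sum_f_mul_sInv_f]
  simp

/-- The exterior derivative of `u · y` for a left invariant tensor `u`, in the right basis:
`θ ⊗ u · y + u ⊗ (y θ)`, where `y θ = ∑_c ω_c · (θ_c y + S⁻¹(L_c) ▷ y)`. -/
theorem thetaAnti_rmul (q : Param) (u : W 3 → ℂ) (y : A q) :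
    thetaAnti q (rmul q (fun I => algebraMap ℂ (A q) (u I)) y)
      = ∑ c, (theta q c • rmul q (fun I => algebraMap ℂ (A q) (consTensor c u I)) y
        + rmul q (fun I => algebraMap ℂ (A q) (snocTensor c u I))
          (theta q c • y + act q (sInv q (L q c)) y)) := by
  have h1 := sum_theta_smul_f q
  have h2 := sum_f_mul_sInv_L q
  funext J
  simp only [rmul_algebraMap, thetaAnti, LinearMap.add_apply, Pi.add_apply, thetaLeft_apply,
    thetaRight_apply, Finset.sum_apply, Pi.smul_apply, rightAct_consTensor, rightAct_snocTensor]
  have e1 : ∀ z, ∑ c, theta q c • act q (f q c (J 0)) z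
      = act q (L q (J 0)) z + theta q (J 0) • z := by
    intro z
    have h := congrArg (fun u => act q u z) (h1 (J 0))
    simpa [LinearMap.sum_apply, map_sum, Algebra.algebraMap_eq_smul_one] using h
  have e2 : ∑ c, act q (f q c (J (Fin.last 3))) (theta q c • y + act q (sInv q (L q c)) y)
      = theta q (J (Fin.last 3)) • y := by
    have h := congrArg (fun u => act q u y) (h1 (J (Fin.last 3)))
    have h' := congrArg (fun u => act q u y) (h2 (J (Fin.last 3)))
    simp only [map_sum, map_smul, map_mul, map_neg, map_add, LinearMap.sum_apply,
      LinearMap.smul_apply, Module.End.mul_apply, LinearMap.neg_apply, LinearMap.add_apply,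
      Algebra.algebraMap_eq_smul_one, map_one, Module.End.one_apply] at h h'
    simp only [map_add, map_smul, Finset.sum_add_distrib, h, h']
    abel
  simp only [map_mul, Module.End.mul_apply, Finset.sum_add_distrib, e1, ← map_sum, e2, map_smul]

theorem hodgeRight_thetaAnti (q : Param) (s : Bool) (α m : ℝ) (y : Fin 4 → A q) :
    hodgeRight q s α m (thetaAnti q
        (∑ b, rmul q (fun I => algebraMap ℂ (A q) (hodgeShape q s b I)) (y b)))
      = -(Complex.I * m * detAbs q α) •
        ∑ b, ∑ c, hodgePair q b c • act q (sInv q (L q c)) (y b) := by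
  simp only [map_sum, thetaAnti_rmul, map_add, map_smul, hodgeRight_rmul, volCoeff_consTensor,
    volCoeff_snocTensor]
  simp only [Fin.sum_univ_four, hodgePair, theta_0, theta_1,
    Matrix.cons_val_zero, Matrix.cons_val_one, Matrix.cons_val]
  module

theorem rmul_smul_left (q : Param) {k : ℕ} (r : ℂ) (t : T q k) (y : A q) :
    rmul q (r • t) y = r • rmul q t y := by
  funext J
  simp only [rmul, Pi.smul_apply, smul_mul_assoc, Finset.smul_sum]

/-- The right Laplacian. With right derivations `-S⁻¹(L_b)` in the place of the `L_b` it is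
`-α S⁻¹(∑ κ_{ba} L_b L_a) = -2 q α S⁻¹(L_0)`, and `L_0` is fixed by `S⁻¹`. -/
theorem lapR_eq (q : Param) (s : Bool) {α m : ℝ} (h : m ^ 2 * detAbs q α = 1) (x : A q) :
    lapR q s (stdContraction q α) m x = (-(α : ℂ)) • act q ((2 * qc q) • L q 2) x := by
  have hc : ((m : ℂ) ^ 2 * detAbs q α) = 1 := by exact_mod_cast h
  have hy : ∀ b, ∑ a, act q (sInv q (f q a b)) (diff q x a) = -act q (sInv q (L q b)) x := by
    intro b
    have h := congrArg (fun u => act q u x) (sum_sInv_f_mul_L q b)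
    simpa [LinearMap.sum_apply, map_sum, diff] using h
  have ht : ∀ b, (fun I => algebraMap ℂ (A q) (hodgeOne q s (stdContraction q α) m b I))
      = (-(Complex.I * m) * α) • fun I => algebraMap ℂ (A q) (hodgeShape q s b I) := by
    intro b
    funext J
    simp only [hodgeOne_stdContraction, Pi.smul_apply, smul_eq_mul, map_mul, Algebra.smul_def]
  have hS : sInv q (∑ b, ∑ c, hodgePair q b c • (L q b * L q c)) = (2 * qc q) • L q 2 := by
    rw [Finset.sum_comm, sum_hodgePair, laplacian_eq_L_two, sInv_smul, sInv_L_two]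
  have hsum : ∀ g : Fin 4 → U q, sInv q (∑ b, g b) = ∑ b, sInv q (g b) := by
    intro g
    simp only [Fin.sum_univ_four, sInv_add]
  simp only [hsum, sInv_smul, sInv_mul] at hS
  rw [lapR, starR₄, starR₁, extD_wedge]
  simp only [ht, hy, rmul_smul_left, ← Finset.smul_sum]
  have hw : ∀ t : T q 4, (wedge q s 4 t : T q 4) = antisym q s 4 (A q) t := fun t => rfl
  simp only [hw, ← hodgeRight_apply]
  rw [map_smul, map_smul, hodgeRight_thetaAnti, ← hS]
  simp only [map_neg, smul_neg, map_sum, map_smul, map_mul, LinearMap.sum_apply,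
    LinearMap.smul_apply, Module.End.mul_apply, Finset.sum_neg_distrib, neg_smul, neg_neg]
  rw [smul_smul, ← neg_smul, ← neg_smul]
  congr 1
  linear_combination (α : ℂ) * m ^ 2 * detAbs q α * Complex.I_sq - α * hc

/-! ### The right action of `K` and `E` -/

/-- Generator-wise rescaling `c, a* ↦ t·c, t·a*` and `a, c* ↦ t⁻¹·a, t⁻¹·c*`. -/
noncomputable def kScaleR (q : Param) (t : ℂ) (ht : t ≠ 0) : A q →ₐ[ℂ] A q :=
  liftA q (fun
      | .a => t⁻¹ • gen q .a
      | .c => t • gen q .c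
      | .as => t • gen q .as
      | .cs => t⁻¹ • gen q .cs)
    (by simp only [smul_mul_smul_comm, gen_ac]; module)
    (by simp only [smul_mul_smul_comm, gen_acs]; module)
    (by simp only [smul_mul_smul_comm, gen_csas]; module)
    (by simp only [smul_mul_smul_comm, gen_cas]; module)
    (by simp only [smul_mul_smul_comm, gen_ccs]; module)
    (by simp only [smul_mul_smul_comm, inv_mul_cancel₀ ht, mul_inv_cancel₀ ht, one_smul, gen_asa])
    (by simp only [smul_mul_smul_comm, mul_inv_cancel₀ ht, inv_mul_cancel₀ ht, one_smul, gen_ccs,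
      gen_aas])

/-- `x ↦ x ◁ K`. -/
noncomputable def kR (q : Param) : A q →ₐ[ℂ] A q := kScaleR q (qh q) (qh_ne_zero q)

/-- `x ↦ x ◁ K⁻¹`. -/
noncomputable def kiR (q : Param) : A q →ₐ[ℂ] A q :=
  kScaleR q (qh q)⁻¹ (inv_ne_zero (qh_ne_zero q))

theorem kR_gen (q : Param) :
    kR q (gen q .a) = (qh q)⁻¹ • gen q .a ∧ kR q (gen q .c) = qh q • gen q .c ∧
    kR q (gen q .as) = qh q • gen q .as ∧ kR q (gen q .cs) = (qh q)⁻¹ • gen q .cs := by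
  refine ⟨?_, ?_, ?_, ?_⟩ <;> rw [kR, kScaleR, liftA_gen]

theorem kiR_gen (q : Param) :
    kiR q (gen q .a) = qh q • gen q .a ∧ kiR q (gen q .c) = (qh q)⁻¹ • gen q .c ∧
    kiR q (gen q .as) = (qh q)⁻¹ • gen q .as ∧ kiR q (gen q .cs) = qh q • gen q .cs := by
  refine ⟨?_, ?_, ?_, ?_⟩ <;> rw [kiR, kScaleR, liftA_gen] <;> simp only [inv_inv]

theorem eR_gen (q : Param) :
    eR q (gen q .a) = 0 ∧ eR q (gen q .c) = gen q .a ∧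
    eR q (gen q .as) = -(qc q • gen q .cs) ∧ eR q (gen q .cs) = 0 := by
  refine ⟨?_, ?_, ?_, ?_⟩ <;>
  · change (eRMat q _) 0 1 = _
    rw [eRMat, liftA_gen]
    simp [upper]

/-- The matrix of which `eR` is a corner: its diagonal consists of `◁ K⁻¹` and `◁ K`. -/
theorem eRMat_eq (q : Param) (x : A q) : eRMat q x = upper (kiR q x) (eR q x) (kR q x) := by
  have h : ∀ x, eRMat q x 0 0 = kiR q x ∧ eRMat q x 1 0 = 0 ∧ eRMat q x 1 1 = kR q x := by
    intro x
    induction x using A_induction with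
    | hs r =>
      simp only [AlgHom.commutes]
      simp [Matrix.algebraMap_matrix_apply]
    | hg x =>
      have hk := kR_gen q
      have hi := kiR_gen q
      rw [eRMat, liftA_gen]
      cases x <;> simp [upper, hk, hi]
    | hm x y hx hy =>
      simp [Matrix.mul_apply, Fin.sum_univ_two, hx, hy]
    | ha x y hx hy => simp [hx, hy]
  ext i j
  fin_cases i <;> fin_cases j <;> simp [upper, h] <;> rfl

/-- The twisted Leibniz rule of the right action of `E`. -/
theorem eR_mul (q : Param) (x y : A q) :
    eR q (x * y) = eR q x * kR q y + kiR q x * eR q y := by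
  have h : eRMat q (x * y) 0 1 = (eRMat q x * eRMat q y) 0 1 := by rw [map_mul]
  rw [eRMat_eq, eRMat_eq, eRMat_eq, upper_mul] at h
  simpa [upper, add_comm] using h

theorem eR_algebraMap (q : Param) (r : ℂ) : eR q (algebraMap ℂ (A q) r) = 0 := by
  change eRMat q _ 0 1 = 0
  rw [AlgHom.commutes]
  simp [Matrix.algebraMap_matrix_apply]

theorem kiR_kR (q : Param) (x : A q) : kiR q (kR q x) = x := by
  have h : (kiR q).comp (kR q) = AlgHom.id ℂ (A q) := by
    apply A_algHom_ext
    have hk := kR_gen q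
    have hi := kiR_gen q
    intro x
    cases x <;> simp [hk, hi, smul_smul, qh_ne_zero q]
  exact congrArg (fun φ : A q →ₐ[ℂ] A q => φ x) h

theorem kR_kiR (q : Param) (x : A q) : kR q (kiR q x) = x := by
  have h : (kR q).comp (kiR q) = AlgHom.id ℂ (A q) := by
    apply A_algHom_ext
    have hk := kR_gen q
    have hi := kiR_gen q
    intro x
    cases x <;> simp [hk, hi, smul_smul, qh_ne_zero q]
  exact congrArg (fun φ : A q →ₐ[ℂ] A q => φ x) h

theorem kR_eR (q : Param) (x : A q) : kR q (eR q x) = (qc q)⁻¹ • eR q (kR q x) := by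
  induction x using A_induction with
  | hs r => simp only [AlgHom.commutes, eR_algebraMap, map_zero, smul_zero]
  | hg x =>
    have h0 := qh_ne_zero q
    cases x <;> simp only [kR_gen, eR_gen, map_smul, map_neg, map_zero, smul_zero,
      ← qh_mul_qh] <;> match_scalars <;> field_simp
  | hm x y hx hy =>
    simp only [eR_mul, map_mul, map_add, hx, hy, kR_kiR, kiR_kR, smul_add, smul_mul_assoc,
      mul_smul_comm]
  | ha x y hx hy => simp only [map_add, hx, hy, smul_add]

theorem algHom_comm_of_gen (q : Param) {φ ψ : A q →ₐ[ℂ] A q}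
    (h : ∀ x, φ (ψ (gen q x)) = ψ (φ (gen q x))) (x : A q) : φ (ψ x) = ψ (φ x) := by
  have h' : φ.comp ψ = ψ.comp φ := A_algHom_ext q h
  exact congrArg (fun χ : A q →ₐ[ℂ] A q => χ x) h'

theorem kL_kR (q : Param) (x : A q) : kL q (kR q x) = kR q (kL q x) := by
  refine algHom_comm_of_gen q (fun x => ?_) x
  cases x <;> simp only [kL_gen, kR_gen, map_smul] <;> exact smul_comm _ _ _

theorem kL_kiR (q : Param) (x : A q) : kL q (kiR q x) = kiR q (kL q x) := by
  refine algHom_comm_of_gen q (fun x => ?_) x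
  cases x <;> simp only [kL_gen, kiR_gen, map_smul] <;> exact smul_comm _ _ _

theorem kiL_kR (q : Param) (x : A q) : kiL q (kR q x) = kR q (kiL q x) := by
  refine algHom_comm_of_gen q (fun x => ?_) x
  cases x <;> simp only [kiL_gen, kR_gen, map_smul] <;> exact smul_comm _ _ _

theorem kiL_kiR (q : Param) (x : A q) : kiL q (kiR q x) = kiR q (kiL q x) := by
  refine algHom_comm_of_gen q (fun x => ?_) x
  cases x <;> simp only [kiL_gen, kiR_gen, map_smul] <;> exact smul_comm _ _ _

theorem kL_eR (q : Param) (x : A q) : kL q (eR q x) = eR q (kL q x) := by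
  induction x using A_induction with
  | hs r => simp only [AlgHom.commutes, eR_algebraMap, map_zero]
  | hg x => cases x <;> simp only [kL_gen, eR_gen, map_smul, map_neg, map_zero] <;> module
  | hm x y hx hy => simp only [eR_mul, map_mul, map_add, hx, hy, kL_kR, kL_kiR]
  | ha x y hx hy => simp only [map_add, hx, hy]

theorem kiL_eR (q : Param) (x : A q) : kiL q (eR q x) = eR q (kiL q x) := by
  induction x using A_induction with
  | hs r => simp only [AlgHom.commutes, eR_algebraMap, map_zero]
  | hg x => cases x <;> simp only [kiL_gen, eR_gen, map_smul, map_neg, map_zero] <;> module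
  | hm x y hx hy => simp only [eR_mul, map_mul, map_add, hx, hy, kiL_kR, kiL_kiR]
  | ha x y hx hy => simp only [map_add, hx, hy]

theorem eL_kR (q : Param) (x : A q) : eL q (kR q x) = kR q (eL q x) := by
  induction x using A_induction with
  | hs r => simp only [AlgHom.commutes, eL_algebraMap, map_zero]
  | hg x => cases x <;> simp only [kR_gen, eL_gen, map_smul, map_neg, map_zero] <;> module
  | hm x y hx hy => simp only [eL_mul, map_mul, map_add, hx, hy, kL_kR, kiL_kR]
  | ha x y hx hy => simp only [map_add, hx, hy]

theorem eL_kiR (q : Param) (x : A q) : eL q (kiR q x) = kiR q (eL q x) := by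
  rw [← kiR_kR q (eL q (kiR q x)), ← eL_kR, kR_kiR]

theorem fL_kR (q : Param) (x : A q) : fL q (kR q x) = kR q (fL q x) := by
  induction x using A_induction with
  | hs r => simp only [AlgHom.commutes, fL_algebraMap, map_zero]
  | hg x => cases x <;> simp only [kR_gen, fL_gen, map_smul, map_neg, map_zero] <;> module
  | hm x y hx hy => simp only [fL_mul, map_mul, map_add, hx, hy, kL_kR, kiL_kR]
  | ha x y hx hy => simp only [map_add, hx, hy]

theorem fL_kiR (q : Param) (x : A q) : fL q (kiR q x) = kiR q (fL q x) := by
  rw [← kiR_kR q (fL q (kiR q x)), ← fL_kR, kR_kiR]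

theorem eL_eR (q : Param) (x : A q) : eL q (eR q x) = eR q (eL q x) := by
  induction x using A_induction with
  | hs r => simp only [eL_algebraMap, eR_algebraMap, map_zero]
  | hg x => cases x <;> simp only [eR_gen, eL_gen, map_smul, map_neg, map_zero, smul_zero, neg_zero]
  | hm x y hx hy =>
    simp only [eR_mul, eL_mul, map_add, hx, hy, kL_eR, kiL_eR, eL_kR, eL_kiR, kL_kR,
      kiL_kiR]
    abel
  | ha x y hx hy => simp only [map_add, hx, hy]

theorem fL_eR (q : Param) (x : A q) : fL q (eR q x) = eR q (fL q x) := by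
  induction x using A_induction with
  | hs r => simp only [fL_algebraMap, eR_algebraMap, map_zero]
  | hg x =>
    have h0 := qc_ne_zero q
    cases x <;> simp only [eR_gen, fL_gen, map_smul, map_neg, map_zero, smul_zero, neg_zero,
      smul_neg, neg_neg, smul_smul, mul_inv_cancel₀ h0, one_smul]
  | hm x y hx hy =>
    simp only [eR_mul, fL_mul, map_add, hx, hy, kL_eR, kiL_eR, fL_kR, fL_kiR, kL_kR,
      kiL_kiR]
    abel
  | ha x y hx hy => simp only [map_add, hx, hy]

theorem act_L_two_apply (q : Param) (x : A q) : act q (L q 2) x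
    = (lam q ^ 2)⁻¹ • (qc q • (kL q (kL q x) - x) + (qc q)⁻¹ • (kiL q (kiL q x) - x))
      + fL q (eL q x) := by
  simp only [L, Matrix.cons_val, map_add, map_smul, map_sub, map_mul, map_one, act_K, act_Ki,
    act_E, act_F, LinearMap.add_apply, LinearMap.smul_apply, LinearMap.sub_apply,
    Module.End.mul_apply, Module.End.one_apply, AlgHom.toLinearMap_apply]

/-- The left and the right action commute. -/
theorem act_L_two_eR (q : Param) (x : A q) :
    act q (L q 2) (eR q x) = eR q (act q (L q 2) x) := by
  simp only [act_L_two_apply, map_add, map_smul, map_sub, kL_eR, kiL_eR, eL_eR, fL_eR]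

/-! ### Eigenvalues of the Casimir element -/

theorem as_mul_c (q : Param) : gen q .as * gen q .c = (qc q)⁻¹ • (gen q .c * gen q .as) := by
  rw [gen_cas, smul_smul, inv_mul_cancel₀ (qc_ne_zero q), one_smul]

theorem as_pow_mul_c (q : Param) (t : ℕ) :
    gen q .as ^ t * gen q .c = ((qc q)⁻¹ ^ t) • (gen q .c * gen q .as ^ t) := by
  induction t with
  | zero => simp
  | succ t ih =>
    rw [pow_succ, mul_assoc, as_mul_c, mul_smul_comm, ← mul_assoc, ih, smul_mul_assoc, smul_smul,
      mul_assoc, pow_succ' _ t]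

theorem eL_c_pow (q : Param) (s : ℕ) : eL q (gen q .c ^ (s + 1))
    = ((qh q)⁻¹ ^ s * (((qh q ^ 2) ^ (s + 1) - ((qh q ^ 2)⁻¹) ^ (s + 1)) / lam q))
      • (gen q .c ^ s * gen q .as) := by
  have h0 := qh_ne_zero q
  have h1 := qh_pow_four_sub_one_ne_zero q
  induction s with
  | zero =>
    simp only [zero_add, pow_one, pow_zero, one_mul, eL_gen, lam_eq_qh]
    match_scalars
    field_simp
  | succ s ih =>
    rw [pow_succ _ (s + 1), eL_mul, ih, map_pow, (kL_gen q).2.1, (kiL_gen q).2.1, (eL_gen q).2.1,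
      smul_pow, smul_mul_assoc, smul_mul_assoc, mul_smul_comm, mul_assoc, as_mul_c, mul_smul_comm,
      ← mul_assoc (gen q .c ^ s), ← pow_succ (gen q .c) s, lam_eq_qh, qc_eq_qh]
    match_scalars
    have hx := pow_ne_zero s h0
    simp only [inv_pow, ← pow_mul, mul_add, mul_one]
    simp only [pow_add, pow_mul' _ 2 s]
    generalize qh q ^ s = X at hx ⊢
    field_simp
    ring

theorem fL_as_pow (q : Param) (t : ℕ) : fL q (gen q .as ^ (t + 1))
    = ((qh q)⁻¹ ^ t * (((qh q ^ 2) ^ (t + 1) - ((qh q ^ 2)⁻¹) ^ (t + 1)) / lam q))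
      • (gen q .c * gen q .as ^ t) := by
  have h0 := qh_ne_zero q
  have h1 := qh_pow_four_sub_one_ne_zero q
  induction t with
  | zero =>
    simp only [zero_add, pow_one, pow_zero, mul_one, fL_gen, lam_eq_qh]
    match_scalars
    field_simp
  | succ t ih =>
    rw [pow_succ _ (t + 1), fL_mul, ih, map_pow, (kL_gen q).2.2.1, (kiL_gen q).2.2.1,
      (fL_gen q).2.2.1, smul_pow, smul_mul_assoc, smul_mul_assoc, mul_smul_comm, mul_assoc,
      ← pow_succ, as_pow_mul_c, lam_eq_qh, qc_eq_qh]
    match_scalars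
    have hx := pow_ne_zero t h0
    simp only [inv_pow, ← pow_mul, mul_add, mul_one]
    simp only [pow_add, pow_mul' _ 2 t]
    generalize qh q ^ t = X at hx ⊢
    field_simp
    ring

/-- The eigenvalue of `L₀` on the spin `N / 2` elements, `[N / 2] [N / 2 + 1]`. -/
noncomputable def casimirValue (q : Param) (N : ℕ) : ℂ :=
  (lam q ^ 2)⁻¹ * (qc q ^ (N + 1) + ((qc q)⁻¹) ^ (N + 1) - qc q - (qc q)⁻¹)

theorem kL_c_pow_mul_as_pow (q : Param) (s t : ℕ) : kL q (gen q .c ^ s * gen q .as ^ t)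
    = ((qh q)⁻¹ ^ s * qh q ^ t) • (gen q .c ^ s * gen q .as ^ t) := by
  rw [map_mul, map_pow, map_pow, (kL_gen q).2.1, (kL_gen q).2.2.1, smul_pow, smul_pow,
    smul_mul_smul_comm]

theorem kiL_c_pow_mul_as_pow (q : Param) (s t : ℕ) : kiL q (gen q .c ^ s * gen q .as ^ t)
    = (qh q ^ s * (qh q)⁻¹ ^ t) • (gen q .c ^ s * gen q .as ^ t) := by
  rw [map_mul, map_pow, map_pow, (kiL_gen q).2.1, (kiL_gen q).2.2.1, smul_pow, smul_pow,
    smul_mul_smul_comm]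

theorem fL_eL_c_pow_mul_as_pow (q : Param) (s t : ℕ) :
    fL q (eL q (gen q .c ^ s * gen q .as ^ t))
      = (((qh q ^ 2) ^ s - ((qh q ^ 2)⁻¹) ^ s) / lam q
          * (((qh q ^ 2) ^ (t + 1) - ((qh q ^ 2)⁻¹) ^ (t + 1)) / lam q))
        • (gen q .c ^ s * gen q .as ^ t) := by
  have h0 := qh_ne_zero q
  have h1 := qh_pow_four_sub_one_ne_zero q
  have hE : ∀ t, eL q (gen q .as ^ t) = 0 := by
    intro t
    induction t with
    | zero => simpa using eL_algebraMap q 1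
    | succ t ih => rw [pow_succ, eL_mul, ih, (eL_gen q).2.2.1, zero_mul, mul_zero, add_zero]
  have hF : ∀ s, fL q (gen q .c ^ s) = 0 := by
    intro s
    induction s with
    | zero => simpa using fL_algebraMap q 1
    | succ s ih => rw [pow_succ, fL_mul, ih, (fL_gen q).2.1, zero_mul, mul_zero, add_zero]
  rw [eL_mul, hE, mul_zero, add_zero]
  cases s with
  | zero =>
    have h := eL_algebraMap q 1
    rw [map_one] at h
    simp [h]
  | succ s =>
    rw [eL_c_pow, map_pow, (kL_gen q).2.2.1, smul_pow, smul_mul_smul_comm,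
      mul_assoc (gen q .c ^ s), ← pow_succ',
      map_smul, fL_mul, hF, zero_mul, zero_add, fL_as_pow, map_pow, (kiL_gen q).2.1, smul_pow,
      smul_mul_smul_comm, ← mul_assoc (gen q .c ^ s), ← pow_succ (gen q .c) s, lam_eq_qh]
    match_scalars
    have hx := pow_ne_zero s h0
    have hy := pow_ne_zero t h0
    simp only [inv_pow, ← pow_mul, mul_add, mul_one]
    simp only [pow_add, pow_mul' _ 2 s, pow_mul' _ 2 t]
    generalize qh q ^ s = X at hx ⊢
    generalize qh q ^ t = Y at hy ⊢
    field_simp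

/-- The elements `c^s (a^*)^t` are eigenvectors of `L_0`, with an eigenvalue that depends on the
degree `s + t` only. The term `FE` is diagonal on them, as `E` kills `a^*` and `F` kills `c`. -/
theorem act_L_two_c_pow_mul_as_pow (q : Param) (s t : ℕ) :
    act q (L q 2) (gen q .c ^ s * gen q .as ^ t)
      = casimirValue q (s + t) • (gen q .c ^ s * gen q .as ^ t) := by
  have h0 := qh_ne_zero q
  have h1 := qh_pow_four_sub_one_ne_zero q
  rw [act_L_two_apply, fL_eL_c_pow_mul_as_pow, kL_c_pow_mul_as_pow, map_smul, kL_c_pow_mul_as_pow,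
    kiL_c_pow_mul_as_pow, map_smul, kiL_c_pow_mul_as_pow, casimirValue, lam_eq_qh, qc_eq_qh]
  match_scalars
  have hx := pow_ne_zero s h0
  have hy := pow_ne_zero t h0
  simp only [inv_pow, ← pow_mul, mul_add, mul_one]
  simp only [pow_add, pow_mul' _ 2 s, pow_mul' _ 2 t]
  generalize qh q ^ s = X at hx ⊢
  generalize qh q ^ t = Y at hy ⊢
  field_simp
  ring

/-! ### The strings of the right action -/

/-- The vectors `y, y ◁ E, …, y ◁ E^N` form a string of length `N + 1` which ends in a multiple of
`y'`. -/
structure IsString (q : Param) (N : ℕ) (y y' : A q) : Prop where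
  weight : kR q y = qh q ^ N • y
  top : ∃ r : ℂ, r ≠ 0 ∧ (eR q ^ N) y = r • y'
  ends : (eR q ^ (N + 1)) y = 0

theorem kR_eR_pow (q : Param) {y : A q} {r : ℂ} (h : kR q y = r • y) (n : ℕ) :
    kR q ((eR q ^ n) y) = ((qc q)⁻¹ ^ n * r) • (eR q ^ n) y := by
  induction n with
  | zero => simpa using h
  | succ n ih =>
    rw [pow_succ', Module.End.mul_apply, kR_eR, ih, map_smul, smul_smul, pow_succ', mul_assoc]

theorem isString_one (q : Param) : IsString q 0 1 1 := by
  refine ⟨by simp, ⟨1, one_ne_zero, by simp⟩, ?_⟩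
  simpa using eR_algebraMap q 1

/-- A string is prolonged by multiplication with an element that generates a string of length
two. -/
theorem IsString.mul {q : Param} {N : ℕ} {y y' z z' : A q} (hy : IsString q N y y')
    (hz : kR q z = qh q • z) (hz' : kR q z' = (qh q)⁻¹ • z') (he : eR q z = z')
    (he' : eR q z' = 0) : IsString q (N + 1) (y * z) (y' * z') := by
  have h0 := qh_ne_zero q
  obtain ⟨r, hr, hr'⟩ := hy.top
  have hpos : 0 < Real.sqrt q := Real.sqrt_pos.2 q.2.1
  have hki : ∀ n, kiR q ((eR q ^ n) y) = ((qc q) ^ n * (qh q ^ N)⁻¹) • (eR q ^ n) y := by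
    intro n
    have h := congrArg (kiR q) (kR_eR_pow q hy.weight n)
    rw [kiR_kR, map_smul] at h
    have h1 := qc_ne_zero q
    conv_rhs => rw [h]
    rw [smul_smul, inv_pow, show qc q ^ n * (qh q ^ N)⁻¹ * ((qc q ^ n)⁻¹ * qh q ^ N) = 1 by
      field_simp, one_smul]
  have e1 : ∀ m w, (eR q ^ (m + 1)) w = eR q ((eR q ^ m) w) := fun m w => by
    rw [pow_succ', Module.End.mul_apply]
  -- the mixed coefficient is a sum of positive numbers, so it never vanishes
  have key : ∀ n, ∃ β : ℝ, 0 < β ∧ (eR q ^ (n + 1)) (y * z)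
      = qh q ^ (n + 1) • ((eR q ^ (n + 1)) y * z) + (β : ℂ) • ((eR q ^ n) y * z') := by
    intro n
    induction n with
    | zero =>
      refine ⟨(Real.sqrt q ^ N)⁻¹, by positivity, ?_⟩
      have h := hki 0
      simp only [pow_zero, Module.End.one_apply, one_mul] at h
      rw [zero_add, pow_one, eR_mul, hz, he, h, pow_one, mul_smul_comm, smul_mul_assoc]
      simp [qh]
    | succ n ih =>
      obtain ⟨β, hβ, h⟩ := ih
      refine ⟨Real.sqrt q ^ (n + 1) * ((q : ℝ) ^ (n + 1) * (Real.sqrt q ^ N)⁻¹)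
        + (Real.sqrt q)⁻¹ * β, ?_, ?_⟩
      · have := q.2.1
        positivity
      · rw [e1 (n + 1) (y * z), h, map_add, map_smul, map_smul, eR_mul, eR_mul, hz, he, hz', he',
          mul_zero, add_zero, hki, ← e1, ← e1]
        push_cast
        simp only [mul_smul_comm, smul_mul_assoc, smul_add, smul_smul, qh, qc]
        match_scalars <;> ring
  refine ⟨?_, ?_, ?_⟩
  · rw [map_mul, hy.weight, hz, smul_mul_smul_comm, pow_succ]
  · obtain ⟨β, hβ, h⟩ := key N
    refine ⟨β * r, mul_ne_zero (by exact_mod_cast hβ.ne') hr, ?_⟩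
    rw [h, hy.ends, hr', zero_mul, smul_zero, zero_add, smul_mul_assoc, smul_smul]
  · obtain ⟨β, hβ, h⟩ := key (N + 1)
    rw [h, e1 (N + 1) y, hy.ends, map_zero, zero_mul, zero_mul,
      smul_zero, smul_zero, add_zero]

theorem isString_c_pow_mul_as_pow (q : Param) (s t : ℕ) :
    IsString q (s + t) (gen q .c ^ s * gen q .as ^ t)
      (gen q .a ^ s * (-(qc q • gen q .cs)) ^ t) := by
  induction t with
  | zero =>
    simp only [pow_zero, mul_one, add_zero]
    induction s with
    | zero => simpa using isString_one q
    | succ s ih =>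
      rw [pow_succ, pow_succ]
      exact ih.mul (kR_gen q).2.1 (kR_gen q).1 (eR_gen q).2.1 (eR_gen q).1
  | succ t ih =>
    rw [pow_succ, pow_succ, ← mul_assoc, ← mul_assoc]
    refine ih.mul (kR_gen q).2.2.1 ?_ (eR_gen q).2.2.1 ?_
    · rw [map_neg, map_smul, (kR_gen q).2.2.2, smul_neg, smul_comm]
    · rw [map_neg, map_smul, (eR_gen q).2.2.2, smul_zero, neg_zero]

theorem eR_pow_c_pow_mul_as_pow_ne_zero (q : Param) {s t l : ℕ} (hl : l ≤ s + t) :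
    (eR q ^ l) (gen q .c ^ s * gen q .as ^ t) ≠ 0 := by
  obtain ⟨r, hr, h⟩ := (isString_c_pow_mul_as_pow q s t).top
  intro h0
  obtain ⟨m, hm⟩ := Nat.exists_eq_add_of_le hl
  rw [hm, add_comm, pow_add, Module.End.mul_apply, h0, map_zero] at h
  rw [← neg_smul, smul_pow, mul_smul_comm, smul_smul] at h
  refine smul_ne_zero (mul_ne_zero hr (pow_ne_zero t (neg_ne_zero.2 (qc_ne_zero q))))
    (gen_a_pow_mul_cs_pow_ne_zero q s t) h.symm

/-! ### Linear independence of the eigenvectors -/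

/-- Joint eigenvectors of a family of operators with distinct systems of eigenvalues are linearly
independent. -/
theorem linearIndependent_of_joint_eigenvectors {V ι κ : Type*} [AddCommGroup V] [Module ℂ V]
    (φ : κ → Module.End ℂ V) (v : ι → V) (χ : ι → κ → ℂ) (hv : ∀ i, v i ≠ 0)
    (h : ∀ i k, φ k (v i) = χ i k • v i) (hχ : Function.Injective χ) :
    LinearIndependent ℂ v := by
  classical
  rw [linearIndependent_iff']
  intro S
  induction S using Finset.strongInduction with
  | H S ih =>
    intro r hr i hi
    by_cases hS : ∃ j ∈ S, j ≠ i
    · obtain ⟨j, hj, hji⟩ := hS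
      obtain ⟨k, hk⟩ := Function.ne_iff.1 (hχ.ne hji)
      -- the operator `φ k - χ j k` removes the `j`-th term
      have h2 : ∑ x ∈ S.erase j, (r x * (χ x k - χ j k)) • v x = 0 := by
        have h3 := congrArg (fun w => φ k w - χ j k • w) hr
        simp only [map_sum, map_smul, h, Finset.smul_sum, ← Finset.sum_sub_distrib, map_zero,
          smul_zero, sub_zero] at h3
        rw [← Finset.add_sum_erase _ _ hj] at h3
        rw [← h3, smul_comm (χ j k), sub_self, zero_add]
        exact Finset.sum_congr rfl fun x _ => by module
      have h4 := ih _ (Finset.erase_ssubset hj) _ h2 i (Finset.mem_erase.2 ⟨hji.symm, hi⟩)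
      exact (mul_eq_zero.1 h4).resolve_right (sub_ne_zero.2 hk.symm)
    · have hS' : S = {i} := by
        refine Finset.eq_singleton_iff_unique_mem.2 ⟨hi, fun j hj => ?_⟩
        by_contra hne
        exact hS ⟨j, hj, hne⟩
      rw [hS', Finset.sum_singleton] at hr
      exact (smul_eq_zero.1 hr).resolve_right (hv i)

theorem phi_ne_zero (q : Param) {n : ℤ} {j l : ℕ} (hl : l ≤ n.natAbs + 2 * j) :
    phi q n j l ≠ 0 :=
  eR_pow_c_pow_mul_as_pow_ne_zero q (by omega)

theorem eR_pow_comm {q : Param} {φ : A q → A q} (h : ∀ x, φ (eR q x) = eR q (φ x)) (l : ℕ)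
    (x : A q) : φ ((eR q ^ l) x) = (eR q ^ l) (φ x) := by
  induction l with
  | zero => simp
  | succ l ih => rw [pow_succ', Module.End.mul_apply, h, ih, Module.End.mul_apply]

theorem act_L_two_phi (q : Param) (n : ℤ) (j l : ℕ) :
    act q (L q 2) (phi q n j l) = casimirValue q (n.natAbs + 2 * j) • phi q n j l := by
  rw [phi, eR_pow_comm (act_L_two_eR q), act_L_two_c_pow_mul_as_pow, map_smul]
  congr 2
  omega

theorem kL_phi (q : Param) (n : ℤ) (j l : ℕ) : kL q (phi q n j l) = qh q ^ n • phi q n j l := by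
  have h0 := qh_ne_zero q
  rw [phi, eR_pow_comm (kL_eR q), kL_c_pow_mul_as_pow, map_smul]
  congr 1
  rw [inv_pow, ← zpow_natCast, ← zpow_natCast, ← zpow_neg, ← zpow_add₀ h0]
  congr 1
  push_cast
  omega

theorem kR_phi (q : Param) (n : ℤ) (j l : ℕ) : kR q (phi q n j l)
    = qh q ^ ((n.natAbs + 2 * j : ℕ) - 2 * (l : ℤ)) • phi q n j l := by
  have h0 := qh_ne_zero q
  rw [phi, kR_eR_pow q (isString_c_pow_mul_as_pow q _ _).weight]
  congr 1
  rw [qc_eq_qh, inv_pow, ← pow_mul, ← zpow_natCast, ← zpow_natCast, ← zpow_neg, ← zpow_add₀ h0]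
  congr 1
  omega

theorem qh_zpow_injective (q : Param) : Function.Injective fun n : ℤ => qh q ^ n := by
  intro m n h
  have h0 : 0 < Real.sqrt q := Real.sqrt_pos.2 q.2.1
  have h1 : Real.sqrt q ≠ 1 := by
    intro h
    have := q.2.2
    rw [Real.sqrt_eq_one] at h
    linarith
  have h2 : Real.sqrt q ^ m = Real.sqrt q ^ n := by
    simp only [qh] at h
    exact_mod_cast h
  exact zpow_right_injective₀ h0 h1 h2

/-- `q^{M+1} + q^{-M-1} = q^{N+1} + q^{-N-1}` forces `q^{M+1}` and `q^{N+1}` to be equal or inverse,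
and the latter is excluded by `q < 1`. -/
theorem casimirValue_injective (q : Param) : Function.Injective (casimirValue q) := by
  intro m n h
  have h0 := qc_ne_zero q
  have hl := pow_ne_zero 2 (lam_ne_zero q)
  rw [casimirValue, casimirValue] at h
  have h1 := mul_left_cancel₀ (inv_ne_zero hl) h
  simp only [sub_left_inj, inv_pow] at h1
  have hm := pow_ne_zero (m + 1) h0
  have hn := pow_ne_zero (n + 1) h0
  have h2 : (qc q ^ (m + 1) - qc q ^ (n + 1)) * (1 - qc q ^ (m + 1) * qc q ^ (n + 1)) = 0 := by
    field_simp at h1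
    linear_combination -h1
  have hr : ∀ k : ℕ, (q : ℝ) ^ (k + 1) < 1 := fun k =>
    pow_lt_one₀ q.2.1.le q.2.2 (Nat.succ_ne_zero k)
  rcases mul_eq_zero.1 h2 with h3 | h3
  · have h4 : (q : ℝ) ^ (m + 1) = (q : ℝ) ^ (n + 1) := by
      rw [sub_eq_zero, qc] at h3
      exact_mod_cast h3
    have := pow_right_injective₀ q.2.1 q.2.2.ne h4
    omega
  · exfalso
    have h4 : (q : ℝ) ^ (m + n + 1 + 1) = 1 := by
      rw [sub_eq_zero, ← pow_add, qc] at h3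
      have h5 : (1 : ℝ) = (q : ℝ) ^ (m + 1 + (n + 1)) := by exact_mod_cast h3
      exact (congrArg ((q : ℝ) ^ ·) (by omega)).trans h5.symm
    exact (hr (m + n + 1)).ne h4

/-- The eigenvalues of `K ▷`, `L_0 ▷` and `◁ K` determine `n`, then `J`, then `l`. -/
theorem linearIndependent_phi (q : Param) : LinearIndependent ℂ
    (fun p : (Σ i : ℤ × ℕ, Fin (i.1.natAbs + 2 * i.2 + 1)) => phi q p.1.1 p.1.2 p.2) := by
  refine linearIndependent_of_joint_eigenvectors
    ![(kL q).toLinearMap, act q (L q 2), (kR q).toLinearMap] _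
    (fun p => ![qh q ^ p.1.1, casimirValue q (p.1.1.natAbs + 2 * p.1.2),
      qh q ^ (((p.1.1.natAbs + 2 * p.1.2 : ℕ) : ℤ) - 2 * ((p.2 : ℕ) : ℤ))]) ?_ ?_ ?_
  · rintro ⟨⟨n, j⟩, l⟩
    exact phi_ne_zero q (Nat.lt_succ_iff.1 l.2)
  · rintro ⟨⟨n, j⟩, l⟩ k
    fin_cases k
    · exact kL_phi q n j l
    · exact act_L_two_phi q n j l
    · exact kR_phi q n j l
  · rintro ⟨⟨n, j⟩, l⟩ ⟨⟨n', j'⟩, l'⟩ h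
    have e1 : n = n' := qh_zpow_injective q (congrFun h 0)
    subst e1
    have e2 := casimirValue_injective q (congrFun h 1)
    have e3 : j = j' := by
      simp only at e2
      omega
    subst e3
    have e4 := qh_zpow_injective q (congrFun h 2)
    have e5 : l = l' := by
      apply Fin.ext
      simp only at e4
      omega
    rw [e5]

/-! ### The eigenvectors span -/

/-- The span of `1` and the generators. Its `N`-th power is the span of the words of length at
most `N`. -/
noncomputable def genSpan (q : Param) : Submodule ℂ (A q) :=
  Submodule.span ℂ (insert 1 (Set.range (gen q)))

theorem one_mem_genSpan (q : Param) : (1 : A q) ∈ genSpan q :=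
  Submodule.subset_span (Set.mem_insert _ _)

theorem gen_mem_genSpan (q : Param) (x : AGen) : gen q x ∈ genSpan q :=
  Submodule.subset_span (Set.mem_insert_of_mem _ ⟨x, rfl⟩)

theorem genSpan_pow_mono (q : Param) : Monotone fun N : ℕ => genSpan q ^ N :=
  pow_right_mono₀ (Submodule.one_le.2 (one_mem_genSpan q))

theorem exists_mem_genSpan_pow (q : Param) (x : A q) : ∃ N, x ∈ genSpan q ^ N := by
  induction x using A_induction with
  | hs r => exact ⟨0, by rw [pow_zero]; exact Submodule.algebraMap_mem r⟩
  | hg x => exact ⟨1, by rw [pow_one]; exact gen_mem_genSpan q x⟩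
  | hm x y hx hy =>
    obtain ⟨M, hM⟩ := hx
    obtain ⟨N, hN⟩ := hy
    exact ⟨M + N, by rw [pow_add]; exact Submodule.mul_mem_mul hM hN⟩
  | ha x y hx hy =>
    obtain ⟨M, hM⟩ := hx
    obtain ⟨N, hN⟩ := hy
    exact ⟨max M N, add_mem (genSpan_pow_mono q (le_max_left M N) hM)
      (genSpan_pow_mono q (le_max_right M N) hN)⟩

theorem genSpan_mem_of_gen (q : Param) (φ : A q →ₗ[ℂ] A q) (h1 : φ 1 ∈ genSpan q)
    (h : ∀ x, φ (gen q x) ∈ genSpan q) {y : A q} (hy : y ∈ genSpan q) : φ y ∈ genSpan q := by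
  have : genSpan q ≤ (genSpan q).comap φ := by
    refine Submodule.span_le.2 ?_
    rintro _ (rfl | ⟨x, rfl⟩)
    · exact h1
    · exact h x
  exact this hy

/-- The right action of `E` does not increase the length of words. -/
theorem eR_mem_genSpan_pow (q : Param) (N : ℕ) : ∀ x ∈ genSpan q ^ N,
    eR q x ∈ genSpan q ^ N := by
  have hk : ∀ y ∈ genSpan q, kR q y ∈ genSpan q := fun y hy => by
    refine genSpan_mem_of_gen q (kR q).toLinearMap (by simpa using one_mem_genSpan q) ?_ hy
    rintro (_ | _ | _ | _) <;>
      simp only [AlgHom.toLinearMap_apply, kR_gen] <;>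
      exact Submodule.smul_mem _ _ (gen_mem_genSpan q _)
  have hi : ∀ y ∈ genSpan q, kiR q y ∈ genSpan q := fun y hy => by
    refine genSpan_mem_of_gen q (kiR q).toLinearMap (by simpa using one_mem_genSpan q) ?_ hy
    rintro (_ | _ | _ | _) <;>
      simp only [AlgHom.toLinearMap_apply, kiR_gen] <;>
      exact Submodule.smul_mem _ _ (gen_mem_genSpan q _)
  have he : ∀ y ∈ genSpan q, eR q y ∈ genSpan q := fun y hy => by
    have h1 : eR q 1 = 0 := by simpa using eR_algebraMap q 1
    refine genSpan_mem_of_gen q (eR q) (by rw [h1]; exact zero_mem _) ?_ hy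
    rintro (_ | _ | _ | _) <;> simp only [eR_gen]
    · exact zero_mem _
    · exact neg_mem (Submodule.smul_mem _ _ (gen_mem_genSpan q _))
    · exact gen_mem_genSpan q _
    · exact zero_mem _
  have hkN : ∀ N, ∀ x ∈ genSpan q ^ N, kR q x ∈ genSpan q ^ N := by
    intro N
    have h : genSpan q ≤ (genSpan q).comap (kR q).toLinearMap := hk
    have h2 : (genSpan q ^ N).map (kR q).toLinearMap ≤ genSpan q ^ N := by
      rw [Submodule.map_pow]
      exact pow_le_pow_left' (Submodule.map_le_iff_le_comap.2 h) N
    exact fun x hx => h2 ⟨x, hx, rfl⟩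
  induction N with
  | zero =>
    intro x hx
    rw [pow_zero, Submodule.mem_one] at hx
    obtain ⟨r, rfl⟩ := hx
    rw [eR_algebraMap]
    exact zero_mem _
  | succ N ih =>
    intro x hx
    rw [pow_succ'] at hx ⊢
    refine Submodule.mul_induction_on hx (fun y hy z hz => ?_) fun y z hy hz => ?_
    · rw [eR_mul]
      exact add_mem (Submodule.mul_mem_mul (he y hy) (hkN N z hz))
        (Submodule.mul_mem_mul (hi y hy) (ih z hz))
    · rw [map_add]
      exact add_mem hy hz

theorem phi_mem_genSpan_pow (q : Param) (n : ℤ) (j l : ℕ) :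
    phi q n j l ∈ genSpan q ^ (n.natAbs + 2 * j) := by
  rw [phi]
  induction l with
  | zero =>
    have h : n.natAbs + 2 * j = (j + (-n).toNat) + (j + n.toNat) := by omega
    rw [pow_zero, Module.End.one_apply, h, pow_add (genSpan q)]
    exact Submodule.mul_mem_mul (Submodule.pow_mem_pow _ (gen_mem_genSpan q _) _)
      (Submodule.pow_mem_pow _ (gen_mem_genSpan q _) _)
  | succ l ih =>
    rw [pow_succ', Module.End.mul_apply]
    exact eR_mem_genSpan_pow q _ _ ih

/-- The normally ordered monomials `a^i c^j (c^*)^k`, with `a^i = (a^*)^{-i}` for negative `i`. -/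
noncomputable def monomial (q : Param) (x : ℤ × ℕ × ℕ) : A q :=
  gen q .a ^ x.1.toNat * gen q .as ^ (-x.1).toNat * (gen q .c ^ x.2.1 * gen q .cs ^ x.2.2)

/-- The degree of a normally ordered monomial. -/
def monomialDegree (x : ℤ × ℕ × ℕ) : ℕ := x.1.natAbs + x.2.1 + x.2.2

theorem mul_pow_of_mul {q : Param} {x y : A q} {r : ℂ} (h : x * y = r • (y * x)) (n : ℕ) :
    x * y ^ n = r ^ n • (y ^ n * x) := by
  induction n with
  | zero => simp
  | succ n ih =>
    rw [pow_succ, ← mul_assoc, ih, smul_mul_assoc, mul_assoc, h, mul_smul_comm, smul_smul,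
      mul_assoc, pow_succ]

theorem c_mul_a (q : Param) : gen q .c * gen q .a = (qc q)⁻¹ • (gen q .a * gen q .c) := by
  rw [gen_ac, smul_smul, inv_mul_cancel₀ (qc_ne_zero q), one_smul]

theorem cs_mul_a (q : Param) : gen q .cs * gen q .a = (qc q)⁻¹ • (gen q .a * gen q .cs) := by
  rw [gen_acs, smul_smul, inv_mul_cancel₀ (qc_ne_zero q), one_smul]

theorem mul_mul_mul_of_mul {q : Param} {x y z w : A q} {r r' : ℂ} (hy : x * y = r • (y * x))
    (hz : x * z = r' • (z * x)) : x * (y * z * w) = (r * r') • (y * z * (x * w)) := by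
  rw [show x * (y * z * w) = x * y * z * w by simp only [mul_assoc], hy, smul_mul_assoc,
    mul_assoc y x, hz, mul_smul_comm, smul_smul, smul_mul_assoc]
  simp only [mul_assoc]

theorem c_mul_monomial (q : Param) (i : ℤ) (j k : ℕ) :
    ∃ r : ℂ, gen q .c * monomial q (i, j, k) = r • monomial q (i, j + 1, k) := by
  refine ⟨(qc q)⁻¹ ^ i.toNat * qc q ^ (-i).toNat, ?_⟩
  simp only [monomial]
  rw [mul_mul_mul_of_mul (mul_pow_of_mul (c_mul_a q) _) (mul_pow_of_mul (gen_cas q) _),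
    pow_succ' (gen q .c), mul_assoc (gen q .c)]

theorem cs_mul_monomial (q : Param) (i : ℤ) (j k : ℕ) :
    ∃ r : ℂ, gen q .cs * monomial q (i, j, k) = r • monomial q (i, j, k + 1) := by
  refine ⟨(qc q)⁻¹ ^ i.toNat * qc q ^ (-i).toNat, ?_⟩
  have h : gen q .cs * gen q .c ^ j = gen q .c ^ j * gen q .cs :=
    ((show Commute (gen q .c) (gen q .cs) from gen_ccs q).pow_left j).symm
  simp only [monomial]
  rw [mul_mul_mul_of_mul (mul_pow_of_mul (cs_mul_a q) _) (mul_pow_of_mul (gen_csas q) _),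
    pow_succ' (gen q .cs), ← mul_assoc (gen q .cs), h, mul_assoc (gen q .c ^ j)]

/-- The span of the normally ordered monomials of degree at most `N`. -/
noncomputable def monomialSpan (q : Param) (N : ℕ) : Submodule ℂ (A q) :=
  Submodule.span ℂ (monomial q '' {x | monomialDegree x ≤ N})

theorem monomial_mem_monomialSpan (q : Param) {N : ℕ} {i : ℤ} {j k : ℕ}
    (h : i.natAbs + j + k ≤ N) : monomial q (i, j, k) ∈ monomialSpan q N :=
  Submodule.subset_span ⟨_, h, rfl⟩

/-- Multiplication with a generator: `c` and `c^*` are moved to their places, while `a` and `a^*`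
either raise the power or produce `a a^*` or `a^* a`, which are polynomials in `c c^*`. -/
theorem gen_mul_monomial_mem (q : Param) (x : AGen) (i : ℤ) (j k : ℕ) :
    gen q x * monomial q (i, j, k) ∈ monomialSpan q (i.natAbs + j + k + 1) := by
  -- products `c^* c` are absorbed by the last two factors
  have hcc : ∀ i' : ℤ, i'.natAbs + 1 = i.natAbs → gen q .cs * gen q .c * monomial q (i', j, k)
      ∈ monomialSpan q (i.natAbs + j + k + 1) := by
    intro i' hi
    obtain ⟨r, hr⟩ := c_mul_monomial q i' j k
    obtain ⟨r', hr'⟩ := cs_mul_monomial q i' (j + 1) k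
    rw [mul_assoc, hr, mul_smul_comm, hr']
    exact Submodule.smul_mem _ _ (Submodule.smul_mem _ _ (monomial_mem_monomialSpan q (by omega)))
  cases x with
  | a =>
    rcases le_or_gt 0 i with hi | hi
    · have h : gen q .a * monomial q (i, j, k) = monomial q (i + 1, j, k) := by
        have e1 : (i + 1).toNat = i.toNat + 1 := by omega
        have e2 : (-(i + 1)).toNat = (-i).toNat := by omega
        simp only [monomial, e1, e2, pow_succ', mul_assoc]
      rw [h]
      exact monomial_mem_monomialSpan q (by omega)
    · have h : gen q .a * monomial q (i, j, k)
          = gen q .a * gen q .as * monomial q (i + 1, j, k) := by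
        have e1 : i.toNat = 0 := by omega
        have e2 : (i + 1).toNat = 0 := by omega
        have e3 : (-i).toNat = (-(i + 1)).toNat + 1 := by omega
        simp only [monomial, e1, e2, e3, pow_succ', pow_zero, one_mul, mul_assoc]
      rw [h, gen_aas', sub_mul, one_mul, smul_mul_assoc]
      exact sub_mem (monomial_mem_monomialSpan q (by omega))
        (Submodule.smul_mem _ _ (hcc _ (by omega)))
  | as =>
    rcases le_or_gt i 0 with hi | hi
    · have h : gen q .as * monomial q (i, j, k) = monomial q (i - 1, j, k) := by
        have e1 : i.toNat = 0 := by omega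
        have e2 : (i - 1).toNat = 0 := by omega
        have e3 : (-(i - 1)).toNat = (-i).toNat + 1 := by omega
        simp only [monomial, e1, e2, e3, pow_succ', pow_zero, one_mul, mul_assoc]
      rw [h]
      exact monomial_mem_monomialSpan q (by omega)
    · have h : gen q .as * monomial q (i, j, k)
          = gen q .as * gen q .a * monomial q (i - 1, j, k) := by
        have e1 : i.toNat = (i - 1).toNat + 1 := by omega
        have e2 : (-i).toNat = 0 := by omega
        have e3 : (-(i - 1)).toNat = 0 := by omega
        simp only [monomial, e1, e2, e3, pow_succ', pow_zero, mul_assoc]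
      rw [h, gen_asa', sub_mul, one_mul]
      exact sub_mem (monomial_mem_monomialSpan q (by omega)) (hcc _ (by omega))
  | c =>
    obtain ⟨r, hr⟩ := c_mul_monomial q i j k
    rw [hr]
    exact Submodule.smul_mem _ _ (monomial_mem_monomialSpan q (by omega))
  | cs =>
    obtain ⟨r, hr⟩ := cs_mul_monomial q i j k
    rw [hr]
    exact Submodule.smul_mem _ _ (monomial_mem_monomialSpan q (by omega))

theorem monomialSpan_mono (q : Param) {M N : ℕ} (h : M ≤ N) : monomialSpan q M ≤ monomialSpan q N :=
  Submodule.span_mono (Set.image_mono fun _ hx => le_trans hx h)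

/-- Normal ordering does not increase the degree. -/
theorem genSpan_pow_le (q : Param) (N : ℕ) : genSpan q ^ N ≤ monomialSpan q N := by
  induction N with
  | zero =>
    rw [pow_zero, Submodule.one_le]
    have h : monomial q (0, 0, 0) = 1 := by simp [monomial]
    rw [← h]
    exact monomial_mem_monomialSpan q (by simp)
  | succ N ih =>
    rw [pow_succ']
    refine (mul_le_mul' le_rfl ih).trans ?_
    rw [genSpan, monomialSpan, Submodule.span_mul_span, Submodule.span_le]
    rintro _ ⟨x, hx, _, ⟨⟨i, j, k⟩, hy, rfl⟩, rfl⟩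
    have hy' : i.natAbs + j + k ≤ N := hy
    rcases hx with rfl | ⟨x, rfl⟩
    · simp only [one_mul]
      exact monomial_mem_monomialSpan q (by omega)
    · exact monomialSpan_mono q (by omega) (gen_mul_monomial_mem q x i j k)

/-- Linearly independent vectors in the span of as many vectors span the same space. -/
theorem span_range_eq_of_linearIndependent {V ι : Type*} [AddCommGroup V] [Module ℂ V] [Finite ι]
    {v w : ι → V} (hv : LinearIndependent ℂ v) (h : ∀ i, v i ∈ Submodule.span ℂ (Set.range w)) :
    Submodule.span ℂ (Set.range v) = Submodule.span ℂ (Set.range w) := by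
  classical
  have := Fintype.ofFinite ι
  have : FiniteDimensional ℂ (Submodule.span ℂ (Set.range w)) :=
    FiniteDimensional.span_of_finite ℂ (Set.finite_range w)
  refine Submodule.eq_of_le_of_finrank_le (Submodule.span_le.2 ?_) ?_
  · rintro _ ⟨i, rfl⟩
    exact h i
  · rw [finrank_span_eq_card hv]
    exact finrank_range_le_card w

/-- An injection of the normally ordered monomials into the eigenvectors which preserves degrees and
weights under both actions of `K`. The subtraction and the division by two in the second component
are exact. -/
def eigenIndex (x : ℤ × ℕ × ℕ) : Σ i : ℤ × ℕ, Fin (i.1.natAbs + 2 * i.2 + 1) :=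
  ⟨(x.2.2 - x.2.1 - x.1, (monomialDegree x - ((x.2.2 : ℤ) - x.2.1 - x.1).natAbs) / 2),
    ⟨x.1.toNat + x.2.2, by simp only [monomialDegree]; omega⟩⟩

theorem eigenIndex_degree (x : ℤ × ℕ × ℕ) :
    (eigenIndex x).1.1.natAbs + 2 * (eigenIndex x).1.2 = monomialDegree x := by
  simp only [eigenIndex, monomialDegree]
  omega

theorem eigenIndex_injective : Function.Injective eigenIndex := by
  rintro ⟨i, j, k⟩ ⟨i', j', k'⟩ h
  have h0 := eigenIndex_degree (i, j, k)
  rw [h, eigenIndex_degree] at h0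
  have h1 := congrArg (fun p => p.1.1) h
  have h2 := congrArg (fun p => (p.2 : ℕ)) h
  simp only [eigenIndex, monomialDegree] at h0 h1 h2
  have e1 : i = i' := by omega
  have e2 : j = j' := by omega
  have e3 : k = k' := by omega
  rw [e1, e2, e3]

/-- In degrees at most `N` the images of the monomials under `eigenIndex` are linearly independent
and as many as the monomials, which span, so that they span as well. -/
theorem span_phi (q : Param) : Submodule.span ℂ (Set.range
    (fun p : (Σ i : ℤ × ℕ, Fin (i.1.natAbs + 2 * i.2 + 1)) => phi q p.1.1 p.1.2 p.2)) = ⊤ := by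
  rw [eq_top_iff]
  intro x _
  obtain ⟨N, hN⟩ := exists_mem_genSpan_pow q x
  have hfin : Finite {x : ℤ × ℕ × ℕ // monomialDegree x ≤ N} := by
    refine Set.Finite.to_subtype (Set.Finite.subset
      ((Set.finite_Icc (-(N : ℤ)) N).prod ((Set.finite_Icc 0 N).prod (Set.finite_Icc 0 N))) ?_)
    rintro ⟨i, j, k⟩ h
    have h' : i.natAbs + j + k ≤ N := h
    simp only [Set.mem_prod, Set.mem_Icc]
    omega
  have hw : monomialSpan q N = Submodule.span ℂ (Set.range
      fun x : {x : ℤ × ℕ × ℕ // monomialDegree x ≤ N} => monomial q x) := by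
    rw [monomialSpan, Set.image_eq_range]
    rfl
  have hli := (linearIndependent_phi q).comp
    (fun x : {x : ℤ × ℕ × ℕ // monomialDegree x ≤ N} => eigenIndex x)
    (eigenIndex_injective.comp Subtype.val_injective)
  have h := span_range_eq_of_linearIndependent hli
    (w := fun x : {x : ℤ × ℕ × ℕ // monomialDegree x ≤ N} => monomial q x) (by
      rintro ⟨y, hy⟩
      rw [← hw]
      refine genSpan_pow_le q N (genSpan_pow_mono q hy ?_)
      rw [← eigenIndex_degree y]
      exact phi_mem_genSpan_pow q _ _ _)
  have hx := genSpan_pow_le q N hN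
  rw [hw, ← h] at hx
  refine Submodule.span_mono ?_ hx
  rintro _ ⟨y, rfl⟩
  exact ⟨eigenIndex y, rfl⟩

/-! ### Eigenvalues as `q`-numbers -/

/-- With `J = N / 2`, the eigenvalue is `[J][J + 1]`. -/
theorem qnum_mul_qnum (q : Param) (N : ℕ) :
    ((qnum q (N / 2 : ℝ) * qnum q (N / 2 + 1 : ℝ) : ℝ) : ℂ) = casimirValue q N := by
  have h0 := q.2.1
  have hx : 0 < (q : ℝ) ^ (N / 2 : ℝ) := Real.rpow_pos_of_pos h0 _
  have hxx : (q : ℝ) ^ (N / 2 : ℝ) * (q : ℝ) ^ (N / 2 : ℝ) = (q : ℝ) ^ N := by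
    rw [← Real.rpow_add h0, add_halves, Real.rpow_natCast]
  have hl : (q : ℝ) - (q : ℝ)⁻¹ ≠ 0 := by
    have h := lam_ne_zero q
    rw [lam, qc] at h
    exact_mod_cast h
  have h : qnum q (N / 2 : ℝ) * qnum q (N / 2 + 1 : ℝ)
      = (((q : ℝ) - (q : ℝ)⁻¹) ^ 2)⁻¹
        * ((q : ℝ) ^ (N + 1) + ((q : ℝ)⁻¹) ^ (N + 1) - q - (q : ℝ)⁻¹) := by
    simp only [qnum, Real.rpow_neg h0.le, Real.rpow_add h0, Real.rpow_one, inv_pow, pow_succ _ N,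
      ← hxx]
    generalize (q : ℝ) ^ (N / 2 : ℝ) = x at hx
    generalize (q : ℝ) - (q : ℝ)⁻¹ = y at hl
    have := h0.ne'
    field_simp
    ring
  rw [h, casimirValue, lam, qc]
  push_cast
  rfl

theorem act_L_two_phi_eq_qnum (q : Param) (n : ℤ) (j l : ℕ) {J : ℝ} (hJ : J = |(n : ℝ)| / 2 + j) :
    act q (L q 2) (phi q n j l)
      = ((qnum q J * qnum q (J + 1) : ℝ) : ℂ) • phi q n j l := by
  have h : J = ((n.natAbs + 2 * j : ℕ) : ℝ) / 2 := by
    rw [hJ]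
    push_cast
    rw [Nat.cast_natAbs]
    push_cast
    ring
  rw [act_L_two_phi, h, qnum_mul_qnum]

end QSU2

theorem mainTheorem4 (q : QSU2.Param) :
    (∀ h : QSU2.U q, QSU2.L q 2 * h = h * QSU2.L q 2) ∧
    QSU2.casimir q
      = QSU2.L q 2 + algebraMap ℂ (QSU2.U q) (((QSU2.qnum q (1 / 2) ^ 2 - 1 / 4 : ℝ) : ℂ)) ∧
    LinearIndependent ℂ
      (fun p : (Σ i : ℤ × ℕ, Fin (i.1.natAbs + 2 * i.2 + 1)) =>
        QSU2.phi q p.1.1 p.1.2 p.2) ∧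
    Submodule.span ℂ (Set.range
      (fun p : (Σ i : ℤ × ℕ, Fin (i.1.natAbs + 2 * i.2 + 1)) =>
        QSU2.phi q p.1.1 p.1.2 p.2)) = ⊤ ∧
    (∀ (n : ℤ) (j l : ℕ) (J : ℝ), J = |(n : ℝ)| / 2 + j → (l : ℝ) ≤ 2 * J →
      QSU2.act q (QSU2.L q 2) (QSU2.phi q n j l)
        = ((QSU2.qnum q J * QSU2.qnum q (J + 1) : ℝ) : ℂ) • QSU2.phi q n j l) ∧
    ∀ (g : Matrix (Fin 4) (Fin 4) ℂ), QSU2.IsSigmaMetric q g →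
      ∀ (s : Bool) (m : ℝ), QSU2.IsNormalised q s (QSU2.contraction g) m →
      (∀ x : QSU2.A q, QSU2.lapL q s (QSU2.contraction g) m x =
        (-(QSU2.contraction g 0 0)) • QSU2.act q
          (QSU2.L q 1 * QSU2.L q 0 + (QSU2.qc q ^ 2) • (QSU2.L q 0 * QSU2.L q 1)
            + (1 + QSU2.qc q ^ 2) • (QSU2.L q 3 * QSU2.L q 3)
            - (2 * (QSU2.qc q ^ 2 - 1)) • (QSU2.L q 2 * QSU2.L q 3)) x) ∧
      (∀ x : QSU2.A q, QSU2.lapL q s (QSU2.contraction g) m x =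
        (-(2 * QSU2.qc q * QSU2.contraction g 0 0)) • QSU2.act q (QSU2.L q 2) x) ∧
      (∀ (n : ℤ) (j l : ℕ) (J : ℝ), J = |(n : ℝ)| / 2 + j → (l : ℝ) ≤ 2 * J →
        QSU2.lapL q s (QSU2.contraction g) m (QSU2.phi q n j l) =
          (-(2 * QSU2.qc q * QSU2.contraction g 0 0)
            * ((QSU2.qnum q J * QSU2.qnum q (J + 1) : ℝ) : ℂ)) • QSU2.phi q n j l) ∧
      (∀ x : QSU2.A q, QSU2.lapR q s (QSU2.contraction g) m x
        = QSU2.lapL q s (QSU2.contraction g) m x) := by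
  refine ⟨QSU2.L_two_central q, QSU2.casimir_eq q, QSU2.linearIndependent_phi q, QSU2.span_phi q,
    fun n j l J hJ _ => QSU2.act_L_two_phi_eq_qnum q n j l hJ, ?_⟩
  intro g hg s m hm
  obtain ⟨α, hα, hΓ⟩ := hg.values
  change QSU2.contraction g = QSU2.stdContraction q α at hΓ
  have h00 : QSU2.stdContraction q α 0 0 = α := rfl
  rw [hΓ] at hm ⊢
  have hm' := hm.sq_mul_detAbs hα
  have hL : ∀ x, QSU2.lapL q s (QSU2.stdContraction q α) m x
      = (-(2 * QSU2.qc q * α)) • QSU2.act q (QSU2.L q 2) x := by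
    intro x
    rw [QSU2.lapL_eq q s hm', QSU2.laplacian_eq_L_two, map_smul, LinearMap.smul_apply, smul_smul]
    congr 1
    ring
  rw [h00]
  refine ⟨QSU2.lapL_eq q s hm', hL, fun n j l J hJ _ => ?_, fun x => ?_⟩
  · rw [hL, QSU2.act_L_two_phi_eq_qnum q n j l hJ, smul_smul]
  · rw [QSU2.lapR_eq q s hm', QSU2.lapL_eq q s hm', QSU2.laplacian_eq_L_two]
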